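/- **Setting.** Let $n\ge 1$, let $\mathcal G_1,\dots,\mathcal G_\nu$ be finitely many connected undirected graphs on $\{1,\dots,n\}$ (communication topologies) with Laplacians $\mathcal L_\ell$, let $A,D,\mathcal K\in\mathbb R^{n\times n}$ be diagonal with positive diagonal entries, and let $h\ge 0$. The directed links of each $\mathcal G_\ell$ are assigned to finitely many channels $m=1,\dots,N$, and $T_{\ell,m}$ is the sum, over the links $k\to i$ of $\mathcal G_\ell$ on channel $m$, of the matrix with entries $1$ at $(i,i)$ and $-1$ at $(i,k)$ and zeros elsewhere, so that $\sum_m T_{\ell,m}=\mathcal L_\ell$ (one link per channel is the standard case; $N=1$ gives $T_{\ell,1}=\mathcal L_\ell$). For $\kappa>0$ put $K=\kappa\mathcal K$, $\mu=\|K^{-1/2}A^{-1}\mathbf 1\|_2^2$, and let $W\in\mathbb R^{n\times(n-1)}$ have orthonormal columns, all orthogonal to $K^{-1/2}A^{-1}\mathbf 1$. Put $$\mathcal T_{\ell,m}=W^\top K^{1/2}A\,T_{\ell,m}AK^{1/2}W,\qquad \bar{\mathcal L}_\ell=W^\top K^{1/2}A\,\mathcal L_\ell AK^{1/2}W .$$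 **LMI conditions.** For $(n-1)\times(n-1)$ matrices $R_m>0$, $S_m>0$ and $S_{12,m}$ let $R,S,S_{12}$ be the block-diagonal matrices formed from them, and $\bar R=h^2\sum_m R_m$. The conditions are, for every $\ell$, $$\Psi_\ell=\begin{bmatrix}\Psi_{11}&\Psi_{12}&0&\Psi_{14}\\ *&\Psi_{22}&\Psi_{23}&\Psi_{24}\\ *&*&R+S&S_{12}+S\\ *&*&*&R+S+\Psi_{44}\end{bmatrix}>0,\qquad \begin{bmatrix}R&S_{12}\\ *&R\end{bmatrix}\ge 0,$$ where $\Psi_{11}=D-K^{1/2}W\bar RW^\top K^{1/2}$, $\Psi_{12}=K^{1/2}W\bar R\bar{\mathcal L}_\ell$, $\Psi_{22}=\bar{\mathcal L}_\ell-\bar{\mathcal L}_\ell\bar R\bar{\mathcal L}_\ell$, $\Psi_{23}=-[S_1\,\cdots\,S_N]$, $\Psi_{14}$ is the block row with blocks $-K^{1/2}W\bar R\mathcal T_{\ell,m}$, $\Psi_{24}$ is the block row with blocks $\bar{\mathcal L}_\ell\bar R\mathcal T_{\ell,m}-S_m-\tfrac12\mathcal T_{\ell,m}$, and $\Psi_{44}$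 is block diagonal with blocks $-\mathcal T_{\ell,m}^\top\bar R\mathcal T_{\ell,m}$. **System.** Consider a power network with inertias $M_i>0$ ($M=\operatorname{diag}(M_i)$), voltages $V_i>0$, symmetric susceptances $B_{ik}\le 0$ $(i\ne k)$ whose graph is connected, net injections $P^{\rm net}\in\mathbb R^n$, nominal frequency $\omega^d>0$, and potential $U(\theta)=-\sum_{\{i,k\}}|B_{ik}|V_iV_k\cos(\theta_i-\theta_k)$. Assume that the closed loop $$\dot\theta=\omega,\quad M\dot\omega=-D(\omega-\omega^d\mathbf 1)+P^{\rm net}-\nabla U(\theta)-p,\quad \dot p=K(\omega-\omega^d\mathbf 1)-KA\sum_m T_{\sigma(t),m}A\,p(t-\tau_m(t))$$ has a synchronized motion, i.e. a solution $\theta^*(t)=\theta_0^*+\omega^s\mathbf 1t$, $\omega=\omega^s\mathbf 1$, $p=p^*$ constant, for every active topology, with $|\theta^*_{0,i}-\theta^*_{0,k}|<\pi/2$ whenever $B_{ik}\ne0$. In reduced error coordinates $z=(\tilde\theta,\tilde\omega,\tilde p)\in\mathbb R^{3n-1}$ it reads $$\dot{\tilde\theta}=\tilde\omega,\quad M\dot{\tilde\omega}=-D\tilde\omega-\nabla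 U(\tilde\theta+\theta^*)+\nabla U(\theta^*)-K^{1/2}W\tilde p-\tfrac1\mu A^{-1}\mathbf 1\mathbf 1^\top A^{-1}\tilde\theta,$$ $$\dot{\tilde p}=W^\top K^{1/2}\tilde\omega-\sum_m\mathcal T_{\sigma(t),m}\,\tilde p(t-\tau_m(t)).$$ **Claim.** Let $R_m$ and $S_{12,m}$ be given such that $\begin{bmatrix}R&S_{12}\\ *&R\end{bmatrix}>0$. Then there is $\kappa_0>0$, depending only on $h,A,D,\mathcal K$, the topologies, the channel assignment, $R$ and $S_{12}$, such that for all $0<\kappa<\kappa_0$, $K=\kappa\mathcal K$, and every $W$ as above: 1. there are $S_m>0$ which, with the given $R_m,S_{12,m}$, satisfy the LMI conditions simultaneously for all $\ell$; 2. for every power network and synchronized motion as above, $z^*=0$ is a locally uniformly asymptotically stable equilibrium of the reduced error system for all uniform fast-varying delays $\tau_m(t)=\tau(t)\in[0,h]$ ($\tau$ measurable) and all (measurable) switching signals $\sigma:\mathbb R_{\ge0}\to\{1,\dots,\nu\}$. Here the stability and attraction bounds are uniform in the initial time $t_0\ge0$, in $\tau$ and in $\sigma$. -/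

import Mathlib

open Matrix

noncomputable section

open scoped Classical in
/-- The Laplacian matrix `L = (degrees) - (adjacency)` of an undirected graph. -/
def DAI.laplacian {n : ℕ} (G : SimpleGraph (Fin n)) : Matrix (Fin n) (Fin n) ℝ :=
  G.lapMatrix ℝ

open scoped Classical in
/-- Contribution of the delay channel `c` to the Laplacian of the communication graph `G`.
The directed link `k → i` of an edge `{i, k}` is transmitted over the channel `ch i k` and
contributes the matrix whose only nonzero entries are `1` at `(i, i)` and `-1` at `(i, k)`.
If `ch` is injective on the directed links, every channel carries one link (and is zero when
it is not used by `G`); if `ch` is not injective, links that share a channel share its delay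
and their matrices add up. In all cases the sum over `c` is the Laplacian. -/
def DAI.channelMatrix {n : ℕ} {C : Type*} (G : SimpleGraph (Fin n))
    (ch : Fin n → Fin n → C) (c : C) : Matrix (Fin n) (Fin n) ℝ :=
  ∑ i, ∑ k, if G.Adj i k ∧ ch i k = c then
    Matrix.single i i (1 : ℝ) - Matrix.single i k (1 : ℝ) else 0

/-- `K^{1/2}` for the diagonal matrix `K = diag(K_i)`. -/
def DAI.sqrtGain {n : ℕ} (K : Fin n → ℝ) : Matrix (Fin n) (Fin n) ℝ :=
  Matrix.diagonal fun i => Real.sqrt (K i)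

/-- The vector `K^{-1/2} A^{-1} 1`. -/
def DAI.kernelVec {n : ℕ} (K A : Fin n → ℝ) : Fin n → ℝ :=
  fun i => (Real.sqrt (K i))⁻¹ * (A i)⁻¹

/-- `μ = ‖K^{-1/2} A^{-1} 1‖₂²`. -/
def DAI.mu {n : ℕ} (K A : Fin n → ℝ) : ℝ :=
  DAI.kernelVec K A ⬝ᵥ DAI.kernelVec K A

/-- `W ∈ ℝ^{n × (n-1)}` has orthonormal columns, all orthogonal to `K^{-1/2} A^{-1} 1`. -/
def DAI.IsReduction {n : ℕ} (K A : Fin n → ℝ) (W : Matrix (Fin n) (Fin (n - 1)) ℝ) : Prop :=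
  Wᵀ * W = 1 ∧ Wᵀ *ᵥ DAI.kernelVec K A = 0

/-- `Wᵀ K^{1/2} A X A K^{1/2} W`. With `X` the Laplacian this is the reduced Laplacian, and with
`X` a channel matrix it is the reduced channel matrix. -/
def DAI.reduced {n : ℕ} (K A : Fin n → ℝ) (W : Matrix (Fin n) (Fin (n - 1)) ℝ)
    (X : Matrix (Fin n) (Fin n) ℝ) : Matrix (Fin (n - 1)) (Fin (n - 1)) ℝ :=
  Wᵀ * DAI.sqrtGain K * Matrix.diagonal A * X * Matrix.diagonal A * DAI.sqrtGain K * W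

/-- The block row `[X_1 ... X_c ...]`. -/
def DAI.blockRow {C m k : Type*} (X : C → Matrix m k ℝ) : Matrix m (k × C) ℝ :=
  Matrix.of fun i j => X j.2 i j.1

/-- The block matrix `[R, S12; *, R]` with `R = blockdiag(R_c)`, `S12 = blockdiag(S12_c)`. -/
def DAI.couplingMatrix {n : ℕ} {C : Type*} [DecidableEq C]
    (R S12 : C → Matrix (Fin (n - 1)) (Fin (n - 1)) ℝ) :
    Matrix ((Fin (n - 1) × C) ⊕ (Fin (n - 1) × C)) ((Fin (n - 1) × C) ⊕ (Fin (n - 1) × C)) ℝ :=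
  Matrix.fromBlocks (Matrix.blockDiagonal R) (Matrix.blockDiagonal S12)
    (Matrix.blockDiagonal S12)ᵀ (Matrix.blockDiagonal R)

/-- The symmetric block matrix `Ψ` of the delay-dependent stability condition, for the
communication graph `G` with channel assignment `ch` and delay bounds `h_c`. -/
def DAI.Psi {n : ℕ} {C : Type*} [Fintype C] [DecidableEq C]
    (D A K : Fin n → ℝ) (W : Matrix (Fin n) (Fin (n - 1)) ℝ)
    (G : SimpleGraph (Fin n)) (ch : Fin n → Fin n → C) (h : C → ℝ)
    (R S S12 : C → Matrix (Fin (n - 1)) (Fin (n - 1)) ℝ) :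
    Matrix ((Fin n ⊕ Fin (n - 1)) ⊕ ((Fin (n - 1) × C) ⊕ (Fin (n - 1) × C)))
      ((Fin n ⊕ Fin (n - 1)) ⊕ ((Fin (n - 1) × C) ⊕ (Fin (n - 1) × C))) ℝ :=
  let KW : Matrix (Fin n) (Fin (n - 1)) ℝ := DAI.sqrtGain K * W
  let Lbar := DAI.reduced K A W (DAI.laplacian G)
  let T : C → Matrix (Fin (n - 1)) (Fin (n - 1)) ℝ :=
    fun c => DAI.reduced K A W (DAI.channelMatrix G ch c)
  let Rbar : Matrix (Fin (n - 1)) (Fin (n - 1)) ℝ := ∑ c, (h c) ^ 2 • R c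
  let Psi11 := Matrix.diagonal D - KW * Rbar * KWᵀ
  let Psi12 := KW * Rbar * Lbar
  let Psi22 := Lbar - Lbar * Rbar * Lbar
  let Psi14 := DAI.blockRow fun c => -(KW * Rbar * T c)
  let Psi23 := -DAI.blockRow S
  let Psi24 := DAI.blockRow fun c => Lbar * Rbar * T c - S c - (1 / 2 : ℝ) • T c
  let Psi33 := Matrix.blockDiagonal R + Matrix.blockDiagonal S
  let Psi34 := Matrix.blockDiagonal S12 + Matrix.blockDiagonal S
  let Psi44 := Matrix.blockDiagonal R + Matrix.blockDiagonal S +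
    Matrix.blockDiagonal fun c => -((T c)ᵀ * Rbar * T c)
  Matrix.fromBlocks
    (Matrix.fromBlocks Psi11 Psi12 Psi12ᵀ Psi22)
    (Matrix.fromBlocks 0 Psi14 Psi23 Psi24)
    (Matrix.fromBlocks 0 Psi14 Psi23 Psi24)ᵀ
    (Matrix.fromBlocks Psi33 Psi34 Psi34ᵀ Psi44)

/-- The matrices `R_c, S_c, S12_c` solve the linear matrix inequalities of the robust stability
condition, simultaneously for all communication graphs `G ℓ`. -/
structure DAI.SolvesLMI {n : ℕ} {ι C : Type*} [Fintype C] [DecidableEq C]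
    (D A K : Fin n → ℝ) (W : Matrix (Fin n) (Fin (n - 1)) ℝ)
    (G : ι → SimpleGraph (Fin n)) (ch : ι → Fin n → Fin n → C) (h : C → ℝ)
    (R S S12 : C → Matrix (Fin (n - 1)) (Fin (n - 1)) ℝ) : Prop where
  R_pos : ∀ c, (R c).PosDef
  S_pos : ∀ c, (S c).PosDef
  Psi_pos : ∀ ℓ, (DAI.Psi D A K W (G ℓ) (ch ℓ) h R S S12).PosDef
  coupling_nonneg : (DAI.couplingMatrix R S12).PosSemidef

/-- The physical data of a Kron-reduced, lossless power network with `n` nodes, apart from the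
damping coefficients: inertias `M_i`, voltage amplitudes `V_i`, susceptances `B_ik` of a connected
electrical network, net power injections `P^net_i = P^d_i - G_ii V_i²`, nominal frequency. -/
structure DAI.PowerNetwork (n : ℕ) where
  M : Fin n → ℝ
  M_pos : ∀ i, 0 < M i
  V : Fin n → ℝ
  V_pos : ∀ i, 0 < V i
  B : Fin n → Fin n → ℝ
  B_symm : ∀ i k, B i k = B k i
  B_nonpos : ∀ i k, i ≠ k → B i k ≤ 0
  connected : (SimpleGraph.fromRel fun i k => B i k ≠ 0).Connected
  Pnet : Fin n → ℝ
  ωd : ℝ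
  ωd_pos : 0 < ωd

/-- The potential `U(θ) = - ∑_{{i,k}} |B_ik| V_i V_k cos (θ_i - θ_k)`; each unordered pair is
listed once, as `i < k`. -/
def DAI.PowerNetwork.potential {n : ℕ} (N : DAI.PowerNetwork n) (θ : Fin n → ℝ) : ℝ :=
  -∑ i, ∑ k, if i < k then |N.B i k| * N.V i * N.V k * Real.cos (θ i - θ k) else 0

/-- The active power flows `P_i(θ) = ∑_k |B_ik| V_i V_k sin (θ_i - θ_k)`, i.e. `∇U(θ)`. -/
def DAI.PowerNetwork.gradU {n : ℕ} (N : DAI.PowerNetwork n) (θ : Fin n → ℝ) : Fin n → ℝ :=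
  fun i => ∑ k, |N.B i k| * N.V i * N.V k * Real.sin (θ i - θ k)

/-- `gradU` is the gradient of the potential. -/
theorem DAI.PowerNetwork.hasDerivAt_potential {n : ℕ} (N : DAI.PowerNetwork n) (θ v : Fin n → ℝ) :
    HasDerivAt (fun s : ℝ => N.potential (θ + s • v)) (N.gradU θ ⬝ᵥ v) 0 := by
  have h : HasDerivAt (fun s : ℝ => N.potential (θ + s • v))
     (-∑ i, ∑ k, if i < k then |N.B i k| * N.V i * N.V k * (-Real.sin (θ i - θ k) * (v i - v k)) else 0) 0 := by
    unfold DAI.PowerNetwork.potential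
    refine HasDerivAt.neg ?_
    refine HasDerivAt.fun_sum fun i _ => HasDerivAt.fun_sum fun k _ => ?_
    split_ifs
    · refine HasDerivAt.const_mul _ ?_
      have h0 : HasDerivAt (fun s : ℝ => (θ + s • v) i - (θ + s • v) k) (v i - v k) 0 := by
        have := ((hasDerivAt_id (0:ℝ)).mul_const (v i - v k)).const_add (θ i - θ k)
        simp only [one_mul, id] at this
        refine this.congr_of_eventuallyEq (Filter.Eventually.of_forall fun s => ?_)
        simp; ring
      simpa using h0.cos
    · exact hasDerivAt_const _ _
  convert h using 1
  set f : Fin n → Fin n → ℝ := fun i k => |N.B i k| * N.V i * N.V k * Real.sin (θ i - θ k) with hf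
  have hanti : ∀ i k, f i k = - f k i := by
    intro i k; simp only [hf]; rw [N.B_symm i k, ← neg_sub (θ k), Real.sin_neg]; ring
  have e1 : N.gradU θ ⬝ᵥ v = ∑ i, ∑ k, f i k * v i := by
    simp [dotProduct, DAI.PowerNetwork.gradU, hf, Finset.sum_mul]
  have e2 : ∀ i k, f i k * v i = (if i < k then f i k * v i else 0) + (if k < i then f i k * v i else 0) := by
    intro i k
    rcases lt_trichotomy i k with h | h | h
    · simp [h, h.le.not_gt]
    · subst h; simp [hf]
    · simp [h, h.le.not_gt]
  rw [e1]
  rw [Finset.sum_congr rfl fun i _ => Finset.sum_congr rfl fun k _ => e2 i k]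
  simp only [Finset.sum_add_distrib]
  rw [Finset.sum_comm (f := fun i k => if k < i then f i k * v i else 0), ← Finset.sum_add_distrib, ← Finset.sum_neg_distrib]
  refine Finset.sum_congr rfl fun i _ => ?_
  rw [← Finset.sum_add_distrib, ← Finset.sum_neg_distrib]
  refine Finset.sum_congr rfl fun k _ => ?_
  split_ifs
  · rw [hanti k i]; simp only [hf]; ring
  · simp

/-- Right-hand side of the closed loop in the original coordinates `(θ, ω, p)`, when the
communication topology is `G`; `pd c` is the delayed value of `p` on channel `c`. -/
def DAI.physicalField {n : ℕ} {C : Type*} [Fintype C] (N : DAI.PowerNetwork n)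
    (D A K : Fin n → ℝ) (G : SimpleGraph (Fin n)) (ch : Fin n → Fin n → C)
    (x : (Fin n → ℝ) × (Fin n → ℝ) × (Fin n → ℝ)) (pd : C → Fin n → ℝ) :
    (Fin n → ℝ) × (Fin n → ℝ) × (Fin n → ℝ) :=
  (x.2.1,
   fun i => (N.M i)⁻¹ *
     (-(D i * (x.2.1 i - N.ωd)) + N.Pnet i - N.gradU x.1 i - x.2.2 i),
   fun i => K i * (x.2.1 i - N.ωd) -
     K i * A i * (∑ c, DAI.channelMatrix G ch c *ᵥ (Matrix.diagonal A *ᵥ pd c)) i)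

/-- `θ(t) = θ₀ + ωs t 1`, `ω = ωs 1`, `p` constant, is a synchronized motion: it solves the closed
loop for all `t ≥ 0`, whichever topology is active, and neighboring angles differ by less than
`π / 2`. (The delays play no role, since `p` is constant.) -/
structure DAI.IsSynchronizedMotion {n : ℕ} {ι C : Type*} [Fintype C] (N : DAI.PowerNetwork n)
    (D A K : Fin n → ℝ) (G : ι → SimpleGraph (Fin n)) (ch : ι → Fin n → Fin n → C)
    (θ₀ : Fin n → ℝ) (ωs : ℝ) (p : Fin n → ℝ) : Prop where
  solves : ∀ ℓ, ∀ t : ℝ, 0 ≤ t →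
    HasDerivAt (fun s : ℝ => ((fun i => θ₀ i + ωs * s, fun _ => ωs, p) :
        (Fin n → ℝ) × (Fin n → ℝ) × (Fin n → ℝ)))
      (DAI.physicalField N D A K (G ℓ) (ch ℓ)
        (fun i => θ₀ i + ωs * t, fun _ => ωs, p) (fun _ => p)) t
  angles : ∀ i k, N.B i k ≠ 0 → |θ₀ i - θ₀ k| < Real.pi / 2

/-- Reduced error states `z = (θ̃, ω̃, p̃) ∈ ℝ^{3n-1}`. -/
abbrev DAI.State (n : ℕ) : Type := (Fin n → ℝ) × (Fin n → ℝ) × (Fin (n - 1) → ℝ)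

/-- Right-hand side of the closed loop in reduced error coordinates, when the communication
topology is `G`; `pd c` is the delayed value of `p̃` on channel `c`. The vector `θs` collects the
angles of the synchronized motion at time `0`: later angles differ from them by a common shift,
which `gradU` does not see. -/
def DAI.errorField {n : ℕ} {C : Type*} [Fintype C] (N : DAI.PowerNetwork n)
    (D A K : Fin n → ℝ) (W : Matrix (Fin n) (Fin (n - 1)) ℝ) (θs : Fin n → ℝ)
    (G : SimpleGraph (Fin n)) (ch : Fin n → Fin n → C)
    (z : DAI.State n) (pd : C → Fin (n - 1) → ℝ) : DAI.State n :=
  (z.2.1,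
   fun i => (N.M i)⁻¹ *
     (-(D i * z.2.1 i) - N.gradU (z.1 + θs) i + N.gradU θs i
       - ((DAI.sqrtGain K * W) *ᵥ z.2.2) i
       - (DAI.mu K A)⁻¹ * (A i)⁻¹ * ∑ k, (A k)⁻¹ * z.1 k),
   (Wᵀ * DAI.sqrtGain K) *ᵥ z.2.1 -
     ∑ c, DAI.reduced K A W (DAI.channelMatrix G ch c) *ᵥ pd c)

/-- `z`, given on `[t₀ - h, t₁]`, is a solution on `[t₀, t₁]` (in the sense of Carathéodory) of the
switched delay system in reduced error coordinates, for the switching signal `σ` and delays `τ_c`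
with values in `[0, h]`. The values on `[t₀ - h, t₀]` are the initial function. -/
def DAI.IsSolution {n : ℕ} {ι C : Type*} [Fintype C] (N : DAI.PowerNetwork n)
    (D A K : Fin n → ℝ) (W : Matrix (Fin n) (Fin (n - 1)) ℝ) (θs : Fin n → ℝ)
    (G : ι → SimpleGraph (Fin n)) (ch : ι → Fin n → Fin n → C) (h : ℝ)
    (σ : ℝ → ι) (τ : C → ℝ → ℝ) (t₀ t₁ : ℝ) (z : ℝ → DAI.State n) : Prop :=
  ContinuousOn z (Set.Icc (t₀ - h) t₁) ∧
  ∀ t ∈ Set.Icc t₀ t₁, z t = z t₀ +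
    ∫ s in t₀..t, DAI.errorField N D A K W θs (G (σ s)) (ch (σ s)) (z s)
      (fun c => (z (s - τ c s)).2.2)

/-- An arbitrary (measurable) switching signal together with a fast-varying delay with values in
`[0, h]`: no continuity or differentiability of the delay is required. -/
structure DAI.Signal (ι : Type*) (h : ℝ) where
  σ : ℝ → ι
  σ_meas : ∀ ℓ, MeasurableSet (σ ⁻¹' {ℓ})
  τ : ℝ → ℝ
  τ_meas : Measurable τ
  τ_mem : ∀ t, τ t ∈ Set.Icc 0 h

/-- Local uniform asymptotic stability of the zero equilibrium for a family of delay systems with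
maximal delay `h`: `Sol j t₀ t₁ z` says that `z` solves system `j` on `[t₀, t₁]`. All bounds are
uniform in the initial time `t₀ ≥ 0` and in the member `j` of the family. Since `t₁` is arbitrary,
the bounds apply to solutions on bounded intervals and to global solutions alike. -/
structure DAI.IsLUAS {J E : Type*} [NormedAddCommGroup E] (h : ℝ)
    (Sol : J → ℝ → ℝ → (ℝ → E) → Prop) : Prop where
  equilibrium : ∀ j t₀ t₁, 0 ≤ t₀ → t₀ ≤ t₁ → Sol j t₀ t₁ fun _ => 0
  stable : ∀ ε > 0, ∃ δ > 0, ∀ j t₀ t₁ z, 0 ≤ t₀ → t₀ ≤ t₁ → Sol j t₀ t₁ z →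
    (∀ s ∈ Set.Icc (t₀ - h) t₀, ‖z s‖ < δ) → ∀ t ∈ Set.Icc t₀ t₁, ‖z t‖ < ε
  attractive : ∃ δ > 0, ∀ ε > 0, ∃ T > (0 : ℝ), ∀ j t₀ t₁ z, 0 ≤ t₀ → t₀ ≤ t₁ → Sol j t₀ t₁ z →
    (∀ s ∈ Set.Icc (t₀ - h) t₀, ‖z s‖ < δ) → ∀ t ∈ Set.Icc (t₀ + T) t₁, ‖z t‖ < ε

end

/-! The two assertions are proved separately, each as a perturbation statement in the gain;
stability is not deduced from the LMIs but from a Lyapunov-Krasovskii functional of its own. Both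
rest on one scaling: for K = κ𝒦 the matrix K^{1/2}W has size √κ, the reduced Laplacians and channel
matrices have size κ, and connectedness bounds the quadratic form of the reduced Laplacian below by
κ·lam, with lam independent of W and ℓ (`exists_reduced_laplacian_coercive_of_finite`).

LMIs (`exists_solvesLMI`): take every S_m = κI and s = √κ. After the second component of the
argument is multiplied by s, the form built from D, the reduced Laplacian and the coupling matrix is
bounded below by a fixed ν, while all remaining terms are bounded by a constant times s
(`lmi_form_pos`).

Stability: under one common delay the channel matrices add up to the Laplacian
(`errorField_uniform`). Let F be the primitive of |p̃'|² starting at t₀. The functional is an energy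
with a small cross term between angles and frequencies, plus γ times the integral of F(t) - F(s)
over s in [t-h, t]. The derivative of the last term is γ(h|p̃'|² - (F(t) - F(t-h))). Its negative
part pays for the mismatch p̃(t) - p̃(t-τ), by Cauchy-Schwarz (`delay_mismatch`), which needs no
regularity of τ. Its positive part is small, because p̃' is of order √κ in ω̃ and of order κ in the
delayed p̃. `exists_gainBounds` collects what κ must satisfy; the network does not enter there.

The initial function need not be differentiable, so on [t₀, t₀+h] its part of the mismatch is
bounded by its size δ and absorbed by an explicit decaying summand of the functional. This gives an
exponential bound as long as the solution stays in a ball where the potential is strongly convex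
(`exp_estimate_of_forall_norm_le`); such a ball exists since neighboring angles differ by less than
π/2 (`exists_localPotential`). A first-exit argument shows that small solutions never leave it
(`exists_exp_estimate`). -/

namespace DAI

open MeasureTheory Set Filter Topology
open scoped NNReal

/-! ### Decay of absolutely continuous functions, integral equations, and the memory term. -/

section Analysis

variable {E : Type*} [NormedAddCommGroup E] [NormedSpace ℝ E]

theorem absolutelyContinuousOnInterval_contDiff_comp {Φ : E → ℝ} (hΦ : ContDiff ℝ 1 Φ)
    {X : ℝ → E} {K : ℝ≥0} {a b : ℝ} (hX : LipschitzOnWith K X (uIcc a b)) :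
    AbsolutelyContinuousOnInterval (fun t => Φ (X t)) a b := by
  have hc : IsCompact (X '' uIcc a b) := isCompact_uIcc.image_of_continuousOn hX.continuousOn
  obtain ⟨C, hC⟩ := (hΦ.locallyLipschitz.locallyLipschitzOn (s := X '' uIcc a b))
    |>.exists_lipschitzOnWith_of_compact hc
  exact (hC.comp hX (mapsTo_image _ _)).absolutelyContinuousOnInterval

/-- An absolutely continuous function with `Y' ≤ -β Y` almost everywhere decays exponentially. -/
theorem le_mul_exp_of_ae_hasDerivAt_le {Y : ℝ → ℝ} {a b β : ℝ} (hab : a ≤ b)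
    (hY : AbsolutelyContinuousOnInterval Y a b)
    (hd : ∀ᵐ t, t ∈ Ioo a b → ∃ y', HasDerivAt Y y' t ∧ y' ≤ -β * Y t) :
    Y b ≤ Y a * Real.exp (-β * (b - a)) := by
  -- With the integrating factor e^{β(t-a)}, the product with Y is absolutely continuous and has
  -- nonpositive derivative almost everywhere, hence does not grow.
  have hE : AbsolutelyContinuousOnInterval (fun t => Real.exp (β * (t - a))) a b := by
    apply ContDiffOn.absolutelyContinuousOnInterval
    exact ContDiff.contDiffOn (by fun_prop)
  have hZ := hE.mul hY
  have hint := hZ.integral_deriv_eq_sub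
  have hle : ∫ x in a..b, deriv ((fun t => Real.exp (β * (t - a))) * Y) x ≤ 0 := by
    rw [intervalIntegral.integral_of_le hab, ← integral_Ioc_eq_integral_Ioo.symm]
    apply setIntegral_nonpos_of_ae_restrict
    rw [EventuallyLE, ae_restrict_iff' measurableSet_Ioo]
    filter_upwards [hd] with t ht hm
    obtain ⟨y', h1, h2⟩ := ht hm
    have h3 : HasDerivAt (fun t => Real.exp (β * (t - a))) (Real.exp (β * (t - a)) * β) t := by
      have := (((hasDerivAt_id t).sub_const a).const_mul β).exp
      simpa using this
    rw [(h3.mul h1).deriv]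
    have := Real.exp_pos (β * (t - a))
    simp only [Pi.zero_apply]
    nlinarith
  rw [hint] at hle
  simp only [Pi.mul_apply, sub_self, mul_zero, Real.exp_zero, one_mul] at hle
  have h4 : Real.exp (β * (b - a)) * Real.exp (-β * (b - a)) = 1 := by
    rw [← Real.exp_add]; simp
  have h5 := Real.exp_pos (-β * (b - a))
  calc Y b = (Real.exp (β * (b - a)) * Y b) * Real.exp (-β * (b - a)) := by
        rw [mul_right_comm, h4, one_mul]
    _ ≤ Y a * Real.exp (-β * (b - a)) := by
        apply mul_le_mul_of_nonneg_right _ h5.le; linarith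

theorem ae_hasDerivAt_of_eq_integral [CompleteSpace E] {z f : ℝ → E} {a b : ℝ}
    (hf : IntervalIntegrable f volume a b)
    (hz : ∀ t ∈ Icc a b, z t = z a + ∫ s in a..t, f s) :
    ∀ᵐ t, t ∈ Ioo a b → HasDerivAt z (f t) t := by
  filter_upwards [hf.ae_hasDerivAt_integral] with t ht hm
  have hab : a ≤ b := (hm.1.trans hm.2).le
  have h1 := (ht (by rw [uIcc_of_le hab]; exact ⟨hm.1.le, hm.2.le⟩) a left_mem_uIcc).const_add (z a)
  refine h1.congr_of_eventuallyEq ?_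
  filter_upwards [Icc_mem_nhds hm.1 hm.2] with s hs using hz s hs

theorem lipschitzOnWith_of_eq_integral {z f : ℝ → E} {a b : ℝ} {C : ℝ≥0}
    (hf : IntervalIntegrable f volume a b) (hC : ∀ s ∈ Icc a b, ‖f s‖ ≤ C)
    (hz : ∀ t ∈ Icc a b, z t = z a + ∫ s in a..t, f s) :
    LipschitzOnWith C z (Icc a b) := by
  refine LipschitzOnWith.of_dist_le_mul fun x hx y hy => ?_
  have hsub : ∀ t ∈ Icc a b, IntervalIntegrable f volume a t := fun t ht =>
    hf.mono_set (by
      rw [uIcc_of_le ht.1, uIcc_of_le (ht.1.trans ht.2)]; exact Icc_subset_Icc_right ht.2)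
  rw [hz x hx, hz y hy, dist_add_left, dist_eq_norm,
    intervalIntegral.integral_interval_sub_left (hsub x hx) (hsub y hy), Real.dist_eq]
  refine intervalIntegral.norm_integral_le_of_norm_le_const fun s hs => hC s ?_
  rcases le_total y x with h | h
  · rw [uIoc_of_le h] at hs; exact ⟨hy.1.trans hs.1.le, hs.2.trans hx.2⟩
  · rw [uIoc_of_ge h] at hs; exact ⟨hx.1.trans hs.1.le, hs.2.trans hy.2⟩

/-- The integral of (g - c)², with c the mean of g, is nonnegative. -/
theorem sq_integral_le {g : ℝ → ℝ} {a b : ℝ} (hab : a ≤ b)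
    (hg : IntervalIntegrable g volume a b)
    (hg2 : IntervalIntegrable (fun s => g s ^ 2) volume a b) :
    (∫ s in a..b, g s) ^ 2 ≤ (b - a) * ∫ s in a..b, g s ^ 2 := by
  rcases hab.eq_or_lt with rfl | hlt
  · simp
  set I := ∫ s in a..b, g s
  set c := I / (b - a)
  have h0 : 0 ≤ ∫ s in a..b, (g s - c) ^ 2 :=
    intervalIntegral.integral_nonneg hab fun s _ => sq_nonneg _
  have h1 : ∫ s in a..b, (g s - c) ^ 2 = (∫ s in a..b, g s ^ 2) - 2 * c * I + (b - a) * c ^ 2 := by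
    have : ∀ s, (g s - c) ^ 2 = g s ^ 2 - (2 * c) * g s + c ^ 2 := fun s => by ring
    simp_rw [this]
    rw [intervalIntegral.integral_add (hg2.sub (hg.const_mul _)) (by simp),
      intervalIntegral.integral_sub hg2 (hg.const_mul _), intervalIntegral.integral_const_mul]
    simp [I]
  have hba : 0 < b - a := sub_pos.2 hlt
  have hc : c * (b - a) = I := div_mul_cancel₀ _ hba.ne'
  rw [h1] at h0
  have := mul_nonneg hba.le h0
  nlinarith

/-- The Cauchy-Schwarz inequality for the squared Euclidean length of an integral. -/
theorem dotProduct_integral_le {m : ℕ} {g : ℝ → Fin m → ℝ} {a b : ℝ} (hab : a ≤ b)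
    (hg : ∀ i, IntervalIntegrable (fun s => g s i) volume a b)
    (hg2 : ∀ i, IntervalIntegrable (fun s => g s i ^ 2) volume a b)
    {v : Fin m → ℝ} (hv : ∀ i, v i = ∫ s in a..b, g s i) :
    v ⬝ᵥ v ≤ (b - a) * ∫ s in a..b, g s ⬝ᵥ g s := by
  have h1 : ∀ s, g s ⬝ᵥ g s = ∑ i, g s i ^ 2 := fun s => by simp [dotProduct, sq]
  simp_rw [h1]
  rw [intervalIntegral.integral_finsetSum fun i _ => hg2 i, Finset.mul_sum]
  refine Finset.sum_le_sum fun i _ => ?_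
  rw [← sq, hv i]
  exact sq_integral_le hab (hg i) (hg2 i)

/-- Properties of the primitive of a bounded nonnegative function supported on `[a, ∞)`. -/
structure IsMemory (a C : ℝ) (q F : ℝ → ℝ) : Prop where
  lipschitz : ∀ s t, |F t - F s| ≤ C * |t - s|
  mono : Monotone F
  zero : ∀ t ≤ a, F t = 0
  deriv : ∀ᵐ t, HasDerivAt F (q t) t

theorem isMemory_integral {a C : ℝ} {q : ℝ → ℝ} (hq : Measurable q) (h0 : ∀ t, 0 ≤ q t)
    (hC : ∀ t, q t ≤ C) (hs : ∀ t < a, q t = 0) :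
    IsMemory a C q fun t => ∫ s in a..t, q s := by
  have hn : ∀ t, ‖q t‖ ≤ C := fun t => by rw [Real.norm_of_nonneg (h0 t)]; exact hC t
  have hli : LocallyIntegrable q volume :=
    (locallyIntegrable_const C).mono hq.aestronglyMeasurable
      (Eventually.of_forall fun t => (hn t).trans (le_abs_self _))
  have hii : ∀ s t, IntervalIntegrable q volume s t := fun s t =>
    (hli.integrableOn_isCompact isCompact_uIcc).intervalIntegrable
  have hd : ∀ s t, (∫ u in a..t, q u) - ∫ u in a..s, q u = ∫ u in s..t, q u := fun s t =>
    intervalIntegral.integral_interval_sub_left (hii _ _) (hii _ _)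
  refine ⟨fun s t => ?_, fun s t hst => ?_, fun t ht => ?_, ?_⟩
  · rw [hd]
    exact intervalIntegral.norm_integral_le_of_norm_le_const fun u _ => hn u
  · rw [← sub_nonneg, hd]
    exact intervalIntegral.integral_nonneg hst fun u _ => h0 u
  · show ∫ s in a..t, q s = 0
    rw [intervalIntegral.integral_symm, intervalIntegral.integral_of_le ht,
      integral_Ioc_eq_integral_Ioo, setIntegral_congr_fun measurableSet_Ioo
        (g := fun _ => (0:ℝ)) (fun u hu => hs u hu.2)]
    simp
  · filter_upwards [LocallyIntegrable.ae_hasDerivAt_integral hli] with t ht using ht a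

namespace IsMemory

variable {a C : ℝ} {q F : ℝ → ℝ}

theorem continuous (hF : IsMemory a C q F) : Continuous F := by
  have : LipschitzWith (Real.toNNReal C) F := LipschitzWith.of_dist_le_mul fun s t => by
    rw [Real.dist_eq, Real.dist_eq]
    exact (hF.lipschitz t s).trans (mul_le_mul_of_nonneg_right (Real.le_coe_toNNReal C)
      (abs_nonneg _))
  exact this.continuous

theorem absolutelyContinuousOnInterval (hF : IsMemory a C q F) (s t : ℝ) :
    AbsolutelyContinuousOnInterval F s t := by
  have : LipschitzWith (Real.toNNReal C) F := LipschitzWith.of_dist_le_mul fun s t => by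
    rw [Real.dist_eq, Real.dist_eq]
    exact (hF.lipschitz t s).trans (mul_le_mul_of_nonneg_right (Real.le_coe_toNNReal C)
      (abs_nonneg _))
  exact this.lipschitzOnWith.absolutelyContinuousOnInterval

/-- Continuity of F suffices, so this holds at every t, even where F itself is not differentiable.
-/
theorem hasDerivAt_window (hF : IsMemory a C q F) (h t : ℝ) :
    HasDerivAt (fun t => ∫ s in (t - h)..t, F s) (F t - F (t - h)) t := by
  have hc := hF.continuous
  have h1 : ∀ u, HasDerivAt (fun t => ∫ s in (0:ℝ)..t, F s) (F u) u := fun u =>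
    intervalIntegral.integral_hasDerivAt_right (hc.intervalIntegrable _ _)
      (hc.stronglyMeasurableAtFilter _ _) hc.continuousAt
  have h2 : HasDerivAt (fun t => ∫ s in (0:ℝ)..(t - h), F s) (F (t - h)) t := by
    simpa [Function.comp_def] using (h1 (t - h)).comp t ((hasDerivAt_id t).sub_const h)
  refine ((h1 t).sub h2).congr_of_eventuallyEq (Eventually.of_forall fun u => ?_)
  exact (intervalIntegral.integral_interval_sub_left (hc.intervalIntegrable _ _)
    (hc.intervalIntegrable _ _)).symm

/-- The quantity is the integral of F(t) - F(s) over the window, and by monotonicity the integrand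
lies between 0 and F(t) - F(t-h). -/
theorem window_bounds (hF : IsMemory a C q F) {h : ℝ} (hh : 0 ≤ h) (t : ℝ) :
    0 ≤ h * F t - ∫ s in (t - h)..t, F s ∧
      h * F t - ∫ s in (t - h)..t, F s ≤ h * (F t - F (t - h)) := by
  have hc := hF.continuous
  have hle : t - h ≤ t := by linarith
  have h1 : ∫ s in (t - h)..t, F s ≤ ∫ _ in (t - h)..t, F t :=
    intervalIntegral.integral_mono_on hle (hc.intervalIntegrable _ _) (by simp)
      fun s hs => hF.mono hs.2
  have h2 : ∫ _ in (t - h)..t, F (t - h) ≤ ∫ s in (t - h)..t, F s :=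
    intervalIntegral.integral_mono_on hle (by simp) (hc.intervalIntegrable _ _)
      fun s hs => hF.mono hs.1
  simp only [intervalIntegral.integral_const, smul_eq_mul, sub_sub_cancel] at h1 h2
  constructor <;> linarith

theorem absolutelyContinuousOnInterval_window (hF : IsMemory a C q F) (h s t : ℝ) :
    AbsolutelyContinuousOnInterval (fun t => ∫ s in (t - h)..t, F s) s t := by
  apply ContDiffOn.absolutelyContinuousOnInterval
  apply ContDiff.contDiffOn
  rw [contDiff_one_iff_deriv]
  refine ⟨fun u => (hF.hasDerivAt_window h u).differentiableAt, ?_⟩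
  have : _root_.deriv (fun t => ∫ s in (t - h)..t, F s) = fun t => F t - F (t - h) :=
    funext fun u => (hF.hasDerivAt_window h u).deriv
  rw [this]
  have := hF.continuous
  fun_prop

end IsMemory

end Analysis

/-! ### Euclidean length and coercivity of quadratic forms. -/

section EuclideanLength

variable {m n : Type*} [Fintype m] [Fintype n]

/-- Euclidean length of a vector. -/
noncomputable def l2 (x : n → ℝ) : ℝ := ‖(WithLp.toLp 2 x : EuclideanSpace ℝ n)‖

theorem l2_nonneg (x : n → ℝ) : 0 ≤ l2 x := norm_nonneg _

theorem l2_sq (x : n → ℝ) : l2 x ^ 2 = x ⬝ᵥ x := by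
  rw [l2, EuclideanSpace.norm_sq_eq]
  simp [dotProduct, sq]

theorem abs_dotProduct_le (x y : n → ℝ) : |x ⬝ᵥ y| ≤ l2 x * l2 y := by
  have := abs_real_inner_le_norm (WithLp.toLp 2 y : EuclideanSpace ℝ n) (WithLp.toLp 2 x)
  rw [EuclideanSpace.inner_toLp_toLp, star_trivial] at this
  rw [mul_comm]
  exact this

theorem dotProduct_le (x y : n → ℝ) : x ⬝ᵥ y ≤ l2 x * l2 y :=
  (le_abs_self _).trans (abs_dotProduct_le x y)

theorem l2_add_le (x y : n → ℝ) : l2 (x + y) ≤ l2 x + l2 y := by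
  rw [l2, WithLp.toLp_add]; exact norm_add_le _ _

theorem l2_sub_le (x y : n → ℝ) : l2 (x - y) ≤ l2 x + l2 y := by
  rw [l2, WithLp.toLp_sub]; exact norm_sub_le _ _

theorem l2_eq_zero {x : n → ℝ} (hx : l2 x = 0) : x = 0 := by
  rw [l2, norm_eq_zero] at hx
  exact congrArg WithLp.ofLp hx

theorem l2_pos {x : n → ℝ} (hx : x ≠ 0) : 0 < l2 x :=
  lt_of_le_of_ne (l2_nonneg x) fun h => hx (l2_eq_zero h.symm)

open scoped Matrix.Norms.L2Operator in
theorem l2_mulVec_le [DecidableEq n] (A : Matrix m n ℝ) (x : n → ℝ) :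
    l2 (A *ᵥ x) ≤ ‖A‖ * l2 x :=
  Matrix.l2_opNorm_mulVec A (WithLp.toLp 2 x)

theorem sq_norm_le_l2_sq (x : n → ℝ) : ‖x‖ ^ 2 ≤ l2 x ^ 2 := by
  have h : ‖x‖ ≤ l2 x := by
    refine (pi_norm_le_iff_of_nonneg (l2_nonneg x)).2 fun i => ?_
    exact PiLp.norm_apply_le (WithLp.toLp 2 x : EuclideanSpace ℝ n) i
  exact pow_le_pow_left₀ (norm_nonneg _) h 2

theorem l2_sq_le_card_mul (x : n → ℝ) : l2 x ^ 2 ≤ Fintype.card n * ‖x‖ ^ 2 := by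
  rw [l2_sq]
  calc x ⬝ᵥ x = ∑ i, ‖x i‖ ^ 2 := by simp [dotProduct, sq]
    _ ≤ ∑ _i : n, ‖x‖ ^ 2 :=
        Finset.sum_le_sum fun i _ => pow_le_pow_left₀ (norm_nonneg _) (norm_le_pi_norm x i) 2
    _ = _ := by simp

theorem continuous_l2 : Continuous (l2 : (n → ℝ) → ℝ) :=
  continuous_norm.comp (PiLp.continuous_toLp 2 _)

/-- A continuous positive function which is homogeneous of degree two is coercive. -/
theorem exists_mul_l2_sq_le {Q : (n → ℝ) → ℝ} (hc : Continuous Q)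
    (hh : ∀ (t : ℝ) x, Q (t • x) = t ^ 2 * Q x) (hp : ∀ x, x ≠ 0 → 0 < Q x) :
    ∃ c > 0, ∀ x, c * l2 x ^ 2 ≤ Q x := by
  have hK : IsCompact {x : n → ℝ | l2 x = 1} := by
    refine Metric.isCompact_of_isClosed_isBounded (isClosed_eq continuous_l2 continuous_const) ?_
    refine (Metric.isBounded_closedBall (x := 0) (r := 1)).subset fun x hx => ?_
    rw [mem_closedBall_zero_iff, ← abs_norm, ← sq_le_one_iff_abs_le_one]
    refine (sq_norm_le_l2_sq x).trans ?_
    rw [show l2 x = 1 from hx]; norm_num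
  have key : ∃ c > 0, ∀ x : n → ℝ, l2 x = 1 → c ≤ Q x := by
    -- The sphere is empty when the index type is, as for `Fin (n - 1)` with n = 1; any constant
    -- serves then.
    rcases {x : n → ℝ | l2 x = 1}.eq_empty_or_nonempty with h | h
    · exact ⟨1, one_pos, fun x hx => absurd (show x ∈ {x : n → ℝ | l2 x = 1} from hx) (by simp [h])⟩
    · obtain ⟨y, hy, hmin⟩ := hK.exists_isMinOn h hc.continuousOn
      refine ⟨Q y, hp y ?_, fun x hx => hmin hx⟩
      rintro rfl
      simp [l2] at hy
  obtain ⟨c, hc0, hcle⟩ := key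
  refine ⟨c, hc0, fun x => ?_⟩
  rcases eq_or_ne x 0 with rfl | hx
  · have := hh 0 0
    simp only [smul_zero] at this
    rw [this]; simp [l2]
  · have hl := l2_pos hx
    have h1 : l2 ((l2 x)⁻¹ • x) = 1 := by
      rw [l2, WithLp.toLp_smul, norm_smul, Real.norm_of_nonneg (inv_nonneg.2 hl.le)]
      exact inv_mul_cancel₀ hl.ne'
    have h2 := hcle _ h1
    rw [hh] at h2
    have h3 : l2 x ^ 2 * ((l2 x)⁻¹ ^ 2 * Q x) = Q x := by field_simp
    rw [← h3, mul_comm c]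
    exact mul_le_mul_of_nonneg_left h2 (by positivity)

end EuclideanLength

/-- Complete the square: 4u(ux² + vy² - xy) = (2ux - y)² + (4uv - 1)y². -/
theorem young {x y u v : ℝ} (hu : 0 < u) (huv : 1 ≤ 4 * u * v) :
    x * y ≤ u * x ^ 2 + v * y ^ 2 := by
  have h1 : 0 ≤ (2 * u * x - y) ^ 2 := sq_nonneg _
  have h2 : 0 ≤ (4 * u * v - 1) * y ^ 2 := mul_nonneg (by linarith) (sq_nonneg _)
  have : 0 ≤ 4 * u * (u * x ^ 2 + v * y ^ 2 - x * y) := by nlinarith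
  have := nonneg_of_mul_nonneg_right this (by positivity)
  linarith

/-- The scalar inequality behind the decay of the Lyapunov functional: `a, b, c` are the lengths of
the frequency, control and angle errors, `e` is the length of the delay mismatch, `w` the length of
the delayed control error, `J` the memory term. -/
theorem dissipation {d lam γ h k l a b c e w J Q η ε X1 X2 X3 Y1 Y2 Y3 Y4 mm Dm cg : ℝ}
    (hh : 0 ≤ h) (hlam : 0 < lam) (hγ : 0 ≤ γ) (hcg : 0 < cg) (hε : 0 ≤ ε) (hw0 : 0 ≤ w)
    (hJ : 0 ≤ J)
    (c1 : 2 * γ * h * k ^ 2 ≤ d / 2) (c2 : 4 * γ * h * l ^ 2 ≤ lam / 4)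
    (c3 : (l ^ 2 / (2 * lam) + 4 * γ * h * l ^ 2) * (2 * h) ≤ γ / 2)
    (e1 : ε * (mm + Dm ^ 2 / cg) ≤ d / 4) (e2 : ε * (k ^ 2 / cg) ≤ lam / 8)
    (hX1 : d * a ^ 2 ≤ X1) (hX2 : lam * b ^ 2 ≤ X2) (hX3 : X3 ≤ l * b * e)
    (hQ0 : 0 ≤ Q) (hQ : Q ≤ k * a + l * w) (hw : w ≤ b + e) (he : e ^ 2 ≤ 2 * h * J + η)
    (hY1 : Y1 ≤ mm * a ^ 2) (hY2 : -Y2 ≤ Dm * a * c) (hY3 : cg * c ^ 2 ≤ Y3)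
    (hY4 : -Y4 ≤ k * b * c) :
    -X1 - X2 + X3 + γ * (h * Q ^ 2 - J) + ε * (Y1 - Y2 - Y3 - Y4) ≤
      -(d / 4 * a ^ 2 + lam / 8 * b ^ 2 + ε * cg / 2 * c ^ 2 + γ / 2 * J)
        + (l ^ 2 / (2 * lam) + 4 * γ * h * l ^ 2) * η := by
  -- Budget. Of d·a², d/2 pays for the memory production and d/4 for the cross term. Of lam·b²,
  -- lam/2 goes to the mismatch, lam/4 to the memory and lam/8 to the cross term. Of cg·c², two
  -- quarters go to the two mixed products. Half of γJ pays for e², whose total coefficient is ce.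
  set ce := l ^ 2 / (2 * lam) + 4 * γ * h * l ^ 2 with hce
  have hce0 : 0 ≤ ce := by positivity
  have hle : l * b * e ≤ lam / 2 * b ^ 2 + l ^ 2 / (2 * lam) * e ^ 2 := by
    have := young (x := b) (y := l * e) (u := lam / 2) (v := 1 / (2 * lam)) (by positivity)
      (by field_simp; norm_num)
    have h2 : 1 / (2 * lam) * (l * e) ^ 2 = l ^ 2 / (2 * lam) * e ^ 2 := by ring
    linarith
  have hQ2 : Q ^ 2 ≤ 2 * k ^ 2 * a ^ 2 + 4 * l ^ 2 * b ^ 2 + 4 * l ^ 2 * e ^ 2 := by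
    have h1 : Q ^ 2 ≤ (k * a + l * w) ^ 2 := pow_le_pow_left₀ hQ0 hQ 2
    have h2 : w ^ 2 ≤ (b + e) ^ 2 := pow_le_pow_left₀ hw0 hw 2
    have h3 : l ^ 2 * w ^ 2 ≤ l ^ 2 * (2 * b ^ 2 + 2 * e ^ 2) :=
      mul_le_mul_of_nonneg_left (by nlinarith [sq_nonneg (b - e)]) (sq_nonneg l)
    nlinarith [sq_nonneg (k * a - l * w)]
  have hγh : 0 ≤ γ * h := mul_nonneg hγ hh
  have hγQ := mul_le_mul_of_nonneg_left hQ2 hγh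
  have hceE := mul_le_mul_of_nonneg_left he hce0
  have hY2' : -Y2 ≤ Dm ^ 2 / cg * a ^ 2 + cg / 4 * c ^ 2 := by
    have := young (x := c) (y := Dm * a) (u := cg / 4) (v := 1 / cg) (by positivity)
      (by field_simp; norm_num)
    have h2 : 1 / cg * (Dm * a) ^ 2 = Dm ^ 2 / cg * a ^ 2 := by ring
    linarith
  have hY4' : -Y4 ≤ k ^ 2 / cg * b ^ 2 + cg / 4 * c ^ 2 := by
    have := young (x := c) (y := k * b) (u := cg / 4) (v := 1 / cg) (by positivity)
      (by field_simp; norm_num)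
    have h2 : 1 / cg * (k * b) ^ 2 = k ^ 2 / cg * b ^ 2 := by ring
    linarith
  have hY : ε * (Y1 - Y2 - Y3 - Y4) ≤
      ε * ((mm + Dm ^ 2 / cg) * a ^ 2 + k ^ 2 / cg * b ^ 2 - cg / 2 * c ^ 2) :=
    mul_le_mul_of_nonneg_left (by linarith) hε
  have f1 := mul_le_mul_of_nonneg_right c1 (sq_nonneg a)
  have f2 := mul_le_mul_of_nonneg_right c2 (sq_nonneg b)
  have f3 := mul_le_mul_of_nonneg_right c3 hJ
  have f4 := mul_le_mul_of_nonneg_right e1 (sq_nonneg a)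
  have f5 := mul_le_mul_of_nonneg_right e2 (sq_nonneg b)
  have f6 : ce * e ^ 2 = l ^ 2 / (2 * lam) * e ^ 2 + 4 * γ * h * l ^ 2 * e ^ 2 := by
    rw [hce]; ring
  linarith

/-! ### The delay system, its energy, and the delay mismatch. -/

section DelaySystem

variable {n m : ℕ} {ι : Type*}

/-- Frequency dynamics with inertias `M`, damping `D` and restoring force `g`, coupled through `B`
to a controller with delayed feedback `L`. -/
noncomputable def delayField (M D : Fin n → ℝ) (B : Matrix (Fin n) (Fin m) ℝ)
    (g : (Fin n → ℝ) → Fin n → ℝ) (L : Matrix (Fin m) (Fin m) ℝ)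
    (z : (Fin n → ℝ) × (Fin n → ℝ) × (Fin m → ℝ)) (pd : Fin m → ℝ) :
    (Fin n → ℝ) × (Fin n → ℝ) × (Fin m → ℝ) :=
  (z.2.1, fun i => (M i)⁻¹ * (-(D i * z.2.1 i) - g z.1 i - (B *ᵥ z.2.2) i),
    Bᵀ *ᵥ z.2.1 - L *ᵥ pd)

/-- Gain bounds under which the delayed feedback does not destroy stability, for delays up to `h`;
`γ` is the weight of the memory term of the Lyapunov functional. -/
structure GainBounds (D : Fin n → ℝ) (B : Matrix (Fin n) (Fin m) ℝ)
    (L : ι → Matrix (Fin m) (Fin m) ℝ) (h d k l lam γ : ℝ) : Prop where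
  h_nonneg : 0 ≤ h
  d_pos : 0 < d
  lam_pos : 0 < lam
  γ_pos : 0 < γ
  k_nonneg : 0 ≤ k
  l_nonneg : 0 ≤ l
  damping : ∀ i, d ≤ D i
  input : ∀ x, l2 (B *ᵥ x) ≤ k * l2 x
  input_transpose : ∀ x, l2 (Bᵀ *ᵥ x) ≤ k * l2 x
  feedback : ∀ ℓ x, l2 (L ℓ *ᵥ x) ≤ l * l2 x
  coercive : ∀ ℓ x, lam * l2 x ^ 2 ≤ x ⬝ᵥ L ℓ *ᵥ x
  damping_dominates : 2 * γ * h * k ^ 2 ≤ d / 2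
  coercive_dominates : 4 * γ * h * l ^ 2 ≤ lam / 4
  memory_dominates : (l ^ 2 / (2 * lam) + 4 * γ * h * l ^ 2) * (2 * h) ≤ γ / 2

/-- `P` is a potential with gradient `g`, strongly convex near its minimum `0`. -/
structure LocalPotential (P : (Fin n → ℝ) → ℝ) (g : (Fin n → ℝ) → Fin n → ℝ) (r c C : ℝ) :
    Prop where
  r_pos : 0 < r
  c_pos : 0 < c
  contDiff : ContDiff ℝ 1 P
  fderiv_eq : ∀ θ v, fderiv ℝ P θ v = g θ ⬝ᵥ v
  continuous_grad : Continuous g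
  lower : ∀ θ, ‖θ‖ ≤ r → c * l2 θ ^ 2 ≤ P θ
  upper : ∀ θ, ‖θ‖ ≤ r → P θ ≤ C * l2 θ ^ 2
  monotone : ∀ θ, ‖θ‖ ≤ r → c * l2 θ ^ 2 ≤ g θ ⬝ᵥ θ

/-- Energy with a cross term between angles and frequencies. -/
noncomputable def energy (P : (Fin n → ℝ) → ℝ) (M : Fin n → ℝ) (ε : ℝ)
    (z : (Fin n → ℝ) × (Fin n → ℝ) × (Fin m → ℝ)) : ℝ :=
  P z.1 + (1 / 2) * ∑ i, M i * z.2.1 i ^ 2 + (1 / 2) * ∑ i, z.2.2 i ^ 2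
    + ε * ∑ i, M i * (z.1 i * z.2.1 i)

theorem contDiff_energy {P : (Fin n → ℝ) → ℝ} (hP : ContDiff ℝ 1 P) (M : Fin n → ℝ) (ε : ℝ) :
    ContDiff ℝ 1 (energy (m := m) P M ε) := by
  unfold energy
  fun_prop

theorem hasDerivAt_energy {P : (Fin n → ℝ) → ℝ} {g : (Fin n → ℝ) → Fin n → ℝ} {r c C : ℝ}
    (hP : LocalPotential P g r c C) (M : Fin n → ℝ) (ε : ℝ)
    {z : ℝ → (Fin n → ℝ) × (Fin n → ℝ) × (Fin m → ℝ)}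
    {z' : (Fin n → ℝ) × (Fin n → ℝ) × (Fin m → ℝ)} {t : ℝ} (hz : HasDerivAt z z' t) :
    HasDerivAt (fun s => energy P M ε (z s))
      (g (z t).1 ⬝ᵥ z'.1 + (∑ i, M i * ((z t).2.1 i * z'.2.1 i)) + (∑ i, (z t).2.2 i * z'.2.2 i)
        + ε * ∑ i, M i * (z'.1 i * (z t).2.1 i + (z t).1 i * z'.2.1 i)) t := by
  have h1 : HasDerivAt (fun s => (z s).1) z'.1 t := hz.fst
  have h2 : HasDerivAt (fun s => (z s).2.1) z'.2.1 t := hz.snd.fst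
  have h3 : HasDerivAt (fun s => (z s).2.2) z'.2.2 t := hz.snd.snd
  rw [hasDerivAt_pi] at h2 h3
  have h1' := hasDerivAt_pi.1 h1
  have hp : HasDerivAt (fun s => P (z s).1) (g (z t).1 ⬝ᵥ z'.1) t := by
    rw [← hP.fderiv_eq]
    exact ((hP.contDiff.differentiable one_ne_zero _).hasFDerivAt).comp_hasDerivAt t h1
  unfold energy
  refine ((hp.add ?_).add ?_).add ?_
  · have := (HasDerivAt.fun_sum (u := Finset.univ) fun i _ =>
      ((h2 i).pow 2).const_mul (M i)).const_mul (1 / 2 : ℝ)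
    refine this.congr_deriv ?_
    rw [Finset.mul_sum]
    refine Finset.sum_congr rfl fun i _ => ?_
    norm_num; ring
  · have := (HasDerivAt.fun_sum (u := Finset.univ) fun i _ =>
      ((h3 i).pow 2)).const_mul (1 / 2 : ℝ)
    refine this.congr_deriv ?_
    rw [Finset.mul_sum]
    refine Finset.sum_congr rfl fun i _ => ?_
    norm_num; ring
  · exact (HasDerivAt.fun_sum (u := Finset.univ) fun i _ =>
      ((h1' i).mul (h2 i)).const_mul (M i)).const_mul ε

/-- The derivative of the energy along the vector field. -/
theorem energy_deriv_eq {M D : Fin n → ℝ} (hM : ∀ i, 0 < M i) (B : Matrix (Fin n) (Fin m) ℝ)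
    (g : (Fin n → ℝ) → Fin n → ℝ) (L : Matrix (Fin m) (Fin m) ℝ) (ε : ℝ)
    (z : (Fin n → ℝ) × (Fin n → ℝ) × (Fin m → ℝ)) (pd : Fin m → ℝ) :
    let z' := delayField M D B g L z pd
    (g z.1 ⬝ᵥ z'.1 + (∑ i, M i * (z.2.1 i * z'.2.1 i)) + (∑ i, z.2.2 i * z'.2.2 i)
        + ε * ∑ i, M i * (z'.1 i * z.2.1 i + z.1 i * z'.2.1 i)) =
      -(∑ i, D i * z.2.1 i ^ 2) - z.2.2 ⬝ᵥ L *ᵥ z.2.2 + z.2.2 ⬝ᵥ L *ᵥ (z.2.2 - pd)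
        + ε * ((∑ i, M i * z.2.1 i ^ 2) - (∑ i, D i * (z.1 i * z.2.1 i)) - g z.1 ⬝ᵥ z.1
          - z.1 ⬝ᵥ B *ᵥ z.2.2) := by
  obtain ⟨θ, ω, p⟩ := z
  simp only [delayField]
  have e1 : ∑ i, M i * (ω i * ((M i)⁻¹ * (-(D i * ω i) - g θ i - (B *ᵥ p) i))) =
      -(∑ i, D i * ω i ^ 2) - g θ ⬝ᵥ ω - ω ⬝ᵥ B *ᵥ p := by
    simp only [dotProduct, ← Finset.sum_neg_distrib, ← Finset.sum_sub_distrib]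
    refine Finset.sum_congr rfl fun i _ => ?_
    have := (hM i).ne'
    field_simp
  have e2 : ∑ i, p i * (Bᵀ *ᵥ ω - L *ᵥ pd) i = ω ⬝ᵥ B *ᵥ p - p ⬝ᵥ L *ᵥ pd := by
    change p ⬝ᵥ (Bᵀ *ᵥ ω - L *ᵥ pd) = _
    rw [dotProduct_sub, dotProduct_mulVec p, vecMul_transpose, dotProduct_comm (B *ᵥ p)]
  have e3 : ∑ i, M i * (ω i * ω i + θ i * ((M i)⁻¹ * (-(D i * ω i) - g θ i - (B *ᵥ p) i))) =
      (∑ i, M i * ω i ^ 2) - (∑ i, D i * (θ i * ω i)) - g θ ⬝ᵥ θ - θ ⬝ᵥ B *ᵥ p := by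
    simp only [dotProduct, ← Finset.sum_sub_distrib]
    refine Finset.sum_congr rfl fun i _ => ?_
    have := (hM i).ne'
    field_simp
    ring
  -- The power g·ω and the coupling ω·Bp occur with both signs and cancel; the delayed feedback is
  -- the undelayed one minus the feedback of the mismatch.
  rw [e1, e2, e3, mulVec_sub, dotProduct_sub]
  ring

theorem sum_mul_sq_le {M : Fin n → ℝ} {μ : ℝ} (hM : ∀ i, M i ≤ μ) (x : Fin n → ℝ) :
    ∑ i, M i * x i ^ 2 ≤ μ * l2 x ^ 2 := by
  rw [l2_sq, dotProduct, Finset.mul_sum]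
  refine Finset.sum_le_sum fun i _ => ?_
  rw [← sq]
  exact mul_le_mul_of_nonneg_right (hM i) (sq_nonneg _)

theorem le_sum_mul_sq {M : Fin n → ℝ} {μ : ℝ} (hM : ∀ i, μ ≤ M i) (x : Fin n → ℝ) :
    μ * l2 x ^ 2 ≤ ∑ i, M i * x i ^ 2 := by
  rw [l2_sq, dotProduct, Finset.mul_sum]
  refine Finset.sum_le_sum fun i _ => ?_
  rw [← sq]
  exact mul_le_mul_of_nonneg_right (hM i) (sq_nonneg _)

theorem abs_sum_mul_mul_le {M : Fin n → ℝ} {μ : ℝ} (hM0 : ∀ i, 0 ≤ M i) (hM : ∀ i, M i ≤ μ)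
    (hμ : 0 ≤ μ) (x y : Fin n → ℝ) :
    |∑ i, M i * (x i * y i)| ≤ μ * l2 x * l2 y := by
  have h1 : ∑ i, M i * (x i * y i) = (fun i => M i * x i) ⬝ᵥ y := by
    simp only [dotProduct, mul_assoc]
  have h2 : l2 (fun i => M i * x i) ≤ μ * l2 x := by
    refine abs_le_of_sq_le_sq' ?_ (mul_nonneg hμ (l2_nonneg x)) |>.2
    rw [mul_pow, l2_sq, l2_sq, dotProduct, dotProduct, Finset.mul_sum]
    refine Finset.sum_le_sum fun i _ => ?_
    have := pow_le_pow_left₀ (hM0 i) (hM i) 2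
    calc M i * x i * (M i * x i) = M i ^ 2 * (x i * x i) := by ring
      _ ≤ μ ^ 2 * (x i * x i) := mul_le_mul_of_nonneg_right this (mul_self_nonneg _)
  rw [h1]
  exact (abs_dotProduct_le _ _).trans (mul_le_mul_of_nonneg_right h2 (l2_nonneg y))

/-- Distance between the present and a delayed value, in terms of the memory term and of the size
`δ` of the initial function. -/
theorem delay_mismatch {p f : ℝ → Fin m → ℝ} {F : ℝ → ℝ} {t₀ t₁ t u h δ K : ℝ}
    (hf : ∀ i, Measurable fun s => f s i) (hK : ∀ s ∈ Icc t₀ t₁, ∀ i, |f s i| ≤ K)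
    (hp : ∀ t ∈ Icc t₀ t₁, ∀ i, p t i = p t₀ i + ∫ s in t₀..t, f s i)
    (hF : Monotone F)
    (hFi : ∀ s ∈ Icc t₀ t₁, ∀ t ∈ Icc t₀ t₁, s ≤ t → F t - F s = ∫ x in s..t, f x ⬝ᵥ f x)
    (hist : ∀ s ∈ Icc (t₀ - h) t₀, ‖p s‖ ≤ δ) (ht : t ∈ Icc t₀ t₁) (hu : u ∈ Icc (t - h) t) :
    l2 (p t - p u) ^ 2 ≤ 2 * h * (F t - F (t - h)) + (if t < t₀ + h then 8 * m * δ ^ 2 else 0) := by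
  have hint : ∀ i, ∀ a ∈ Icc t₀ t₁, ∀ b ∈ Icc t₀ t₁,
      IntervalIntegrable (fun s => f s i) volume a b ∧
      IntervalIntegrable (fun s => f s i ^ 2) volume a b := by
    intro i a ha b hb
    have hsub : uIoc a b ⊆ Icc t₀ t₁ := uIoc_subset_uIcc.trans (uIcc_subset_Icc ha hb)
    constructor
    · refine (intervalIntegrable_const (c := K)).mono_fun (hf i).aestronglyMeasurable ?_
      refine (ae_restrict_iff' measurableSet_uIoc).2 (Eventually.of_forall fun s hs => ?_)
      exact (hK s (hsub hs) i).trans (le_abs_self _)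
    · refine (intervalIntegrable_const (c := K ^ 2)).mono_fun
        ((hf i).pow_const 2).aestronglyMeasurable ?_
      refine (ae_restrict_iff' measurableSet_uIoc).2 (Eventually.of_forall fun s hs => ?_)
      simp only [norm_pow]
      exact pow_le_pow_left₀ (norm_nonneg _) ((hK s (hsub hs) i).trans (le_abs_self _)) 2
  have hh : 0 ≤ h := by linarith [hu.1, hu.2]
  -- Cauchy-Schwarz on [v, t], a subinterval of the window; the increment of F is then enlarged to
  -- the whole window, so only the range of the delay matters.
  have hJ : ∀ v ∈ Icc (t - h) t, t₀ ≤ v → l2 (p t - p v) ^ 2 ≤ h * (F t - F (t - h)) := by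
    intro v hv hv0
    have hvm : v ∈ Icc t₀ t₁ := ⟨hv0, hv.2.trans ht.2⟩
    have h0 : t₀ ∈ Icc t₀ t₁ := ⟨le_rfl, ht.1.trans ht.2⟩
    have h1 := dotProduct_integral_le (g := f) (v := p t - p v) hv.2
      (fun i => (hint i v hvm t ht).1) (fun i => (hint i v hvm t ht).2) (fun i => by
        rw [Pi.sub_apply, hp t ht i, hp v hvm i, add_sub_add_left_eq_sub,
          intervalIntegral.integral_interval_sub_left (hint i _ h0 _ ht).1 (hint i _ h0 _ hvm).1])
    rw [← hFi v hvm t ht hv.2, ← l2_sq] at h1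
    refine h1.trans (mul_le_mul (by linarith [hv.1]) ?_ ?_ hh)
    · linarith [hF hv.1]
    · linarith [hF hv.2]
  have hJ0 : 0 ≤ F t - F (t - h) := sub_nonneg.2 (hF (by linarith))
  rcases le_or_gt t₀ u with hu0 | hu0
  · have := hJ u hu hu0
    have h2 : (0 : ℝ) ≤ if t < t₀ + h then 8 * m * δ ^ 2 else 0 := by split_ifs <;> positivity
    nlinarith [mul_nonneg hh hJ0]
  -- The delayed time falls into the initial interval: split at t₀. The historical part is at most
  -- m(2δ)², and (x + y)² ≤ 2x² + 2y² turns this into 8mδ².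
  · have htl : t < t₀ + h := by linarith [hu.1]
    rw [if_pos htl]
    have h1 := hJ t₀ ⟨by linarith, ht.1⟩ le_rfl
    have h2 : l2 (p t₀ - p u) ^ 2 ≤ m * (2 * δ) ^ 2 := by
      refine (l2_sq_le_card_mul _).trans ?_
      rw [Fintype.card_fin]
      refine mul_le_mul_of_nonneg_left (pow_le_pow_left₀ (norm_nonneg _) ?_ 2) (Nat.cast_nonneg _)
      refine (norm_sub_le _ _).trans ?_
      linarith [hist t₀ ⟨by linarith, le_rfl⟩, hist u ⟨by linarith [hu.1, ht.1], hu0.le⟩]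
    have h3 : l2 (p t - p u) ≤ l2 (p t - p t₀) + l2 (p t₀ - p u) := by
      have := l2_add_le (p t - p t₀) (p t₀ - p u)
      rwa [sub_add_sub_cancel] at this
    have h4 := pow_le_pow_left₀ (l2_nonneg _) h3 2
    nlinarith [sq_nonneg (l2 (p t - p t₀) - l2 (p t₀ - p u))]

end DelaySystem

/-! ### Constants of the Lyapunov functional and its dissipation. -/

section ExponentialEstimate

variable {n m : ℕ} {ι : Type*}

/-- Two-sided quadratic bounds of the energy. -/
theorem energy_bounds {P : (Fin n → ℝ) → ℝ} {g : (Fin n → ℝ) → Fin n → ℝ} {r c C : ℝ}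
    (hP : LocalPotential P g r c C) {M : Fin n → ℝ} {m₀ mm ε : ℝ} (hm0 : 0 < m₀)
    (hM0 : ∀ i, m₀ ≤ M i) (hMm : ∀ i, M i ≤ mm) (hmm : 0 ≤ mm) (hε : 0 ≤ ε)
    (e1 : ε * mm ≤ c) (e2 : ε * mm ≤ m₀ / 2)
    (z : (Fin n → ℝ) × (Fin n → ℝ) × (Fin m → ℝ)) (hz : ‖z.1‖ ≤ r) :
    c / 2 * l2 z.1 ^ 2 + m₀ / 4 * l2 z.2.1 ^ 2 + 1 / 2 * l2 z.2.2 ^ 2 ≤ energy P M ε z ∧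
    energy P M ε z ≤ (C + c) * l2 z.1 ^ 2 + (mm + m₀) * l2 z.2.1 ^ 2 + l2 z.2.2 ^ 2 := by
  obtain ⟨θ, ω, p⟩ := z
  simp only [energy]
  have h1 := hP.lower θ hz
  have h2 := hP.upper θ hz
  have h3 := le_sum_mul_sq hM0 ω
  have h4 := sum_mul_sq_le hMm ω
  have h5 : ∑ i, p i ^ 2 = l2 p ^ 2 := by rw [l2_sq]; simp [dotProduct, sq]
  have h6 := abs_sum_mul_mul_le (fun i => hm0.le.trans (hM0 i)) hMm hmm θ ω
  have h7 : |ε * ∑ i, M i * (θ i * ω i)| ≤ ε * mm / 2 * (l2 θ ^ 2 + l2 ω ^ 2) := by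
    rw [abs_mul, abs_of_nonneg hε]
    have := mul_le_mul_of_nonneg_left h6 hε
    have h8 := mul_nonneg (mul_nonneg hε hmm) (sq_nonneg (l2 θ - l2 ω))
    nlinarith
  obtain ⟨h8, h9⟩ := abs_le.1 h7
  have h10 := mul_le_mul_of_nonneg_right e1 (sq_nonneg (l2 θ))
  have h11 := mul_le_mul_of_nonneg_right e2 (sq_nonneg (l2 ω))
  have h12 := mul_nonneg hP.c_pos.le (sq_nonneg (l2 θ))
  have h13 := mul_nonneg hm0.le (sq_nonneg (l2 ω))
  have h14 := mul_nonneg hmm (sq_nonneg (l2 ω))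
  rw [h5]
  constructor <;> nlinarith [sq_nonneg (l2 p)]

/-- Constants of the Lyapunov functional: `ε` weighs the cross term, `α` is the dissipation rate,
`c₁`, `c₂` bound the functional from below and above. -/
structure LyapunovConstants (M D : Fin n → ℝ) (d k lam γ h cg CP m₀ mm Dm ε α c₁ c₂ : ℝ) :
    Prop where
  m₀_pos : 0 < m₀
  le_M : ∀ i, m₀ ≤ M i
  M_le : ∀ i, M i ≤ mm
  mm_nonneg : 0 ≤ mm
  D_le : ∀ i, D i ≤ Dm
  Dm_nonneg : 0 ≤ Dm
  ε_pos : 0 < ε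
  cross_le_angle : ε * mm ≤ cg
  cross_le_inertia : ε * mm ≤ m₀ / 2
  cross_le_damping : ε * (mm + Dm ^ 2 / cg) ≤ d / 4
  cross_le_coercive : ε * (k ^ 2 / cg) ≤ lam / 8
  α_pos : 0 < α
  α_le_damping : α ≤ d / 4
  α_le_coercive : α ≤ lam / 8
  α_le_angle : α ≤ ε * cg / 2
  α_le_memory : α ≤ γ / 2
  c₁_pos : 0 < c₁
  c₁_le_angle : c₁ ≤ cg / 2
  c₁_le_inertia : c₁ ≤ m₀ / 4
  c₁_le_control : c₁ ≤ 1 / 2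
  c₂_pos : 0 < c₂
  le_c₂_angle : CP + cg ≤ c₂
  le_c₂_inertia : mm + m₀ ≤ c₂
  le_c₂_control : 1 ≤ c₂
  le_c₂_memory : γ * h ≤ c₂

/-- Order of choice: bounds for the inertias and the damping, then ε small against these, and only
then the rate α, which must be small against ε. -/
theorem exists_lyapunovConstants {M D : Fin n → ℝ} (hM : ∀ i, 0 < M i)
    {d k lam γ h cg CP : ℝ} (hd : 0 < d) (hlam : 0 < lam) (hγ : 0 < γ) (hcg : 0 < cg) :
    ∃ m₀ mm Dm ε α c₁ c₂, LyapunovConstants M D d k lam γ h cg CP m₀ mm Dm ε α c₁ c₂ := by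
  obtain ⟨m₀, hm0, hm⟩ : ∃ m₀ > 0, ∀ i, m₀ ≤ M i := by
    rcases isEmpty_or_nonempty (Fin n) with he | he
    · exact ⟨1, one_pos, fun i => he.elim i⟩
    · obtain ⟨i, hi⟩ := Finite.exists_min M
      exact ⟨M i, hM i, hi⟩
  have hub : ∀ X : Fin n → ℝ, ∃ b, 0 ≤ b ∧ ∀ i, X i ≤ b := fun X =>
    ⟨‖X‖, norm_nonneg _, fun i => (le_abs_self _).trans (norm_le_pi_norm X i)⟩
  obtain ⟨mm, hmm, hMm⟩ := hub M
  obtain ⟨Dm, hDm, hDD⟩ := hub D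
  have hsmall : ∀ A B : ℝ, 0 ≤ A → 0 < B → ∃ e > 0, ∀ ε, 0 ≤ ε → ε ≤ e → ε * A ≤ B := by
    intro A B hA hB
    refine ⟨B / (A + 1), by positivity, fun ε h0 hε => ?_⟩
    calc ε * A ≤ ε * (A + 1) := by nlinarith
      _ ≤ B / (A + 1) * (A + 1) := mul_le_mul_of_nonneg_right hε (by positivity)
      _ = B := by field_simp
  obtain ⟨x1, p1, q1⟩ := hsmall mm cg hmm hcg
  obtain ⟨x2, p2, q2⟩ := hsmall mm (m₀ / 2) hmm (by positivity)
  obtain ⟨x3, p3, q3⟩ := hsmall (mm + Dm ^ 2 / cg) (d / 4) (by positivity) (by positivity)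
  obtain ⟨x4, p4, q4⟩ := hsmall (k ^ 2 / cg) (lam / 8) (by positivity) (by positivity)
  obtain ⟨ε, hε, i1, i2, i3, i4⟩ : ∃ ε > 0, ε ≤ x1 ∧ ε ≤ x2 ∧ ε ≤ x3 ∧ ε ≤ x4 :=
    ⟨min (min x1 x2) (min x3 x4), lt_min (lt_min p1 p2) (lt_min p3 p4),
      (min_le_left _ _).trans (min_le_left _ _), (min_le_left _ _).trans (min_le_right _ _),
      (min_le_right _ _).trans (min_le_left _ _), (min_le_right _ _).trans (min_le_right _ _)⟩
  have hmin : ∀ a b e f : ℝ, 0 < a → 0 < b → 0 < e → 0 < f →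
      ∃ x > 0, x ≤ a ∧ x ≤ b ∧ x ≤ e ∧ x ≤ f := fun a b e f ha hb he hf =>
    ⟨min (min a b) (min e f), lt_min (lt_min ha hb) (lt_min he hf),
      (min_le_left _ _).trans (min_le_left _ _), (min_le_left _ _).trans (min_le_right _ _),
      (min_le_right _ _).trans (min_le_left _ _), (min_le_right _ _).trans (min_le_right _ _)⟩
  obtain ⟨α, hα, a1, a2, a3, a4⟩ := hmin (d / 4) (lam / 8) (ε * cg / 2) (γ / 2)
    (by positivity) (by positivity) (by positivity) (by positivity)
  obtain ⟨c₁, hc1, b1, b2, b3, -⟩ := hmin (cg / 2) (m₀ / 4) (1 / 2) 1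
    (by positivity) (by positivity) (by positivity) (by positivity)
  -- Absolute values make one sum dominate every entry although the signs of CP and h are not known
  -- here.
  have hc2 : 0 < |CP + cg| + |mm + m₀| + 1 + |γ * h| := by positivity
  have n1 := abs_nonneg (CP + cg)
  have n2 := abs_nonneg (mm + m₀)
  have n3 := abs_nonneg (γ * h)
  have s1 := le_abs_self (CP + cg)
  have s2 := le_abs_self (mm + m₀)
  have s3 := le_abs_self (γ * h)
  exact ⟨m₀, mm, Dm, ε, α, c₁, |CP + cg| + |mm + m₀| + 1 + |γ * h|, hm0, hm, hMm, hmm, hDD, hDm,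
    hε, q1 ε hε.le i1, q2 ε hε.le i2, q3 ε hε.le i3, q4 ε hε.le i4, hα, a1, a2, a3, a4, hc1, b1,
    b2, b3, hc2, by linarith, by linarith, by linarith, by linarith⟩

variable {P : (Fin n → ℝ) → ℝ} {g : (Fin n → ℝ) → Fin n → ℝ} {r cg CP : ℝ}
  {M D : Fin n → ℝ} {B : Matrix (Fin n) (Fin m) ℝ} {L : ι → Matrix (Fin m) (Fin m) ℝ}
  {h d k l lam γ m₀ mm Dm ε α c₁ c₂ : ℝ}

/-- Dissipation of the energy together with the memory term. -/
theorem energy_dissipation (hP : LocalPotential P g r cg CP)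
    (hB : GainBounds D B L h d k l lam γ)
    (hc : LyapunovConstants M D d k lam γ h cg CP m₀ mm Dm ε α c₁ c₂) (ℓ : ι)
    (z : (Fin n → ℝ) × (Fin n → ℝ) × (Fin m → ℝ)) (hz : ‖z.1‖ ≤ r) (pd : Fin m → ℝ) {J η : ℝ}
    (hJ : 0 ≤ J) (he : l2 (z.2.2 - pd) ^ 2 ≤ 2 * h * J + η) :
    let z' := delayField M D B g (L ℓ) z pd
    (g z.1 ⬝ᵥ z'.1 + (∑ i, M i * (z.2.1 i * z'.2.1 i)) + (∑ i, z.2.2 i * z'.2.2 i)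
        + ε * ∑ i, M i * (z'.1 i * z.2.1 i + z.1 i * z'.2.1 i))
      + γ * (h * (z'.2.2 ⬝ᵥ z'.2.2) - J) ≤
    -(α * (l2 z.1 ^ 2 + l2 z.2.1 ^ 2 + l2 z.2.2 ^ 2 + J))
      + (l ^ 2 / (2 * lam) + 4 * γ * h * l ^ 2) * η := by
  intro z'
  have hMp : ∀ i, 0 < M i := fun i => hc.m₀_pos.trans_le (hc.le_M i)
  have heq := energy_deriv_eq hMp B g (L ℓ) ε z pd (D := D)
  simp only at heq
  rw [heq]
  obtain ⟨θ, ω, p⟩ := z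
  simp only at hz he ⊢
  have hDp : ∀ i, 0 ≤ D i := fun i => hB.d_pos.le.trans (hB.damping i)
  have hX3 : p ⬝ᵥ L ℓ *ᵥ (p - pd) ≤ l * l2 p * l2 (p - pd) := by
    refine (dotProduct_le _ _).trans ?_
    have := mul_le_mul_of_nonneg_left (hB.feedback ℓ (p - pd)) (l2_nonneg p)
    linarith
  have hQ : l2 z'.2.2 ≤ k * l2 ω + l * l2 pd :=
    (l2_sub_le _ _).trans (add_le_add (hB.input_transpose ω) (hB.feedback ℓ pd))
  have hw : l2 pd ≤ l2 p + l2 (p - pd) := by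
    have := l2_sub_le p (p - pd)
    rwa [sub_sub_cancel] at this
  have hY2 := abs_sum_mul_mul_le hDp hc.D_le hc.Dm_nonneg θ ω
  have hY4 : -(θ ⬝ᵥ B *ᵥ p) ≤ k * l2 p * l2 θ := by
    have h1 := neg_le_of_abs_le (abs_dotProduct_le θ (B *ᵥ p))
    have h2 := mul_le_mul_of_nonneg_left (hB.input p) (l2_nonneg θ)
    linarith
  have key := dissipation hB.h_nonneg hB.lam_pos hB.γ_pos.le hP.c_pos hc.ε_pos.le
    (l2_nonneg pd) hJ hB.damping_dominates hB.coercive_dominates hB.memory_dominates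
    hc.cross_le_damping hc.cross_le_coercive
    (le_sum_mul_sq hB.damping ω) (hB.coercive ℓ p) hX3 (l2_nonneg z'.2.2) hQ hw he
    (sum_mul_sq_le hc.M_le ω) (by linarith [neg_le_of_abs_le hY2] :
      -(∑ i, D i * (θ i * ω i)) ≤ Dm * l2 ω * l2 θ) (hP.monotone θ hz) hY4
  rw [l2_sq z'.2.2] at key
  refine (le_of_eq ?_).trans (key.trans ?_)
  · ring
  · have a1 := mul_le_mul_of_nonneg_right hc.α_le_damping (sq_nonneg (l2 ω))
    have a2 := mul_le_mul_of_nonneg_right hc.α_le_coercive (sq_nonneg (l2 p))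
    have a3 := mul_le_mul_of_nonneg_right hc.α_le_angle (sq_nonneg (l2 θ))
    have a4 := mul_le_mul_of_nonneg_right hc.α_le_memory hJ
    linarith

end ExponentialEstimate

/-! ### Measurability and boundedness along solutions, and the exponential estimate. -/

section ExponentialEstimate

variable {n m : ℕ} {ι : Type*}

/-- Every preimage is a finite union of level sets of σ, so no σ-algebra on the set of topologies is
needed. -/
theorem measurable_comp_of_finite [Finite ι] {σ : ℝ → ι}
    (hσ : ∀ ℓ, MeasurableSet (σ ⁻¹' {ℓ})) {β : Type*} [MeasurableSpace β] (φ : ι → β) :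
    Measurable fun s => φ (σ s) := by
  intro s _
  have : (fun s => φ (σ s)) ⁻¹' s = ⋃ ℓ ∈ φ ⁻¹' s, σ ⁻¹' {ℓ} := by
    ext x; simp
  rw [this]
  exact MeasurableSet.biUnion (Set.toFinite _).countable fun ℓ _ => hσ ℓ

/-- `z` is continuous and solves the delay system on `[t₀, t₁]` in integral form. -/
structure IsDelaySolution (M D : Fin n → ℝ) (B : Matrix (Fin n) (Fin m) ℝ)
    (g : (Fin n → ℝ) → Fin n → ℝ) (L : ι → Matrix (Fin m) (Fin m) ℝ) (σ : ℝ → ι) (τ : ℝ → ℝ)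
    (t₀ t₁ : ℝ) (z : ℝ → (Fin n → ℝ) × (Fin n → ℝ) × (Fin m → ℝ)) : Prop where
  continuous : Continuous z
  eq_integral : ∀ t ∈ Icc t₀ t₁, z t = z t₀ +
    ∫ s in t₀..t, delayField M D B g (L (σ s)) (z s) (z (s - τ s)).2.2

theorem continuous_delayField (M D : Fin n → ℝ) (B : Matrix (Fin n) (Fin m) ℝ)
    {g : (Fin n → ℝ) → Fin n → ℝ} (hg : Continuous g) :
    Continuous fun x : Matrix (Fin m) (Fin m) ℝ ×
      ((Fin n → ℝ) × (Fin n → ℝ) × (Fin m → ℝ)) × (Fin m → ℝ) =>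
        delayField M D B g x.1 x.2.1 x.2.2 := by
  unfold delayField
  refine Continuous.prodMk (by fun_prop) (Continuous.prodMk ?_ ?_)
  · refine continuous_pi fun i => continuous_const.mul (((by fun_prop :
      Continuous _).sub ?_).sub ?_)
    · exact (continuous_apply i).comp (hg.comp (by fun_prop))
    · exact (continuous_apply i).comp (Continuous.matrix_mulVec continuous_const (by fun_prop))
  · have h1 := Continuous.matrix_mulVec (continuous_const (y := Bᵀ)) (continuous_fst.comp
      (continuous_snd.comp (continuous_fst.comp continuous_snd)) : Continuous fun x :
        Matrix (Fin m) (Fin m) ℝ × ((Fin n → ℝ) × (Fin n → ℝ) × (Fin m → ℝ)) × (Fin m → ℝ) =>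
          x.2.1.2.1)
    have h2 := Continuous.matrix_mulVec (continuous_fst : Continuous fun x :
        Matrix (Fin m) (Fin m) ℝ × ((Fin n → ℝ) × (Fin n → ℝ) × (Fin m → ℝ)) × (Fin m → ℝ) =>
          x.1) (continuous_snd.comp continuous_snd)
    exact h1.sub h2

variable {P : (Fin n → ℝ) → ℝ} {g : (Fin n → ℝ) → Fin n → ℝ} {r cg CP : ℝ}
  {M D : Fin n → ℝ} {B : Matrix (Fin n) (Fin m) ℝ} {L : ι → Matrix (Fin m) (Fin m) ℝ}
  {h d k l lam γ m₀ mm Dm ε α c₁ c₂ : ℝ} {σ : ℝ → ι} {τ : ℝ → ℝ} {t₀ t₁ : ℝ}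
  {z : ℝ → (Fin n → ℝ) × (Fin n → ℝ) × (Fin m → ℝ)}

theorem measurable_delayField [Finite ι] (hg : Continuous g)
    (hσ : ∀ ℓ, MeasurableSet (σ ⁻¹' {ℓ})) (hτ : Measurable τ) (hz : Continuous z) :
    Measurable fun s => delayField M D B g (L (σ s)) (z s) (z (s - τ s)).2.2 := by
  have h1 : ∀ i j, Measurable fun s => L (σ s) i j := fun i j =>
    measurable_comp_of_finite hσ fun ℓ => L ℓ i j
  have h2 : Measurable fun s => (z (s - τ s)).2.2 :=
    (continuous_snd.comp (continuous_snd.comp hz)).measurable.comp (measurable_id.sub hτ)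
  unfold delayField
  refine Measurable.prodMk (by fun_prop) (Measurable.prodMk ?_ ?_)
  · refine Continuous.measurable ?_
    refine continuous_pi fun i => continuous_const.mul (((by fun_prop :
      Continuous _).sub ?_).sub ?_)
    · exact (continuous_apply i).comp (hg.comp (by fun_prop))
    · exact (continuous_apply i).comp (Continuous.matrix_mulVec continuous_const (by fun_prop))
  · refine measurable_pi_iff.2 fun i => Measurable.sub ?_ ?_
    · exact ((continuous_apply i).comp
        (Continuous.matrix_mulVec continuous_const (by fun_prop))).measurable
    · exact Finset.measurable_fun_sum Finset.univ fun j _ =>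
        (h1 i j).mul ((measurable_pi_apply j).comp h2)

/-- For a fixed topology, present and delayed times are treated as independent variables in a
compact rectangle, so τ may be arbitrarily irregular; then the maximum over the finitely many
topologies is taken. -/
theorem exists_bound_delayField [Finite ι] (hg : Continuous g)
    (hτ : ∀ t, τ t ∈ Icc 0 h) (hz : Continuous z) :
    ∃ K : ℝ≥0, ∀ s ∈ Icc t₀ t₁,
      ‖delayField M D B g (L (σ s)) (z s) (z (s - τ s)).2.2‖ ≤ K := by
  have hc := continuous_delayField M D B hg
  have h1 : ∀ ℓ, ∃ K : ℝ, ∀ s ∈ Icc t₀ t₁, ∀ u ∈ Icc (t₀ - h) t₁,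
      ‖delayField M D B g (L ℓ) (z s) (z u).2.2‖ ≤ K := by
    intro ℓ
    have hcomp : IsCompact (Icc t₀ t₁ ×ˢ Icc (t₀ - h) t₁) := isCompact_Icc.prod isCompact_Icc
    have hcont : Continuous fun x : ℝ × ℝ => delayField M D B g (L ℓ) (z x.1) (z x.2).2.2 :=
      hc.comp (continuous_const.prodMk ((hz.comp continuous_fst).prodMk
        (continuous_snd.comp (continuous_snd.comp (hz.comp continuous_snd)))))
    obtain ⟨K, hK⟩ := hcomp.exists_bound_of_continuousOn hcont.continuousOn
    exact ⟨K, fun s hs u hu => hK (s, u) ⟨hs, hu⟩⟩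
  choose K hK using h1
  obtain ⟨K', hK'⟩ := (Set.finite_range K).bddAbove
  refine ⟨Real.toNNReal K', fun s hs => ?_⟩
  refine (hK (σ s) s hs _ ⟨?_, ?_⟩).trans ((hK' ⟨σ s, rfl⟩).trans (Real.le_coe_toNNReal _))
  · linarith [hs.1, (hτ s).2]
  · linarith [hs.2, (hτ s).1]

/-- Exponential estimate on an interval on which the angle errors remain in the region where the
potential is strongly convex. -/
theorem exp_estimate_of_forall_norm_le [Finite ι] (hP : LocalPotential P g r cg CP)
    (hB : GainBounds D B L h d k l lam γ)
    (hc : LyapunovConstants M D d k lam γ h cg CP m₀ mm Dm ε α c₁ c₂)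
    {ce β κ C δ b : ℝ} (hce : ce = l ^ 2 / (2 * lam) + 4 * γ * h * l ^ 2) (hβ : β = α / c₂)
    (hκ : κ = ce * (8 * m * Real.exp (2 * β * h)) / β)
    (hC : C = (c₂ * (2 * n + m) + κ) / c₁)
    (hσ : ∀ ℓ, MeasurableSet (σ ⁻¹' {ℓ})) (hτm : Measurable τ) (hτ : ∀ t, τ t ∈ Icc 0 h)
    (hz : IsDelaySolution M D B g L σ τ t₀ t₁ z) (hist : ∀ s ∈ Icc (t₀ - h) t₀, ‖z s‖ ≤ δ)
    (hb : b ∈ Icc t₀ t₁) (hr : ∀ t ∈ Icc t₀ b, ‖z t‖ ≤ r) :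
    ‖z b‖ ^ 2 ≤ C * δ ^ 2 * Real.exp (-β * (b - t₀)) := by
  set f := fun s => delayField M D B g (L (σ s)) (z s) (z (s - τ s)).2.2 with hf
  have hfm : Measurable f := measurable_delayField hP.continuous_grad hσ hτm hz.continuous
  obtain ⟨K, hK⟩ : ∃ K : ℝ≥0, ∀ s ∈ Icc t₀ t₁, ‖f s‖ ≤ K :=
    exists_bound_delayField hP.continuous_grad hτ hz.continuous
  have h01 : t₀ ≤ t₁ := hb.1.trans hb.2
  have hβ0 : 0 < β := by rw [hβ]; exact div_pos hc.α_pos hc.c₂_pos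
  have hce0 : 0 ≤ ce := by
    have := hB.lam_pos; have := hB.γ_pos; have := hB.h_nonneg
    rw [hce]; positivity
  have hκ0 : 0 ≤ κ := by rw [hκ]; positivity
  have hfi : IntervalIntegrable f volume t₀ t₁ := by
    refine (intervalIntegrable_const (c := (K : ℝ))).mono_fun hfm.aestronglyMeasurable ?_
    refine (ae_restrict_iff' measurableSet_uIoc).2 (Eventually.of_forall fun s hs => ?_)
    rw [uIoc_of_le h01] at hs
    exact (hK s ⟨hs.1.le, hs.2⟩).trans (le_abs_self _)
  have hder := ae_hasDerivAt_of_eq_integral hfi hz.eq_integral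
  have hlip := lipschitzOnWith_of_eq_integral hfi hK hz.eq_integral
  -- the memory term
  set q : ℝ → ℝ := (Icc t₀ t₁).indicator fun s => (f s).2.2 ⬝ᵥ (f s).2.2 with hq
  have hqm : Measurable q := by
    refine Measurable.indicator ?_ measurableSet_Icc
    refine Finset.measurable_fun_sum _ fun i _ => ?_
    have : Measurable fun s => (f s).2.2 i :=
      (measurable_pi_apply i).comp (measurable_snd.comp (measurable_snd.comp hfm))
    exact this.mul this
  have hq0 : ∀ t, 0 ≤ q t := fun t => indicator_nonneg (fun s _ => by
    rw [← l2_sq]; exact sq_nonneg _) t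
  have hqC : ∀ t, q t ≤ m * (K : ℝ) ^ 2 := fun t => by
    by_cases hs : t ∈ Icc t₀ t₁
    swap
    · rw [hq, indicator_of_notMem hs]; positivity
    rw [hq, indicator_of_mem hs, ← l2_sq]
    refine (l2_sq_le_card_mul _).trans ?_
    rw [Fintype.card_fin]
    refine mul_le_mul_of_nonneg_left (pow_le_pow_left₀ (norm_nonneg _) ?_ 2) (Nat.cast_nonneg _)
    exact ((norm_snd_le _).trans (norm_snd_le _)).trans (hK t hs)
  -- The indicator makes F vanish up to t₀: the memory term starts from zero and no derivative of
  -- the initial function is ever needed.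
  have hF := isMemory_integral hqm hq0 hqC (fun t ht => indicator_of_notMem
    (fun hm => absurd hm.1 (not_le.2 ht)) _)
  set F : ℝ → ℝ := fun t => ∫ s in t₀..t, q s with hFdef
  have hFi : ∀ s ∈ Icc t₀ t₁, ∀ t ∈ Icc t₀ t₁, s ≤ t →
      F t - F s = ∫ x in s..t, (f x).2.2 ⬝ᵥ (f x).2.2 := by
    intro s hs t ht hst
    have hqi : ∀ u v, IntervalIntegrable q volume u v := fun u v => by
      refine (intervalIntegrable_const (c := m * (K : ℝ) ^ 2)).mono_fun
        hqm.aestronglyMeasurable (Eventually.of_forall fun x => ?_)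
      simp only [Real.norm_of_nonneg (hq0 x)]
      exact (hqC x).trans (le_abs_self _)
    rw [hFdef]
    simp only
    rw [intervalIntegral.integral_interval_sub_left (hqi _ _) (hqi _ _)]
    refine intervalIntegral.integral_congr fun x hx => ?_
    rw [uIcc_of_le hst] at hx
    exact indicator_of_mem (show x ∈ Icc t₀ t₁ from ⟨hs.1.trans hx.1, hx.2.trans ht.2⟩) _
  -- the Lyapunov functional
  set Y : ℝ → ℝ := fun t => energy P M ε (z t) + γ * (h * F t - ∫ s in (t - h)..t, F s)
    + κ * δ ^ 2 * Real.exp (-(2 * β) * (t - t₀)) with hY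
  have hYac : AbsolutelyContinuousOnInterval Y t₀ b := by
    have hl : LipschitzOnWith K z (uIcc t₀ b) := by
      rw [uIcc_of_le hb.1]; exact hlip.mono (Icc_subset_Icc_right hb.2)
    have g1 := absolutelyContinuousOnInterval_contDiff_comp (contDiff_energy hP.contDiff M ε) hl
    have g2 := (((hF.absolutelyContinuousOnInterval t₀ b).const_mul h).sub
      (hF.absolutelyContinuousOnInterval_window h t₀ b)).const_mul γ
    refine (g1.add g2).add ?_
    · apply ContDiffOn.absolutelyContinuousOnInterval
      exact ContDiff.contDiffOn (by fun_prop)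
  have hYd : ∀ᵐ t, t ∈ Ioo t₀ b → ∃ y', HasDerivAt Y y' t ∧ y' ≤ -β * Y t := by
    filter_upwards [hder, hF.deriv] with t ht1 ht2 htm
    have htI : t ∈ Icc t₀ t₁ := ⟨htm.1.le, (htm.2.trans_le hb.2).le⟩
    have hd := ht1 ⟨htm.1, htm.2.trans_le hb.2⟩
    have hde := hasDerivAt_energy hP M ε hd
    have hexp : HasDerivAt (fun t => κ * δ ^ 2 * Real.exp (-(2 * β) * (t - t₀)))
        (κ * δ ^ 2 * (Real.exp (-(2 * β) * (t - t₀)) * (-(2 * β)))) t := by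
      have := ((((hasDerivAt_id t).sub_const t₀).const_mul (-(2 * β))).exp).const_mul (κ * δ ^ 2)
      simpa using this
    refine ⟨_, (hde.add (((ht2.const_mul h).sub (hF.hasDerivAt_window h t)).const_mul γ)).add
      hexp, ?_⟩
    have hJ : 0 ≤ F t - F (t - h) := sub_nonneg.2 (hF.mono (by linarith [hB.h_nonneg]))
    have hzr : ‖(z t).1‖ ≤ r := (norm_fst_le _).trans (hr t ⟨htm.1.le, htm.2.le⟩)
    set X := Real.exp (-(2 * β) * (t - t₀)) with hX
    have hX0 : 0 < X := Real.exp_pos _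
    have hmis : l2 ((z t).2.2 - (z (t - τ t)).2.2) ^ 2 ≤ 2 * h * (F t - F (t - h)) +
        8 * m * δ ^ 2 * (Real.exp (2 * β * h) * X) := by
      refine (delay_mismatch (p := fun s => (z s).2.2) (f := fun s => (f s).2.2) (F := F)
        (t₀ := t₀) (t₁ := t₁) (h := h) (δ := δ) (K := K) (fun i =>
          (measurable_pi_apply i).comp (measurable_snd.comp (measurable_snd.comp hfm)))
        (fun s hs i => ?_) (fun s hs i => ?_) hF.mono hFi (fun s hs => ?_) htI
        ⟨by linarith [(hτ t).2], by linarith [(hτ t).1]⟩).trans (add_le_add le_rfl ?_)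
      · exact ((norm_le_pi_norm (f s).2.2 i).trans
          ((norm_snd_le _).trans (norm_snd_le _))).trans (hK s hs)
      · have hs' : IntervalIntegrable f volume t₀ s := hfi.mono_set (by
          rw [uIcc_of_le hs.1, uIcc_of_le h01]; exact Icc_subset_Icc_right hs.2)
        have hlin := ((ContinuousLinearMap.proj (R := ℝ) (φ := fun _ : Fin m => ℝ) i).comp
          ((ContinuousLinearMap.snd ℝ (Fin n → ℝ) (Fin m → ℝ)).comp
          (ContinuousLinearMap.snd ℝ (Fin n → ℝ) ((Fin n → ℝ) × (Fin m → ℝ))))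
            ).intervalIntegral_comp_comm hs'
        have := congrArg (fun w => w.2.2 i) (hz.eq_integral s hs)
        simp only [Prod.snd_add, Pi.add_apply] at this
        rw [this]
        congr 1
        exact hlin.symm
      · exact ((norm_snd_le _).trans (norm_snd_le _)).trans (hist s hs)
      -- Before t₀ + h the factor exp(2βh)·X is at least 1, so the historical contribution may be
      -- replaced by a decaying exponential valid at all times.
      · split_ifs with hlt
        · have : 1 ≤ Real.exp (2 * β * h) * X := by
            rw [hX, ← Real.exp_add, Real.one_le_exp_iff]
            nlinarith
          exact le_mul_of_one_le_right (by positivity) this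
        · positivity
    have hdis := energy_dissipation hP hB hc (σ t) (z t) hzr (z (t - τ t)).2.2 hJ hmis
    simp only at hdis
    have hqt : q t = (f t).2.2 ⬝ᵥ (f t).2.2 := indicator_of_mem htI _
    rw [hqt]
    have hup := (energy_bounds hP hc.m₀_pos hc.le_M hc.M_le hc.mm_nonneg hc.ε_pos.le
      hc.cross_le_angle hc.cross_le_inertia (z t) hzr).2
    have hw := (hF.window_bounds hB.h_nonneg t).2
    -- The functional is at most c₂ times the sum that is dissipated at rate α; hence the decay rate
    -- β = α / c₂.
    have hV : energy P M ε (z t) + γ * (h * F t - ∫ s in (t - h)..t, F s) ≤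
        c₂ * (l2 (z t).1 ^ 2 + l2 (z t).2.1 ^ 2 + l2 (z t).2.2 ^ 2 + (F t - F (t - h))) := by
      have a1 := mul_le_mul_of_nonneg_right hc.le_c₂_angle (sq_nonneg (l2 (z t).1))
      have a2 := mul_le_mul_of_nonneg_right hc.le_c₂_inertia (sq_nonneg (l2 (z t).2.1))
      have a3 := mul_le_mul_of_nonneg_right hc.le_c₂_control (sq_nonneg (l2 (z t).2.2))
      have a4 := mul_le_mul_of_nonneg_right hc.le_c₂_memory hJ
      have a5 := mul_le_mul_of_nonneg_left hw hB.γ_pos.le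
      linarith
    have hβV := mul_le_mul_of_nonneg_left hV hβ0.le
    have hβc : β * c₂ = α := by rw [hβ]; exact div_mul_cancel₀ _ hc.c₂_pos.ne'
    rw [← mul_assoc, hβc] at hβV
    -- This fixes κ: the summand κδ²X has derivative -2β times itself; one half cancels the
    -- historical forcing, the other half is the decay required of Y.
    have hκβ : ce * (8 * m * δ ^ 2 * (Real.exp (2 * β * h) * X)) = β * (κ * δ ^ 2 * X) := by
      rw [hκ]; field_simp
    rw [← hce, hκβ] at hdis
    simp only [hY]
    linarith
  have hdecay := le_mul_exp_of_ae_hasDerivAt_le hb.1 hYac hYd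
  have hr0 : ∀ t ∈ Icc t₀ b, ‖(z t).1‖ ≤ r := fun t ht => (norm_fst_le _).trans (hr t ht)
  have hbd := fun t (ht : t ∈ Icc t₀ b) => energy_bounds hP hc.m₀_pos hc.le_M hc.M_le
    hc.mm_nonneg hc.ε_pos.le hc.cross_le_angle hc.cross_le_inertia (z t) (hr0 t ht)
  have hlow : c₁ * ‖z b‖ ^ 2 ≤ Y b := by
    have h1 := (hbd b ⟨hb.1, le_rfl⟩).1
    have h2 := mul_nonneg hB.γ_pos.le (hF.window_bounds hB.h_nonneg b).1
    have h3 : 0 ≤ κ * δ ^ 2 * Real.exp (-(2 * β) * (b - t₀)) := by positivity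
    have h4 : ‖z b‖ ^ 2 ≤ l2 (z b).1 ^ 2 + l2 (z b).2.1 ^ 2 + l2 (z b).2.2 ^ 2 := by
      have s1 := sq_norm_le_l2_sq (z b).1
      have s2 := sq_norm_le_l2_sq (z b).2.1
      have s3 := sq_norm_le_l2_sq (z b).2.2
      have p1 := sq_nonneg (l2 (z b).1)
      have p2 := sq_nonneg (l2 (z b).2.1)
      have p3 := sq_nonneg (l2 (z b).2.2)
      rw [Prod.norm_def, Prod.norm_def]
      rcases max_choice ‖(z b).1‖ (max ‖(z b).2.1‖ ‖(z b).2.2‖) with e | e <;> rw [e]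
      · linarith
      · rcases max_choice ‖(z b).2.1‖ ‖(z b).2.2‖ with e | e <;> rw [e] <;> linarith
    have h5 := mul_le_mul_of_nonneg_left h4 hc.c₁_pos.le
    have a1 := mul_le_mul_of_nonneg_right hc.c₁_le_angle (sq_nonneg (l2 (z b).1))
    have a2 := mul_le_mul_of_nonneg_right hc.c₁_le_inertia (sq_nonneg (l2 (z b).2.1))
    have a3 := mul_le_mul_of_nonneg_right hc.c₁_le_control (sq_nonneg (l2 (z b).2.2))
    simp only [hY]
    linarith
  -- The memory term is zero at t₀. The factor 2n + m counts coordinates, from the comparison of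
  -- Euclidean and maximum norms on the three components.
  have hini : Y t₀ ≤ (c₂ * (2 * n + m) + κ) * δ ^ 2 := by
    have h1 := (hbd t₀ ⟨le_rfl, hb.1⟩).2
    have hw := (hF.window_bounds hB.h_nonneg t₀).2
    rw [hF.zero t₀ le_rfl, hF.zero (t₀ - h) (by linarith [hB.h_nonneg]), sub_zero, mul_zero] at hw
    have a5 := mul_le_mul_of_nonneg_left hw hB.γ_pos.le
    have hδ : ‖z t₀‖ ^ 2 ≤ δ ^ 2 := pow_le_pow_left₀ (norm_nonneg _)
      (hist t₀ ⟨by linarith [hB.h_nonneg], le_rfl⟩) 2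
    have hl : ∀ {j : ℕ} (x : Fin j → ℝ), ‖x‖ ≤ ‖z t₀‖ → l2 x ^ 2 ≤ j * δ ^ 2 := fun {j} x hx => by
      refine (l2_sq_le_card_mul x).trans ?_
      rw [Fintype.card_fin]
      exact mul_le_mul_of_nonneg_left ((pow_le_pow_left₀ (norm_nonneg _) hx 2).trans hδ)
        (Nat.cast_nonneg _)
    have b1 := mul_le_mul_of_nonneg_left (hl (z t₀).1 (norm_fst_le _)) hc.c₂_pos.le
    have b2 := mul_le_mul_of_nonneg_left
      (hl (z t₀).2.1 ((norm_fst_le _).trans (norm_snd_le _))) hc.c₂_pos.le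
    have b3 := mul_le_mul_of_nonneg_left
      (hl (z t₀).2.2 ((norm_snd_le _).trans (norm_snd_le _))) hc.c₂_pos.le
    have a1 := mul_le_mul_of_nonneg_right hc.le_c₂_angle (sq_nonneg (l2 (z t₀).1))
    have a2 := mul_le_mul_of_nonneg_right hc.le_c₂_inertia (sq_nonneg (l2 (z t₀).2.1))
    have a3 := mul_le_mul_of_nonneg_right hc.le_c₂_control (sq_nonneg (l2 (z t₀).2.2))
    simp only [hY, hF.zero t₀ le_rfl, sub_self, mul_zero, Real.exp_zero, mul_one] at a5 ⊢
    linarith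
  have hE := Real.exp_pos (-β * (b - t₀))
  have hfin := hlow.trans (hdecay.trans (mul_le_mul_of_nonneg_right hini hE.le))
  have : C * δ ^ 2 * Real.exp (-β * (b - t₀)) =
      ((c₂ * (2 * n + m) + κ) * δ ^ 2 * Real.exp (-β * (b - t₀))) / c₁ := by
    rw [hC]; ring
  rw [this, le_div_iff₀ hc.c₁_pos, mul_comm]
  exact hfin

end ExponentialEstimate

/-! ### From exponential estimates to local uniform asymptotic stability. -/

section LocalStability

/-- For stability, δ ≤ ε/(C + 1) works because C < (C + 1)². For attraction, the waiting time comes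
from x < eˣ, which avoids logarithms and the case C = 0. -/
theorem isLUAS_of_exp_estimate {J E : Type*} [NormedAddCommGroup E] {h : ℝ}
    {Sol : J → ℝ → ℝ → (ℝ → E) → Prop}
    (h0 : ∀ j t₀ t₁, 0 ≤ t₀ → t₀ ≤ t₁ → Sol j t₀ t₁ fun _ => 0) {δ₀ C β : ℝ} (hδ₀ : 0 < δ₀)
    (hC : 0 ≤ C) (hβ : 0 < β)
    (hest : ∀ j t₀ t₁ z δ, 0 ≤ t₀ → t₀ ≤ t₁ → Sol j t₀ t₁ z → 0 < δ → δ ≤ δ₀ →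
      (∀ s ∈ Icc (t₀ - h) t₀, ‖z s‖ < δ) →
        ∀ t ∈ Icc t₀ t₁, ‖z t‖ ^ 2 ≤ C * δ ^ 2 * Real.exp (-β * (t - t₀))) :
    IsLUAS h Sol := by
  refine ⟨h0, fun ε hε => ?_, δ₀, hδ₀, fun ε hε => ?_⟩
  · refine ⟨min δ₀ (ε / (C + 1)), lt_min hδ₀ (by positivity), ?_⟩
    intro j t₀ t₁ z ht0 ht01 hs hist t ht
    have hδ : 0 < min δ₀ (ε / (C + 1)) := lt_min hδ₀ (by positivity)
    have h1 := hest j t₀ t₁ z _ ht0 ht01 hs hδ (min_le_left _ _) hist t ht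
    have h2 : Real.exp (-β * (t - t₀)) ≤ 1 := by
      rw [Real.exp_le_one_iff]; nlinarith [ht.1]
    have h3 : min δ₀ (ε / (C + 1)) ^ 2 ≤ (ε / (C + 1)) ^ 2 :=
      pow_le_pow_left₀ hδ.le (min_le_right _ _) 2
    have h4 : C * (ε / (C + 1)) ^ 2 < ε ^ 2 := by
      rw [div_pow, ← mul_div_assoc, div_lt_iff₀ (by positivity)]
      nlinarith [mul_pos hε hε, mul_nonneg hC hC, mul_nonneg hC (mul_pos hε hε).le,
        mul_nonneg (mul_nonneg hC hC) (mul_pos hε hε).le]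
    refine lt_of_pow_lt_pow_left₀ 2 hε.le (lt_of_le_of_lt ?_ h4)
    refine h1.trans ((mul_le_of_le_one_right (by positivity) h2).trans ?_)
    exact mul_le_mul_of_nonneg_left h3 hC
  · refine ⟨C * δ₀ ^ 2 / ε ^ 2 / β + 1, by positivity, ?_⟩
    intro j t₀ t₁ z ht0 ht01 hs hist t ht
    have hT : 0 ≤ C * δ₀ ^ 2 / ε ^ 2 / β := by positivity
    have h1 := hest j t₀ t₁ z _ ht0 ht01 hs hδ₀ le_rfl hist t ⟨by linarith [ht.1], ht.2⟩
    refine lt_of_pow_lt_pow_left₀ 2 hε.le (lt_of_le_of_lt h1 ?_)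
    have h2 : C * δ₀ ^ 2 / ε ^ 2 < β * (t - t₀) := by
      have h3 : C * δ₀ ^ 2 / ε ^ 2 / β < t - t₀ := by linarith [ht.1]
      rw [div_lt_iff₀ hβ] at h3; linarith
    have h4 : C * δ₀ ^ 2 / ε ^ 2 < Real.exp (β * (t - t₀)) :=
      h2.trans ((lt_add_one _).trans_le (Real.add_one_le_exp _))
    rw [neg_mul, Real.exp_neg, ← div_eq_mul_inv, div_lt_iff₀ (Real.exp_pos _)]
    rw [div_lt_iff₀ (by positivity)] at h4
    linarith

variable {n m : ℕ} {ι : Type*} {P : (Fin n → ℝ) → ℝ} {g : (Fin n → ℝ) → Fin n → ℝ} {r cg CP : ℝ}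
  {M D : Fin n → ℝ} {B : Matrix (Fin n) (Fin m) ℝ} {L : ι → Matrix (Fin m) (Fin m) ℝ}
  {h d k l lam γ : ℝ}

/-- Small solutions of the delay system decay exponentially, uniformly in the switching signal, the
delay and the initial time. -/
theorem exists_exp_estimate [Finite ι] (hM : ∀ i, 0 < M i) (hP : LocalPotential P g r cg CP)
    (hB : GainBounds D B L h d k l lam γ) :
    ∃ δ₀ > 0, ∃ C ≥ 0, ∃ β > 0, ∀ (σ : ℝ → ι) (τ : ℝ → ℝ) (t₀ t₁ : ℝ)
      (z : ℝ → (Fin n → ℝ) × (Fin n → ℝ) × (Fin m → ℝ)) (δ : ℝ),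
      (∀ ℓ, MeasurableSet (σ ⁻¹' {ℓ})) → Measurable τ → (∀ t, τ t ∈ Icc 0 h) → t₀ ≤ t₁ →
      0 < δ → δ ≤ δ₀ → ContinuousOn z (Icc (t₀ - h) t₁) →
      (∀ t ∈ Icc t₀ t₁, z t = z t₀ +
        ∫ s in t₀..t, delayField M D B g (L (σ s)) (z s) (z (s - τ s)).2.2) →
      (∀ s ∈ Icc (t₀ - h) t₀, ‖z s‖ < δ) →
      ∀ t ∈ Icc t₀ t₁, ‖z t‖ ^ 2 ≤ C * δ ^ 2 * Real.exp (-β * (t - t₀)) := by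
  obtain ⟨m₀, mm, Dm, ε, α, c₁, c₂, hc⟩ := exists_lyapunovConstants (M := M) (D := D) hM
    (k := k) (h := h) (CP := CP) hB.d_pos hB.lam_pos hB.γ_pos hP.c_pos
  obtain ⟨ce, hce⟩ : ∃ ce, ce = l ^ 2 / (2 * lam) + 4 * γ * h * l ^ 2 := ⟨_, rfl⟩
  obtain ⟨β, hβ⟩ : ∃ β, β = α / c₂ := ⟨_, rfl⟩
  obtain ⟨κ, hκ⟩ : ∃ κ, κ = ce * (8 * m * Real.exp (2 * β * h)) / β := ⟨_, rfl⟩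
  obtain ⟨C, hC⟩ : ∃ C, C = (c₂ * (2 * n + m) + κ) / c₁ := ⟨_, rfl⟩
  have hβ0 : 0 < β := by rw [hβ]; exact div_pos hc.α_pos hc.c₂_pos
  have hce0 : 0 ≤ ce := by
    have := hB.lam_pos; have := hB.γ_pos; have := hB.h_nonneg
    rw [hce]; positivity
  have hκ0 : 0 ≤ κ := by rw [hκ]; positivity
  have hC0 : 0 ≤ C := by
    have := hc.c₁_pos; have := hc.c₂_pos
    rw [hC]; positivity
  have hrp := hP.r_pos
  -- This radius gives both Cδ² < r² and δ < r, which the exit argument needs.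
  refine ⟨r / (C + 1) / 2, by positivity, C, hC0, β, hβ0, ?_⟩
  intro σ τ t₀ t₁ z δ hσ hτm hτ h01 hδ0 hδ hzc hzi hist
  have hh := hB.h_nonneg
  -- extend the solution to a continuous function on the line
  have hle : t₀ - h ≤ t₁ := by linarith
  obtain ⟨y, hyc, hyz⟩ : ∃ y : ℝ → (Fin n → ℝ) × (Fin n → ℝ) × (Fin m → ℝ), Continuous y ∧
      ∀ t ∈ Icc (t₀ - h) t₁, y t = z t :=
    ⟨IccExtend hle ((Icc (t₀ - h) t₁).domRestrict z), (continuousOn_iff_continuous_domRestrict.1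
      hzc).Icc_extend', fun t ht => by rw [IccExtend_of_mem _ _ ht]; rfl⟩
  have hsub : ∀ t ∈ Icc t₀ t₁, t ∈ Icc (t₀ - h) t₁ := fun t ht => ⟨by linarith [ht.1], ht.2⟩
  have hy : IsDelaySolution M D B g L σ τ t₀ t₁ y := by
    refine ⟨hyc, fun t ht => ?_⟩
    rw [hyz t (hsub t ht), hyz t₀ (hsub t₀ ⟨le_rfl, h01⟩), hzi t ht]
    congr 1
    refine intervalIntegral.integral_congr fun s hs => ?_
    rw [uIcc_of_le ht.1] at hs
    have hs' : s ∈ Icc t₀ t₁ := ⟨hs.1, hs.2.trans ht.2⟩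
    rw [hyz s (hsub s hs'), hyz (s - τ s) ⟨by linarith [hs.1, (hτ s).2],
      by linarith [hs'.2, (hτ s).1]⟩]
  have hyhist : ∀ s ∈ Icc (t₀ - h) t₀, ‖y s‖ ≤ δ := fun s hs => by
    rw [hyz s ⟨hs.1, hs.2.trans h01⟩]; exact (hist s hs).le
  have hstep : ∀ b ∈ Icc t₀ t₁, (∀ t ∈ Icc t₀ b, ‖y t‖ ≤ r) →
      ‖y b‖ ^ 2 ≤ C * δ ^ 2 * Real.exp (-β * (b - t₀)) := fun b hb hr =>
    exp_estimate_of_forall_norm_le hP hB hc hce hβ hκ hC hσ hτm hτ hy hyhist hb hr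
  have hδr : C * δ ^ 2 < r ^ 2 := by
    have h1 : δ ^ 2 ≤ (r / (C + 1) / 2) ^ 2 := pow_le_pow_left₀ hδ0.le hδ 2
    have h2 : C * (r / (C + 1) / 2) ^ 2 < r ^ 2 := by
      rw [div_pow, div_pow, ← mul_div_assoc, ← mul_div_assoc, div_div,
        div_lt_iff₀ (by positivity)]
      nlinarith [mul_pos hrp hrp, mul_nonneg hC0 (mul_pos hrp hrp).le,
        mul_nonneg (mul_nonneg hC0 hC0) (mul_pos hrp hrp).le]
    exact (mul_le_mul_of_nonneg_left h1 hC0).trans_lt h2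
  have hδr' : δ < r := by
    refine hδ.trans_lt ?_
    rw [div_div, div_lt_iff₀ (by positivity)]
    nlinarith
  -- the solution stays in the ball of radius `r`
  have htrap : ∀ t ∈ Icc t₀ t₁, ‖y t‖ < r := by
    by_contra! hcon
    have hS : IsCompact (Icc t₀ t₁ ∩ {t | r ≤ ‖y t‖}) :=
      isCompact_Icc.inter_right (isClosed_le continuous_const hyc.norm)
    obtain ⟨b, ⟨hbI, hbr⟩, hmin⟩ := hS.exists_isLeast hcon
    have hlt : ∀ t ∈ Ico t₀ b, ‖y t‖ ≤ r := fun t ht => by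
      by_contra! hgt
      exact absurd (hmin ⟨⟨ht.1, ht.2.le.trans hbI.2⟩, hgt.le⟩) (not_le.2 ht.2)
    have hb0 : t₀ ≠ b := by
      rintro rfl
      exact absurd (hbr.trans (hyhist t₀ ⟨by linarith, le_rfl⟩)) (not_le.2 hδr')
    -- The bound passes to the closure, so the estimate applies at the first exit time b itself,
    -- where it yields ‖y b‖² ≤ Cδ² < r², a contradiction.
    have hcl : Icc t₀ b ⊆ {t | ‖y t‖ ≤ r} := by
      rw [← closure_Ico hb0]
      exact (isClosed_le hyc.norm continuous_const).closure_subset_iff.2 hlt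
    have h1 := hstep b hbI hcl
    have h2 : Real.exp (-β * (b - t₀)) ≤ 1 := by
      rw [Real.exp_le_one_iff]; nlinarith [hbI.1]
    have h3 := h1.trans (mul_le_of_le_one_right (by positivity) h2)
    have h4 : r ^ 2 ≤ ‖y b‖ ^ 2 := pow_le_pow_left₀ hrp.le hbr 2
    linarith
  intro t ht
  rw [← hyz t (hsub t ht)]
  exact hstep t ht fun s hs => (htrap s ⟨hs.1, hs.2.trans ht.2⟩).le

end LocalStability

/-! ### Strong convexity of the network potential near the synchronized angles. -/

section NetworkPotential

/-- Mean value inequality: the derivative of the sine is at least cos b on [-b, b]. -/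
theorem cos_mul_le_sin_sub {a e b : ℝ} (hb : b ≤ Real.pi) (ha : |a| ≤ b) (he : 0 ≤ e)
    (hae : |a + e| ≤ b) : Real.cos b * e ≤ Real.sin (a + e) - Real.sin a := by
  have h := Convex.mul_sub_le_image_sub_of_le_deriv (convex_Icc (-b) b)
    Real.continuous_sin.continuousOn Real.differentiable_sin.differentiableOn
    (C := Real.cos b) (fun x hx => ?_) a (abs_le.1 ha) (a + e) (abs_le.1 hae) (by linarith)
  · simpa using h
  · rw [interior_Icc] at hx
    rw [Real.deriv_sin, ← Real.cos_abs x]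
    exact Real.cos_le_cos_of_nonneg_of_le_pi (abs_nonneg x) hb (abs_le.2 ⟨hx.1.le, hx.2.le⟩)

/-- The excess of `-cos` over its tangent is between multiples of the square, as long as the angles
stay in `[-b, b]`. -/
theorem cos_tangent_bounds_of_nonneg {a e b : ℝ} (hb : b ≤ Real.pi) (ha : |a| ≤ b)
    (he : 0 ≤ e) (hae : |a + e| ≤ b) :
    Real.cos b / 2 * e ^ 2 ≤ Real.cos a - Real.cos (a + e) - e * Real.sin a ∧
      Real.cos a - Real.cos (a + e) - e * Real.sin a ≤ 1 / 2 * e ^ 2 := by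
  -- As a function of x, the excess vanishes at 0 and has derivative sin(a + x) - sin a, which lies
  -- between x·cos b and x; comparing with c/2·x² gives both bounds.
  have hd : ∀ x : ℝ, HasDerivAt (fun x => Real.cos a - Real.cos (a + x) - x * Real.sin a)
      (Real.sin (a + x) - Real.sin a) x := by
    intro x
    have h1 := ((hasDerivAt_id x).const_add a).cos.const_sub (Real.cos a)
    have h2 := (hasDerivAt_id x).mul_const (Real.sin a)
    simpa using h1.fun_sub h2
  have hq : ∀ c x : ℝ, HasDerivAt (fun x => c / 2 * x ^ 2) (c * x) x := by
    intro c x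
    refine ((hasDerivAt_pow 2 x).const_mul (c / 2)).congr_deriv ?_
    norm_num; ring
  constructor
  · have hm : MonotoneOn (fun x => (Real.cos a - Real.cos (a + x) - x * Real.sin a)
        - Real.cos b / 2 * x ^ 2) (Icc 0 e) := by
      refine monotoneOn_of_deriv_nonneg (convex_Icc _ _) (fun x _ =>
        ((hd x).fun_sub (hq _ x)).continuousAt.continuousWithinAt) (fun x _ =>
        ((hd x).fun_sub (hq _ x)).differentiableAt.differentiableWithinAt) fun x hx => ?_
      rw [interior_Icc] at hx
      rw [((hd x).fun_sub (hq _ x)).deriv]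
      have := cos_mul_le_sin_sub hb ha hx.1.le (abs_le.2
        ⟨by linarith [(abs_le.1 ha).1, hx.1], by linarith [(abs_le.1 hae).2, hx.2]⟩)
      linarith
    have := hm (left_mem_Icc.2 he) (right_mem_Icc.2 he) he
    simp only [add_zero, sub_self, zero_mul] at this
    norm_num at this
    linarith
  · have hm : MonotoneOn (fun x => 1 / 2 * x ^ 2 -
        (Real.cos a - Real.cos (a + x) - x * Real.sin a)) (Icc 0 e) := by
      refine monotoneOn_of_deriv_nonneg (convex_Icc _ _) (fun x _ =>
        ((hq 1 x).fun_sub (hd x)).continuousAt.continuousWithinAt) (fun x _ =>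
        ((hq 1 x).fun_sub (hd x)).differentiableAt.differentiableWithinAt) fun x hx => ?_
      rw [interior_Icc] at hx
      rw [((hq 1 x).fun_sub (hd x)).deriv]
      have h1 := Real.lipschitzWith_sin.dist_le_mul (a + x) a
      rw [Real.dist_eq, Real.dist_eq, add_sub_cancel_left, abs_of_nonneg hx.1.le] at h1
      have h2 := (le_abs_self _).trans h1
      simp only [NNReal.coe_one] at h2
      linarith
    have := hm (left_mem_Icc.2 he) (right_mem_Icc.2 he) he
    simp only [add_zero, sub_self, zero_mul] at this
    norm_num at this
    linarith

/-- Negative e reduces to the previous case through the symmetry (a, e) ↦ (-a, -e). The third bound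
supplies the monotonicity of the gradient. -/
theorem cos_tangent_bounds {a e b : ℝ} (hb : b ≤ Real.pi) (ha : |a| ≤ b) (hae : |a + e| ≤ b) :
    Real.cos b / 2 * e ^ 2 ≤ Real.cos a - Real.cos (a + e) - e * Real.sin a ∧
      Real.cos a - Real.cos (a + e) - e * Real.sin a ≤ 1 / 2 * e ^ 2 ∧
      Real.cos b * e ^ 2 ≤ (Real.sin (a + e) - Real.sin a) * e := by
  rcases le_total 0 e with he | he
  · obtain ⟨h1, h2⟩ := cos_tangent_bounds_of_nonneg hb ha he hae
    refine ⟨h1, h2, ?_⟩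
    have := mul_le_mul_of_nonneg_right (cos_mul_le_sin_sub hb ha he hae) he
    linarith
  · have ha' : |-a| ≤ b := by rwa [abs_neg]
    have hae' : |-a + -e| ≤ b := by rwa [← neg_add, abs_neg]
    have he' : 0 ≤ -e := by linarith
    obtain ⟨h1, h2⟩ := cos_tangent_bounds_of_nonneg hb ha' he' hae'
    have h3 := mul_le_mul_of_nonneg_right (cos_mul_le_sin_sub hb ha' he' hae') he'
    rw [← neg_add, Real.cos_neg, Real.cos_neg, Real.sin_neg] at h1 h2
    rw [← neg_add, Real.sin_neg, Real.sin_neg] at h3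
    refine ⟨by linarith, by linarith, by linarith⟩

variable {n : ℕ} (N : PowerNetwork n)

/-- Coupling strength of the line between nodes `i` and `k`. -/
noncomputable def PowerNetwork.weight (i k : Fin n) : ℝ := |N.B i k| * N.V i * N.V k

theorem PowerNetwork.weight_nonneg (i k : Fin n) : 0 ≤ N.weight i k :=
  mul_nonneg (mul_nonneg (abs_nonneg _) (N.V_pos i).le) (N.V_pos k).le

theorem PowerNetwork.weight_pos {i k : Fin n} (h : N.B i k ≠ 0) : 0 < N.weight i k :=
  mul_pos (mul_pos (abs_pos.2 h) (N.V_pos i)) (N.V_pos k)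

/-- The flow from i to k is minus the flow from k to i, so the two contributions of a line combine
into one term with v i - v k. -/
theorem PowerNetwork.gradU_dotProduct (θ v : Fin n → ℝ) :
    N.gradU θ ⬝ᵥ v = ∑ i, ∑ k, if i < k then
      N.weight i k * Real.sin (θ i - θ k) * (v i - v k) else 0 := by
  set f : Fin n → Fin n → ℝ := fun i k => N.weight i k * Real.sin (θ i - θ k) with hf
  have hanti : ∀ i k, f i k = - f k i := by
    intro i k
    simp only [hf, weight]; rw [N.B_symm i k, ← neg_sub (θ k), Real.sin_neg]; ring
  have e1 : N.gradU θ ⬝ᵥ v = ∑ i, ∑ k, f i k * v i := by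
    simp [dotProduct, PowerNetwork.gradU, hf, Finset.sum_mul, weight]
  have e2 : ∀ i k, f i k * v i =
      (if i < k then f i k * v i else 0) + (if k < i then f i k * v i else 0) := by
    intro i k
    rcases lt_trichotomy i k with h | h | h
    · simp [h, h.le.not_gt]
    · subst h; simp [hf]
    · simp [h, h.le.not_gt]
  rw [e1, Finset.sum_congr rfl fun i _ => Finset.sum_congr rfl fun k _ => e2 i k]
  simp only [Finset.sum_add_distrib]
  rw [Finset.sum_comm (f := fun i k => if k < i then f i k * v i else 0), ← Finset.sum_add_distrib]
  refine Finset.sum_congr rfl fun i _ => ?_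
  rw [← Finset.sum_add_distrib]
  refine Finset.sum_congr rfl fun k _ => ?_
  split_ifs
  · rw [hanti k i]; simp only [hf]; ring
  · simp

theorem PowerNetwork.contDiff_potential : ContDiff ℝ 1 N.potential := by
  unfold PowerNetwork.potential
  refine ContDiff.neg (ContDiff.sum fun i _ => ContDiff.sum fun k _ => ?_)
  split_ifs
  · fun_prop
  · exact contDiff_const

theorem PowerNetwork.continuous_gradU : Continuous N.gradU := by
  unfold PowerNetwork.gradU
  fun_prop

/-- Potential of the error system: the excess of the network potential over its tangent at the
synchronized angles, and a term which penalizes uniform rotations. -/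
noncomputable def PowerNetwork.errorPotential (θs a : Fin n → ℝ) (μ : ℝ) (θ : Fin n → ℝ) : ℝ :=
  N.potential (θ + θs) - N.potential θs - N.gradU θs ⬝ᵥ θ + μ / 2 * (a ⬝ᵥ θ) ^ 2

/-- Gradient of the potential of the error system. -/
noncomputable def PowerNetwork.errorGrad (θs a : Fin n → ℝ) (μ : ℝ) (θ : Fin n → ℝ) : Fin n → ℝ :=
  N.gradU (θ + θs) - N.gradU θs + (μ * (a ⬝ᵥ θ)) • a

theorem PowerNetwork.contDiff_errorPotential (θs a : Fin n → ℝ) (μ : ℝ) :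
    ContDiff ℝ 1 (N.errorPotential θs a μ) := by
  have h1 : ContDiff ℝ 1 fun θ : Fin n → ℝ => N.potential (θ + θs) :=
    N.contDiff_potential.comp (by fun_prop)
  have h2 : ∀ b : Fin n → ℝ, ContDiff ℝ 1 fun θ : Fin n → ℝ => b ⬝ᵥ θ := fun b => by
    unfold dotProduct
    fun_prop
  exact ((h1.sub contDiff_const).sub (h2 _)).add (contDiff_const.mul ((h2 a).pow 2))

/-- Differentiability is already known, so it suffices to compute directional derivatives and use
their uniqueness. -/
theorem PowerNetwork.fderiv_errorPotential (θs a : Fin n → ℝ) (μ : ℝ) (θ v : Fin n → ℝ) :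
    fderiv ℝ (N.errorPotential θs a μ) θ v = N.errorGrad θs a μ θ ⬝ᵥ v := by
  have h1 : HasDerivAt (fun s : ℝ => N.errorPotential θs a μ (θ + s • v))
      (fderiv ℝ (N.errorPotential θs a μ) θ v) 0 := by
    have hl : HasDerivAt (fun s : ℝ => θ + s • v) v 0 := by
      simpa using ((hasDerivAt_id (0 : ℝ)).smul_const v).const_add θ
    have hf := (((N.contDiff_errorPotential θs a μ).differentiable one_ne_zero) θ).hasFDerivAt
    have hf' : HasFDerivAt (N.errorPotential θs a μ) (fderiv ℝ (N.errorPotential θs a μ) θ)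
        (θ + (0 : ℝ) • v) := by simpa using hf
    exact hf'.comp_hasDerivAt (0 : ℝ) hl
  have h2 : HasDerivAt (fun s : ℝ => N.errorPotential θs a μ (θ + s • v))
      (N.errorGrad θs a μ θ ⬝ᵥ v) 0 := by
    have hlin : ∀ b : Fin n → ℝ, HasDerivAt (fun s : ℝ => b ⬝ᵥ (θ + s • v)) (b ⬝ᵥ v) 0 := by
      intro b
      have := ((hasDerivAt_id (0 : ℝ)).mul_const (b ⬝ᵥ v)).const_add (b ⬝ᵥ θ)
      simp only [one_mul, id] at this
      refine this.congr_of_eventuallyEq (Eventually.of_forall fun s => ?_)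
      simp [dotProduct_add, dotProduct_smul]
    have hp := N.hasDerivAt_potential (θ + θs) v
    have hp' : HasDerivAt (fun s : ℝ => N.potential (θ + s • v + θs))
        (N.gradU (θ + θs) ⬝ᵥ v) 0 := by
      refine hp.congr_of_eventuallyEq (Eventually.of_forall fun s => ?_)
      simp only [add_right_comm]
    have := ((hp'.sub_const (N.potential θs)).sub (hlin (N.gradU θs))).add
      (((hlin a).pow 2).const_mul (μ / 2))
    refine this.congr_deriv ?_
    simp [errorGrad, add_dotProduct, sub_dotProduct, smul_dotProduct]
    ring
  exact h1.unique h2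

theorem PowerNetwork.errorPotential_eq (θs a : Fin n → ℝ) (μ : ℝ) (θ : Fin n → ℝ) :
    N.errorPotential θs a μ θ = (∑ i, ∑ k, if i < k then N.weight i k *
      (Real.cos (θs i - θs k) - Real.cos (θs i - θs k + (θ i - θ k))
        - (θ i - θ k) * Real.sin (θs i - θs k)) else 0) + μ / 2 * (a ⬝ᵥ θ) ^ 2 := by
  rw [errorPotential, N.gradU_dotProduct]
  congr 1
  unfold PowerNetwork.potential
  rw [sub_neg_eq_add, neg_add_eq_sub, ← Finset.sum_sub_distrib, ← Finset.sum_sub_distrib]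
  refine Finset.sum_congr rfl fun i _ => ?_
  rw [← Finset.sum_sub_distrib, ← Finset.sum_sub_distrib]
  refine Finset.sum_congr rfl fun k _ => ?_
  split_ifs
  · have : (θ + θs) i - (θ + θs) k = θs i - θs k + (θ i - θ k) := by
      simp only [Pi.add_apply]; ring
    rw [this, weight]; ring
  · simp

theorem PowerNetwork.errorGrad_dotProduct (θs a : Fin n → ℝ) (μ : ℝ) (θ : Fin n → ℝ) :
    N.errorGrad θs a μ θ ⬝ᵥ θ = (∑ i, ∑ k, if i < k then N.weight i k *
      ((Real.sin (θs i - θs k + (θ i - θ k)) - Real.sin (θs i - θs k)) * (θ i - θ k)) else 0)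
        + μ * (a ⬝ᵥ θ) ^ 2 := by
  rw [errorGrad, add_dotProduct, sub_dotProduct, N.gradU_dotProduct, N.gradU_dotProduct,
    smul_dotProduct, smul_eq_mul]
  congr 1
  · rw [← Finset.sum_sub_distrib]
    refine Finset.sum_congr rfl fun i _ => ?_
    rw [← Finset.sum_sub_distrib]
    refine Finset.sum_congr rfl fun k _ => ?_
    split_ifs
    · have : (θ + θs) i - (θ + θs) k = θs i - θs k + (θ i - θ k) := by
        simp only [Pi.add_apply]; ring
      rw [this]; ring
    · simp
  · ring

/-- The quadratic form which the potential of the error system is compared with. -/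
noncomputable def PowerNetwork.quadForm (a θ : Fin n → ℝ) : ℝ :=
  (∑ i, ∑ k, if i < k then N.weight i k * (θ i - θ k) ^ 2 else 0) + (a ⬝ᵥ θ) ^ 2

/-- If the form vanishes, θ is constant along lines, hence constant by connectedness; a·θ = 0 with
positive a then forces θ = 0. The rest is compactness of the unit sphere. -/
theorem PowerNetwork.exists_mul_l2_sq_le_quadForm {a : Fin n → ℝ}
    (ha : ∀ i, 0 < a i) : ∃ c > 0, ∀ θ, c * l2 θ ^ 2 ≤ N.quadForm a θ := by
  have hterm : ∀ (θ : Fin n → ℝ) (i k : Fin n),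
      0 ≤ if i < k then N.weight i k * (θ i - θ k) ^ 2 else 0 := fun θ i k => by
    split_ifs
    · exact mul_nonneg (N.weight_nonneg i k) (sq_nonneg _)
    · exact le_rfl
  refine exists_mul_l2_sq_le ?_ (fun t θ => ?_) (fun θ hθ => ?_)
  · unfold quadForm dotProduct
    refine Continuous.add (continuous_finsetSum _ fun i _ => continuous_finsetSum _ fun k _ => ?_)
      (by fun_prop)
    split_ifs <;> fun_prop
  · simp only [quadForm, mul_add, Finset.mul_sum, dotProduct_smul, smul_eq_mul, Pi.smul_apply]
    congr 1
    · refine Finset.sum_congr rfl fun i _ => Finset.sum_congr rfl fun k _ => ?_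
      split_ifs <;> ring
    · ring
  · have hs0 : 0 ≤ ∑ i, ∑ k, if i < k then N.weight i k * (θ i - θ k) ^ 2 else 0 :=
      Finset.sum_nonneg fun i _ => Finset.sum_nonneg fun k _ => hterm θ i k
    refine lt_of_le_of_ne (add_nonneg hs0 (sq_nonneg _)) fun h0 => hθ ?_
    have hboth := (add_eq_zero_iff_of_nonneg hs0 (sq_nonneg _)).1 h0.symm
    have hlt : ∀ i k, i < k → N.B i k ≠ 0 → θ i = θ k := by
      intro i k hik hB
      have h1 := (Finset.sum_eq_zero_iff_of_nonneg fun i _ =>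
        Finset.sum_nonneg fun k _ => hterm θ i k).1 hboth.1 i (Finset.mem_univ i)
      have h2 := (Finset.sum_eq_zero_iff_of_nonneg fun k _ => hterm θ i k).1 h1 k
        (Finset.mem_univ k)
      rw [if_pos hik] at h2
      have h3 := (mul_eq_zero.1 h2).resolve_left (N.weight_pos hB).ne'
      exact sub_eq_zero.1 (pow_eq_zero_iff two_ne_zero |>.1 h3)
    have hadj : ∀ i k, (SimpleGraph.fromRel fun i k => N.B i k ≠ 0).Adj i k → θ i = θ k := by
      intro i k hik
      rw [SimpleGraph.fromRel_adj] at hik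
      have hB : N.B i k ≠ 0 := hik.2.elim id fun h => by rwa [N.B_symm]
      rcases lt_or_gt_of_ne hik.1 with h | h
      · exact hlt i k h hB
      · exact (hlt k i h (by rwa [N.B_symm])).symm
    have hconst : ∀ i k, θ i = θ k := by
      intro i k
      obtain ⟨w⟩ := N.connected.preconnected i k
      induction w with
      | nil => rfl
      | cons hA _ ih => exact (hadj _ _ hA).trans ih
    have hsum : a ⬝ᵥ θ = 0 := pow_eq_zero_iff two_ne_zero |>.1 hboth.2
    funext i
    have h1 : a ⬝ᵥ θ = (∑ k, a k) * θ i := by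
      rw [dotProduct, Finset.sum_mul]
      exact Finset.sum_congr rfl fun k _ => by rw [hconst k i]
    rw [h1] at hsum
    have hpos : 0 < ∑ k, a k := Finset.sum_pos (fun k _ => ha k) ⟨i, Finset.mem_univ i⟩
    exact (mul_eq_zero.1 hsum).resolve_left hpos.ne'

theorem PowerNetwork.exists_quadForm_le (a : Fin n → ℝ) :
    ∃ C > 0, ∀ θ, N.quadForm a θ ≤ C * l2 θ ^ 2 := by
  refine ⟨(∑ i, ∑ k, N.weight i k * 4) + l2 a ^ 2 + 1, ?_, fun θ => ?_⟩
  · have : 0 ≤ ∑ i, ∑ k, N.weight i k * 4 :=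
      Finset.sum_nonneg fun i _ => Finset.sum_nonneg fun k _ =>
        mul_nonneg (N.weight_nonneg i k) (by norm_num)
    positivity
  · rw [add_mul, add_mul, Finset.sum_mul]
    have h1 : (a ⬝ᵥ θ) ^ 2 ≤ l2 a ^ 2 * l2 θ ^ 2 := by
      rw [← mul_pow]
      exact sq_le_sq' (neg_le_of_abs_le (abs_dotProduct_le a θ)) (dotProduct_le a θ)
    have h2 : ∑ i, ∑ k, (if i < k then N.weight i k * (θ i - θ k) ^ 2 else 0) ≤
        ∑ i, (∑ k, N.weight i k * 4) * l2 θ ^ 2 := by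
      refine Finset.sum_le_sum fun i _ => ?_
      rw [Finset.sum_mul]
      refine Finset.sum_le_sum fun k _ => ?_
      have hw := N.weight_nonneg i k
      have hi : ∀ j, |θ j| ≤ ‖θ‖ := norm_le_pi_norm θ
      have hd : (θ i - θ k) ^ 2 ≤ 4 * l2 θ ^ 2 := by
        have h3 : |θ i - θ k| ≤ 2 * ‖θ‖ := (abs_sub _ _).trans (by linarith [hi i, hi k])
        have h4 := pow_le_pow_left₀ (abs_nonneg _) h3 2
        rw [sq_abs] at h4
        linarith [sq_norm_le_l2_sq θ]
      split_ifs
      · rw [mul_assoc]; exact mul_le_mul_of_nonneg_left hd hw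
      · positivity
    have h5 := sq_nonneg (l2 θ)
    unfold quadForm
    linarith

theorem PowerNetwork.exists_localPotential (hn : 1 ≤ n) {θs a : Fin n → ℝ} {μ : ℝ} (hμ : 0 < μ)
    (ha : ∀ i, 0 < a i) (hang : ∀ i k, N.B i k ≠ 0 → |θs i - θs k| < Real.pi / 2) :
    ∃ r c C, LocalPotential (N.errorPotential θs a μ) (N.errorGrad θs a μ) r c C := by
  obtain ⟨b, hb0, hb, hbe⟩ : ∃ b, 0 ≤ b ∧ b < Real.pi / 2 ∧
      ∀ i k, N.B i k ≠ 0 → |θs i - θs k| ≤ b := by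
    classical
    have : Nonempty (Fin n × Fin n) := ⟨(⟨0, hn⟩, ⟨0, hn⟩)⟩
    obtain ⟨⟨i, k⟩, hmax⟩ := Finite.exists_max fun x : Fin n × Fin n =>
      if N.B x.1 x.2 ≠ 0 then |θs x.1 - θs x.2| else 0
    refine ⟨if N.B i k ≠ 0 then |θs i - θs k| else 0, ?_, ?_, fun i' k' h => ?_⟩
    · split_ifs <;> positivity
    · split_ifs with h
      · exact hang i k h
      · exact Real.pi_div_two_pos
    · have := hmax (i', k')
      simp only [if_pos h] at this
      exact this
  obtain ⟨c₀, hc₀, hc⟩ := N.exists_mul_l2_sq_le_quadForm ha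
  obtain ⟨C₀, hC₀, hC⟩ := N.exists_quadForm_le a
  -- The slack b' - b fixes the radius: ‖θ‖ ≤ (b' - b)/2 moves each angle difference by at most b' -
  -- b, so on every line it stays within b' < π/2, where cos b' is positive.
  obtain ⟨b', hbb', hb'⟩ := exists_between hb
  have hcos : 0 < Real.cos b' := Real.cos_pos_of_mem_Ioo ⟨by linarith [Real.pi_pos], hb'⟩
  have hcos1 : Real.cos b' ≤ 1 := Real.cos_le_one b'
  have hν : 0 < min (Real.cos b' / 2) (μ / 2) := by positivity
  have hbounds : ∀ θ : Fin n → ℝ, ‖θ‖ ≤ (b' - b) / 2 →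
      min (Real.cos b' / 2) (μ / 2) * N.quadForm a θ ≤ N.errorPotential θs a μ θ ∧
      N.errorPotential θs a μ θ ≤ (1 + μ) * N.quadForm a θ ∧
      min (Real.cos b' / 2) (μ / 2) * N.quadForm a θ ≤ N.errorGrad θs a μ θ ⬝ᵥ θ := by
    intro θ hθ
    have hedge : ∀ i k, N.weight i k ≠ 0 → _ := fun i k hw =>
      cos_tangent_bounds (a := θs i - θs k) (e := θ i - θ k) (b := b')
        (by linarith [Real.pi_pos])
        ((hbe i k fun h => hw (by simp [weight, h])).trans hbb'.le) (by
          have h1 := hbe i k fun h => hw (by simp [weight, h])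
          have hi : ∀ j, |θ j| ≤ ‖θ‖ := norm_le_pi_norm θ
          have h2 : |θ i - θ k| ≤ b' - b := (abs_sub _ _).trans (by linarith [hi i, hi k])
          exact (abs_add_le _ _).trans (by linarith))
    have hs := sq_nonneg (a ⬝ᵥ θ)
    have m1 := min_le_left (Real.cos b' / 2) (μ / 2)
    have m2 := min_le_right (Real.cos b' / 2) (μ / 2)
    have hsum : ∀ {F G : Fin n → Fin n → ℝ}, (∀ i k, N.weight i k ≠ 0 → F i k ≤ G i k) →
        (∑ i, ∑ k, if i < k then N.weight i k * F i k else 0) ≤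
          ∑ i, ∑ k, if i < k then N.weight i k * G i k else 0 := by
      intro F G hFG
      refine Finset.sum_le_sum fun i _ => Finset.sum_le_sum fun k _ => ?_
      split_ifs
      · rcases eq_or_ne (N.weight i k) 0 with h | h
        · rw [h, zero_mul, zero_mul]
        · exact mul_le_mul_of_nonneg_left (hFG i k h) (N.weight_nonneg i k)
      · exact le_rfl
    have hmul : ∀ ν : ℝ, ν * N.quadForm a θ =
        (∑ i, ∑ k, if i < k then N.weight i k * (ν * (θ i - θ k) ^ 2) else 0) +
          ν * (a ⬝ᵥ θ) ^ 2 := by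
      intro ν
      rw [quadForm, mul_add, Finset.mul_sum]
      congr 1
      refine Finset.sum_congr rfl fun i _ => ?_
      rw [Finset.mul_sum]
      refine Finset.sum_congr rfl fun k _ => ?_
      split_ifs <;> ring
    rw [hmul, hmul, N.errorPotential_eq, N.errorGrad_dotProduct]
    refine ⟨add_le_add (hsum fun i k hw => ?_) (mul_le_mul_of_nonneg_right m2 hs),
      add_le_add (hsum fun i k hw => ?_) (mul_le_mul_of_nonneg_right (by linarith) hs),
      add_le_add (hsum fun i k hw => ?_) (mul_le_mul_of_nonneg_right (by linarith) hs)⟩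
    · exact (mul_le_mul_of_nonneg_right m1 (sq_nonneg _)).trans (hedge i k hw).1
    · exact (hedge i k hw).2.1.trans (mul_le_mul_of_nonneg_right (by linarith) (sq_nonneg _))
    · exact (mul_le_mul_of_nonneg_right (by linarith) (sq_nonneg _)).trans (hedge i k hw).2.2
  have hlow : ∀ θ, min (Real.cos b' / 2) (μ / 2) * c₀ * l2 θ ^ 2 ≤
      min (Real.cos b' / 2) (μ / 2) * N.quadForm a θ := fun θ => by
    rw [mul_assoc]; exact mul_le_mul_of_nonneg_left (hc θ) hν.le
  refine ⟨(b' - b) / 2, min (Real.cos b' / 2) (μ / 2) * c₀, (1 + μ) * C₀, by linarith,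
    mul_pos hν hc₀, N.contDiff_errorPotential θs a μ, N.fderiv_errorPotential θs a μ, ?_,
    fun θ hθ => (hlow θ).trans (hbounds θ hθ).1, fun θ hθ => (hbounds θ hθ).2.1.trans ?_,
    fun θ hθ => (hlow θ).trans (hbounds θ hθ).2.2⟩
  · unfold errorGrad dotProduct
    have := N.continuous_gradU
    fun_prop
  · rw [mul_assoc]; exact mul_le_mul_of_nonneg_left (hC θ) (by linarith)

end NetworkPotential

/-! ### Scaling, norms and coercivity of the reduced matrices. -/

section Reduction

variable {n : ℕ} {ι C : Type*}

/-- Each directed link uses exactly one channel, so the sum over c removes the channel condition and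
leaves degrees minus adjacency. -/
theorem sum_channelMatrix [Fintype C] [DecidableEq C] (G : SimpleGraph (Fin n))
    (ch : Fin n → Fin n → C) : ∑ c, channelMatrix G ch c = laplacian G := by
  classical
  have h1 : ∑ c, channelMatrix G ch c = ∑ i, ∑ k, if G.Adj i k then
      Matrix.single i i (1 : ℝ) - Matrix.single i k (1 : ℝ) else 0 := by
    unfold channelMatrix
    rw [Finset.sum_comm]
    refine Finset.sum_congr rfl fun i _ => ?_
    rw [Finset.sum_comm]
    refine Finset.sum_congr rfl fun k _ => ?_
    by_cases h : G.Adj i k <;> simp [h]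
  rw [h1]
  ext a b
  have h2 : ∀ i, (∑ k, if G.Adj i k then
      Matrix.single i i (1 : ℝ) - Matrix.single i k (1 : ℝ) else 0) a b =
      if i = a then ∑ k, (if G.Adj a k then ((if a = b then 1 else 0) - if k = b then 1 else 0)
        else (0 : ℝ)) else 0 := by
    intro i
    rw [Matrix.sum_apply]
    by_cases hia : i = a
    · rw [if_pos hia]
      subst hia
      refine Finset.sum_congr rfl fun k _ => ?_
      split_ifs <;> simp_all
    · rw [if_neg hia]
      apply Finset.sum_eq_zero
      intro k _
      split_ifs <;> simp [hia]
  rw [Matrix.sum_apply, Finset.sum_congr rfl fun i _ => h2 i]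
  simp only [Finset.sum_ite_eq', Finset.mem_univ, if_true]
  have h3 : ∀ k, (if G.Adj a k then ((if a = b then 1 else 0) - if k = b then 1 else 0)
      else (0 : ℝ)) = (if G.Adj a k then (if a = b then 1 else 0) else 0) -
        if k = b then (if G.Adj a k then 1 else 0) else 0 := by
    intro k; split_ifs <;> simp
  rw [Finset.sum_congr rfl fun k _ => h3 k, Finset.sum_sub_distrib]
  simp only [Finset.sum_ite_eq', Finset.mem_univ, if_true]
  unfold laplacian SimpleGraph.lapMatrix SimpleGraph.degMatrix
  rw [Matrix.sub_apply, Matrix.diagonal_apply, SimpleGraph.adjMatrix_apply]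
  congr 1
  split_ifs with hab
  · rw [SimpleGraph.degree_eq_sum_if_adj]
  · simp

/-- The scaling matrix `A K^{1/2} W` of the reduction. -/
noncomputable def scaledReduction (K A : Fin n → ℝ) (W : Matrix (Fin n) (Fin (n - 1)) ℝ) :
    Matrix (Fin n) (Fin (n - 1)) ℝ := Matrix.diagonal A * sqrtGain K * W

theorem reduced_eq (K A : Fin n → ℝ) (W : Matrix (Fin n) (Fin (n - 1)) ℝ)
    (X : Matrix (Fin n) (Fin n) ℝ) :
    reduced K A W X = (scaledReduction K A W)ᵀ * X * scaledReduction K A W := by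
  simp only [reduced, scaledReduction, sqrtGain, transpose_mul, diagonal_transpose,
    Matrix.mul_assoc]

theorem reduced_sum {κ : Type*} (s : Finset κ) (K A : Fin n → ℝ)
    (W : Matrix (Fin n) (Fin (n - 1)) ℝ) (X : κ → Matrix (Fin n) (Fin n) ℝ) :
    ∑ c ∈ s, reduced K A W (X c) = reduced K A W (∑ c ∈ s, X c) := by
  simp only [reduced_eq, Matrix.mul_sum, Matrix.sum_mul]

theorem sqrtGain_smul {κ : ℝ} (hκ : 0 ≤ κ) (K : Fin n → ℝ) :
    sqrtGain (κ • K) = √κ • sqrtGain K := by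
  rw [sqrtGain, sqrtGain, ← Matrix.diagonal_smul]
  congr 1
  funext i
  simp [Real.sqrt_mul hκ]

theorem scaledReduction_smul {κ : ℝ} (hκ : 0 ≤ κ) (K A : Fin n → ℝ)
    (W : Matrix (Fin n) (Fin (n - 1)) ℝ) :
    scaledReduction (κ • K) A W = √κ • scaledReduction K A W := by
  rw [scaledReduction, scaledReduction, sqrtGain_smul hκ, Matrix.mul_smul, Matrix.smul_mul]

theorem reduced_smul {κ : ℝ} (hκ : 0 ≤ κ) (K A : Fin n → ℝ)
    (W : Matrix (Fin n) (Fin (n - 1)) ℝ) (X : Matrix (Fin n) (Fin n) ℝ) :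
    reduced (κ • K) A W X = κ • reduced K A W X := by
  rw [reduced_eq, reduced_eq, scaledReduction_smul hκ, transpose_smul, Matrix.smul_mul,
    Matrix.smul_mul, Matrix.mul_smul, smul_smul, Real.mul_self_sqrt hκ]

/-- The kernel vectors for different κ are proportional. Hence constants obtained for the unscaled
gain, uniformly in W, serve for every κ. -/
theorem IsReduction.of_smul {κ : ℝ} (hκ : 0 < κ) {K A : Fin n → ℝ}
    {W : Matrix (Fin n) (Fin (n - 1)) ℝ} (hW : IsReduction (κ • K) A W) : IsReduction K A W := by
  refine ⟨hW.1, ?_⟩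
  have h1 : kernelVec K A = √κ • kernelVec (κ • K) A := by
    funext i
    have := (Real.sqrt_pos.2 hκ).ne'
    simp only [kernelVec, Pi.smul_apply, smul_eq_mul, Real.sqrt_mul hκ.le, mul_inv]
    field_simp
  rw [h1, mulVec_smul, hW.2, smul_zero]

section Norms

open scoped Matrix.Norms.L2Operator

theorem norm_one_le (m : Type*) [Fintype m] [DecidableEq m] : ‖(1 : Matrix m m ℝ)‖ ≤ 1 := by
  rw [← Matrix.diagonal_one, Matrix.l2_opNorm_diagonal]
  exact (pi_norm_le_iff_of_nonneg zero_le_one).2 fun i => by simp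

theorem norm_transpose_eq {m k : Type*} [Fintype m] [Fintype k] [DecidableEq m] [DecidableEq k]
    (X : Matrix m k ℝ) : ‖Xᵀ‖ = ‖X‖ := by
  rw [← conjTranspose_eq_transpose_of_trivial, Matrix.l2_opNorm_conjTranspose]

/-- From ‖W‖² = ‖WᵀW‖. Only an inequality, because for n = 1 there are no columns and the norm is
zero. -/
theorem IsReduction.norm_le {K A : Fin n → ℝ} {W : Matrix (Fin n) (Fin (n - 1)) ℝ}
    (hW : IsReduction K A W) : ‖W‖ ≤ 1 := by
  have h1 := Matrix.l2_opNorm_conjTranspose_mul_self W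
  rw [conjTranspose_eq_transpose_of_trivial, hW.1] at h1
  have h2 := norm_one_le (Fin (n - 1))
  nlinarith [norm_nonneg W]

theorem IsReduction.l2_mulVec {K A : Fin n → ℝ} {W : Matrix (Fin n) (Fin (n - 1)) ℝ}
    (hW : IsReduction K A W) (x : Fin (n - 1) → ℝ) : l2 (W *ᵥ x) ^ 2 = l2 x ^ 2 := by
  rw [l2_sq, l2_sq, dotProduct_mulVec, ← mulVec_transpose, mulVec_mulVec, hW.1, one_mulVec]

theorem norm_sqrtGain_mul_le {K A : Fin n → ℝ} {W : Matrix (Fin n) (Fin (n - 1)) ℝ}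
    (hW : IsReduction K A W) : ‖sqrtGain K * W‖ ≤ ‖sqrtGain K‖ :=
  (Matrix.l2_opNorm_mul _ _).trans (mul_le_of_le_one_right (norm_nonneg _) hW.norm_le)

theorem norm_reduced_le {K A : Fin n → ℝ} {W : Matrix (Fin n) (Fin (n - 1)) ℝ}
    (hW : IsReduction K A W) (X : Matrix (Fin n) (Fin n) ℝ) :
    ‖reduced K A W X‖ ≤ ‖Matrix.diagonal A * sqrtGain K‖ ^ 2 * ‖X‖ := by
  have h1 : ‖scaledReduction K A W‖ ≤ ‖Matrix.diagonal A * sqrtGain K‖ :=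
    (Matrix.l2_opNorm_mul _ _).trans (mul_le_of_le_one_right (norm_nonneg _) hW.norm_le)
  rw [reduced_eq]
  refine (Matrix.l2_opNorm_mul _ _).trans ((mul_le_mul_of_nonneg_right
    (Matrix.l2_opNorm_mul _ _) (norm_nonneg _)).trans ?_)
  rw [norm_transpose_eq]
  calc ‖scaledReduction K A W‖ * ‖X‖ * ‖scaledReduction K A W‖
      = ‖scaledReduction K A W‖ ^ 2 * ‖X‖ := by ring
    _ ≤ _ := mul_le_mul_of_nonneg_right (pow_le_pow_left₀ (norm_nonneg _) h1 2) (norm_nonneg _)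

theorem exists_norm_reduced_le [Finite ι] (K A : Fin n → ℝ) (X : ι → Matrix (Fin n) (Fin n) ℝ) :
    ∃ b, 0 ≤ b ∧ ∀ (W : Matrix (Fin n) (Fin (n - 1)) ℝ), IsReduction K A W → ∀ ℓ,
      ‖reduced K A W (X ℓ)‖ ≤ b := by
  obtain ⟨b, hb⟩ := (Set.finite_range fun ℓ => ‖X ℓ‖).bddAbove
  refine ⟨‖Matrix.diagonal A * sqrtGain K‖ ^ 2 * |b|, by positivity, fun W hW ℓ => ?_⟩
  exact (norm_reduced_le hW _).trans (mul_le_mul_of_nonneg_left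
    ((hb ⟨ℓ, rfl⟩).trans (le_abs_self b)) (by positivity))

end Norms

theorem dotProduct_reduced_mulVec (K A : Fin n → ℝ) (W : Matrix (Fin n) (Fin (n - 1)) ℝ)
    (X : Matrix (Fin n) (Fin n) ℝ) (x : Fin (n - 1) → ℝ) :
    x ⬝ᵥ reduced K A W X *ᵥ x = ((Matrix.diagonal A * sqrtGain K) *ᵥ (W *ᵥ x)) ⬝ᵥ
      X *ᵥ ((Matrix.diagonal A * sqrtGain K) *ᵥ (W *ᵥ x)) := by
  rw [reduced_eq, scaledReduction, mulVec_mulVec, ← mulVec_mulVec, ← mulVec_mulVec,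
    dotProduct_mulVec, vecMul_transpose]

/-- On a connected graph the reduced Laplacian is coercive, uniformly in the reduction. -/
theorem exists_reduced_laplacian_coercive {G : SimpleGraph (Fin n)} (hG : G.Connected)
    {K A : Fin n → ℝ} (hK : ∀ i, 0 < K i) (hA : ∀ i, 0 < A i) :
    ∃ c > 0, ∀ W, IsReduction K A W → ∀ x,
      c * l2 x ^ 2 ≤ x ⬝ᵥ reduced K A W (laplacian G) *ᵥ x := by
  classical
  set Bm := Matrix.diagonal A * sqrtGain K with hBm
  set v := kernelVec K A with hv
  have hpsd : ∀ y : Fin n → ℝ, 0 ≤ y ⬝ᵥ laplacian G *ᵥ y := by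
    intro y
    have := (SimpleGraph.posSemidef_lapMatrix ℝ G).dotProduct_mulVec_nonneg y
    rw [star_trivial] at this
    unfold laplacian
    convert this
  have hzero : ∀ y : Fin n → ℝ, y ⬝ᵥ laplacian G *ᵥ y = 0 → ∀ i j, y i = y j := by
    intro y hy i j
    refine (G.lapMatrix_toLinearMap₂'_apply'_eq_zero_iff_forall_reachable y).1 ?_ i j
      (hG.preconnected i j)
    rw [Matrix.toLinearMap₂'_apply']
    unfold laplacian at hy
    convert hy
  -- Uniformity in W: this form lives on all of ℝⁿ and does not mention W; its penalty (v·y)²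
  -- vanishes on the range of every reduction.
  have hexists : ∃ c > 0, ∀ y, c * l2 y ^ 2 ≤
      (Bm *ᵥ y) ⬝ᵥ laplacian G *ᵥ (Bm *ᵥ y) + (v ⬝ᵥ y) ^ 2 := by
    refine exists_mul_l2_sq_le ?_ (fun t y => ?_) (fun y hy => ?_)
    · have h1 : Continuous fun y : Fin n → ℝ => Bm *ᵥ y :=
        Continuous.matrix_mulVec continuous_const continuous_id
      exact (h1.dotProduct (Continuous.matrix_mulVec continuous_const h1)).add
        ((continuous_const.dotProduct continuous_id).pow 2)
    · simp only [mulVec_smul, dotProduct_smul, smul_dotProduct, smul_eq_mul]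
      ring
    · refine lt_of_le_of_ne (add_nonneg (hpsd _) (sq_nonneg _)) fun h0 => hy ?_
      obtain ⟨h1, h2⟩ := (add_eq_zero_iff_of_nonneg (hpsd _) (sq_nonneg _)).1 h0.symm
      have h3 := hzero _ h1
      have h2' : v ⬝ᵥ y = 0 := pow_eq_zero_iff two_ne_zero |>.1 h2
      have hBy : ∀ i, (Bm *ᵥ y) i = A i * √(K i) * y i := by
        intro i
        rw [hBm, sqrtGain, Matrix.diagonal_mul_diagonal, Matrix.mulVec_diagonal]
      have hpos : ∀ i, 0 < A i * √(K i) := fun i => mul_pos (hA i) (Real.sqrt_pos.2 (hK i))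
      have hvi : ∀ i, v i = (A i * √(K i))⁻¹ := fun i => by
        rw [hv, kernelVec, mul_inv]; ring
      -- On the zero set of the Laplacian form, AK^{1/2}y is constant, that is, y is a multiple of
      -- v.
      have hyv : ∀ j i, y i = (Bm *ᵥ y) j * v i := by
        intro j i
        rw [h3 j i, hBy, hvi, mul_comm _ (y i), mul_assoc, mul_inv_cancel₀ (hpos i).ne', mul_one]
      funext j
      have h4 : v ⬝ᵥ y = (Bm *ᵥ y) j * (v ⬝ᵥ v) := by
        rw [dotProduct, dotProduct, Finset.mul_sum]
        exact Finset.sum_congr rfl fun i _ => by rw [hyv j i]; ring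
      have h5 : 0 < v ⬝ᵥ v := by
        refine Finset.sum_pos (fun i _ => ?_) ⟨j, Finset.mem_univ j⟩
        rw [hvi]; have := hpos i; positivity
      rw [h4] at h2'
      rw [hyv j j, (mul_eq_zero.1 h2').resolve_right h5.ne', zero_mul]
      rfl
  obtain ⟨c, hc, hle⟩ := hexists
  refine ⟨c, hc, fun W hW x => ?_⟩
  have h1 := hle (W *ᵥ x)
  have h2 : v ⬝ᵥ W *ᵥ x = 0 := by
    rw [dotProduct_mulVec, ← mulVec_transpose, hW.2, zero_dotProduct]
  rw [hW.l2_mulVec, h2] at h1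
  rw [dotProduct_reduced_mulVec]
  simpa using h1

theorem exists_pos_forall_mul_le {A B : ℝ} (hB : 0 < B) :
    ∃ e > 0, ∀ x, 0 ≤ x → x ≤ e → x * A ≤ B := by
  refine ⟨B / (|A| + 1), by positivity, fun x h0 hx => ?_⟩
  calc x * A ≤ x * (|A| + 1) := mul_le_mul_of_nonneg_left (by linarith [le_abs_self A]) h0
    _ ≤ B / (|A| + 1) * (|A| + 1) := mul_le_mul_of_nonneg_right hx (by positivity)
    _ = B := by field_simp

theorem exists_pos_forall_le_of_finite {α : Type*} [Finite α] {F : α → ℝ} (hF : ∀ a, 0 < F a) :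
    ∃ c > 0, ∀ a, c ≤ F a := by
  rcases isEmpty_or_nonempty α with he | he
  · exact ⟨1, one_pos, fun a => he.elim a⟩
  · obtain ⟨a, ha⟩ := Finite.exists_min F
    exact ⟨F a, hF a, ha⟩

/-- A coercivity constant valid for all graphs of a finite family and all reductions. -/
theorem exists_reduced_laplacian_coercive_of_finite [Finite ι] {G : ι → SimpleGraph (Fin n)}
    (hG : ∀ ℓ, (G ℓ).Connected) {K A : Fin n → ℝ} (hK : ∀ i, 0 < K i) (hA : ∀ i, 0 < A i) :
    ∃ c > 0, ∀ W, IsReduction K A W → ∀ ℓ x,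
      c * l2 x ^ 2 ≤ x ⬝ᵥ reduced K A W (laplacian (G ℓ)) *ᵥ x := by
  choose c hc hle using fun ℓ => exists_reduced_laplacian_coercive (hG ℓ) hK hA
  obtain ⟨c₀, hc₀, hcl⟩ := exists_pos_forall_le_of_finite hc
  exact ⟨c₀, hc₀, fun W hW ℓ x =>
    (mul_le_mul_of_nonneg_right (hcl ℓ) (sq_nonneg _)).trans (hle ℓ W hW x)⟩

open scoped Matrix.Norms.L2Operator in
/-- For small controller gains the reduced error system satisfies the gain bounds. -/
theorem exists_gainBounds [Finite ι] {G : ι → SimpleGraph (Fin n)}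
    (hG : ∀ ℓ, (G ℓ).Connected) {A D K : Fin n → ℝ} (hA : ∀ i, 0 < A i) (hD : ∀ i, 0 < D i)
    (hK : ∀ i, 0 < K i) {h : ℝ} (hh : 0 ≤ h) :
    ∃ κ₀ > 0, ∀ κ : ℝ, 0 < κ → κ < κ₀ → ∀ W, IsReduction (κ • K) A W →
      ∃ d k l lam γ, GainBounds D (sqrtGain (κ • K) * W)
        (fun ℓ => reduced (κ • K) A W (laplacian (G ℓ))) h d k l lam γ := by
  obtain ⟨d, hd, hdD⟩ := exists_pos_forall_le_of_finite hD
  obtain ⟨lam, hlam, hcoer⟩ := exists_reduced_laplacian_coercive_of_finite hG hK hA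
  obtain ⟨l, hl, hlb⟩ := exists_norm_reduced_le K A fun ℓ => laplacian (G ℓ)
  set k := ‖sqrtGain K‖ with hk
  have hk0 : 0 ≤ k := norm_nonneg _
  -- The memory weight will be κγ. In the memory condition the main term κl²h/lam has the same order
  -- κ as κγ/2, so γ has to beat it outright; the extra 1 leaves κ/2 for a remainder of order κ³.
  obtain ⟨γ, hγ⟩ : ∃ γ, γ = 2 * (l ^ 2 * h / lam) + 1 := ⟨_, rfl⟩
  have hγ0 : 0 < γ := by rw [hγ]; positivity
  obtain ⟨e1, p1, q1⟩ := exists_pos_forall_mul_le (A := 2 * γ * h * k ^ 2) (half_pos hd)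
  obtain ⟨e2, p2, q2⟩ := exists_pos_forall_mul_le (A := 4 * γ * h * l ^ 2)
    (B := lam / 4) (by positivity)
  obtain ⟨e3, p3, q3⟩ := exists_pos_forall_mul_le (A := 8 * γ * h ^ 2 * l ^ 2)
    (B := 1 / 2) (by positivity)
  refine ⟨min (min 1 e1) (min e2 e3), lt_min (lt_min one_pos p1) (lt_min p2 p3), ?_⟩
  intro κ hκ hκ0 W hW
  have hW' := hW.of_smul hκ
  obtain ⟨⟨i0, i1⟩, i2, i3⟩ := by simpa only [lt_min_iff] using hκ0
  have hs : √κ ^ 2 = κ := Real.sq_sqrt hκ.le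
  -- The three smallness conditions are linear in κ², and κ < 1 makes bounds on κ sufficient for
  -- them.
  have hκ2 : κ ^ 2 ≤ κ := by nlinarith
  have r1 := q1 (κ ^ 2) (sq_nonneg _) (hκ2.trans i1.le)
  have r2 := q2 (κ ^ 2) (sq_nonneg _) (hκ2.trans i2.le)
  have r3 := q3 (κ ^ 2) (sq_nonneg _) (hκ2.trans i3.le)
  have hnorm : ‖sqrtGain (κ • K) * W‖ ≤ √κ * k := by
    refine (norm_sqrtGain_mul_le hW).trans ?_
    rw [sqrtGain_smul hκ.le, norm_smul, Real.norm_of_nonneg (Real.sqrt_nonneg _)]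
  refine ⟨d, √κ * k, κ * l, κ * lam, κ * γ, ⟨hh, hd, mul_pos hκ hlam, mul_pos hκ hγ0,
    by positivity, by positivity, hdD, fun x => ?_, fun x => ?_, fun ℓ x => ?_, fun ℓ x => ?_,
    ?_, ?_, ?_⟩⟩
  · exact (l2_mulVec_le _ x).trans (mul_le_mul_of_nonneg_right hnorm (l2_nonneg x))
  · refine (l2_mulVec_le _ x).trans (mul_le_mul_of_nonneg_right ?_ (l2_nonneg x))
    rwa [norm_transpose_eq]
  · refine (l2_mulVec_le _ x).trans (mul_le_mul_of_nonneg_right ?_ (l2_nonneg x))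
    rw [reduced_smul hκ.le, norm_smul, Real.norm_of_nonneg hκ.le]
    exact mul_le_mul_of_nonneg_left (hlb W hW' ℓ) hκ.le
  · rw [reduced_smul hκ.le, smul_mulVec, dotProduct_smul, smul_eq_mul, mul_assoc]
    exact mul_le_mul_of_nonneg_left (hcoer W hW' ℓ x) hκ.le
  · calc 2 * (κ * γ) * h * (√κ * k) ^ 2 = √κ ^ 2 * κ * (2 * γ * h * k ^ 2) := by ring
      _ ≤ d / 2 := by rw [hs, ← sq]; exact r1
  · calc 4 * (κ * γ) * h * (κ * l) ^ 2 = κ * (κ ^ 2 * (4 * γ * h * l ^ 2)) := by ring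
      _ ≤ κ * (lam / 4) := mul_le_mul_of_nonneg_left r2 hκ.le
      _ = κ * lam / 4 := by ring
  · calc ((κ * l) ^ 2 / (2 * (κ * lam)) + 4 * (κ * γ) * h * (κ * l) ^ 2) * (2 * h)
        = κ * (l ^ 2 * h / lam + κ ^ 2 * (8 * γ * h ^ 2 * l ^ 2)) := by
          field_simp
          ring
      _ ≤ κ * (l ^ 2 * h / lam + 1 / 2) :=
          mul_le_mul_of_nonneg_left (by linarith) hκ.le
      _ = κ * γ / 2 := by rw [hγ]; ring

end Reduction

/-! ### Quadratic forms of block matrices and their norm bounds. -/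

section QuadraticForms

theorem dotProduct_fromBlocks_mulVec {m k : Type*} [Fintype m] [Fintype k]
    (A : Matrix m m ℝ) (B : Matrix m k ℝ) (E : Matrix k k ℝ) (x : m → ℝ) (y : k → ℝ) :
    Sum.elim x y ⬝ᵥ Matrix.fromBlocks A B Bᵀ E *ᵥ Sum.elim x y =
      x ⬝ᵥ A *ᵥ x + 2 * (x ⬝ᵥ B *ᵥ y) + y ⬝ᵥ E *ᵥ y := by
  have h : y ⬝ᵥ Bᵀ *ᵥ x = x ⬝ᵥ B *ᵥ y := by
    rw [dotProduct_mulVec, vecMul_transpose, dotProduct_comm]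
  rw [Matrix.fromBlocks_mulVec, sumElim_dotProduct_sumElim]
  simp only [Sum.elim_comp_inl, Sum.elim_comp_inr, dotProduct_add, h]
  ring

variable {p m : Type*} [Fintype p] {C : Type*} [Fintype C]

theorem l2_slice_le (y : p × C → ℝ) (c : C) : l2 (fun j => y (j, c)) ≤ l2 y := by
  refine abs_le_of_sq_le_sq' ?_ (l2_nonneg y) |>.2
  rw [l2_sq, l2_sq, dotProduct, dotProduct, Fintype.sum_prod_type]
  refine Finset.sum_le_sum fun j _ => ?_
  exact Finset.single_le_sum (f := fun c => y (j, c) * y (j, c))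
    (fun c _ => mul_self_nonneg _) (Finset.mem_univ c)

theorem blockRow_mulVec (X : C → Matrix m p ℝ) (y : p × C → ℝ) :
    blockRow X *ᵥ y = ∑ c, X c *ᵥ fun j => y (j, c) := by
  funext i
  simp only [blockRow, mulVec, dotProduct, Matrix.of_apply, Finset.sum_apply,
    Fintype.sum_prod_type]
  rw [Finset.sum_comm]

theorem dotProduct_blockDiagonal_mulVec [DecidableEq C] (X : C → Matrix p p ℝ) (y : p × C → ℝ) :
    y ⬝ᵥ Matrix.blockDiagonal X *ᵥ y =
      ∑ c, (fun j => y (j, c)) ⬝ᵥ X c *ᵥ fun j => y (j, c) := by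
  simp only [mulVec, dotProduct, Fintype.sum_prod_type, Matrix.blockDiagonal_apply, ite_mul,
    zero_mul, Finset.sum_ite_eq, Finset.mem_univ, if_true]
  rw [Finset.sum_comm]

variable [Fintype m]

open scoped Matrix.Norms.L2Operator

theorem abs_dotProduct_mulVec_le [DecidableEq p] {X : Matrix m p ℝ} {b : ℝ} (hX : ‖X‖ ≤ b)
    (x : m → ℝ) (y : p → ℝ) : |x ⬝ᵥ X *ᵥ y| ≤ b * (l2 x * l2 y) := by
  have h1 := mul_le_mul_of_nonneg_left (l2_mulVec_le X y) (l2_nonneg x)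
  have h2 := mul_le_mul_of_nonneg_right hX (mul_nonneg (l2_nonneg x) (l2_nonneg y))
  linarith [abs_dotProduct_le x (X *ᵥ y)]

theorem abs_dotProduct_blockRow_mulVec_le [DecidableEq p] {X : C → Matrix m p ℝ} {b : ℝ}
    (hX : ∀ c, ‖X c‖ ≤ b) (x : m → ℝ) (y : p × C → ℝ) :
    |x ⬝ᵥ blockRow X *ᵥ y| ≤ Fintype.card C * b * (l2 x * l2 y) := by
  rw [blockRow_mulVec, dotProduct_sum]
  refine (Finset.abs_sum_le_sum_abs _ _).trans ?_
  have : ∀ c ∈ (Finset.univ : Finset C), |x ⬝ᵥ X c *ᵥ fun j => y (j, c)| ≤ b * (l2 x * l2 y) := by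
    intro c _
    refine (abs_dotProduct_mulVec_le (hX c) x _).trans ?_
    exact mul_le_mul_of_nonneg_left (mul_le_mul_of_nonneg_left (l2_slice_le y c) (l2_nonneg x))
      ((norm_nonneg _).trans (hX c))
  refine (Finset.sum_le_card_nsmul _ _ _ this).trans (le_of_eq ?_)
  rw [nsmul_eq_mul, Finset.card_univ, mul_assoc]

theorem abs_dotProduct_blockDiagonal_mulVec_le [DecidableEq C] [DecidableEq p]
    {X : C → Matrix p p ℝ} {b : ℝ} (hX : ∀ c, ‖X c‖ ≤ b) (y : p × C → ℝ) :
    |y ⬝ᵥ Matrix.blockDiagonal X *ᵥ y| ≤ Fintype.card C * b * l2 y ^ 2 := by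
  rw [dotProduct_blockDiagonal_mulVec]
  refine (Finset.abs_sum_le_sum_abs _ _).trans ?_
  have : ∀ c ∈ (Finset.univ : Finset C),
      |(fun j => y (j, c)) ⬝ᵥ X c *ᵥ fun j => y (j, c)| ≤ b * l2 y ^ 2 := by
    intro c _
    refine (abs_dotProduct_mulVec_le (hX c) _ _).trans ?_
    rw [sq]
    exact mul_le_mul_of_nonneg_left (mul_le_mul (l2_slice_le y c) (l2_slice_le y c) (l2_nonneg _)
      (l2_nonneg y)) ((norm_nonneg _).trans (hX c))
  refine (Finset.sum_le_card_nsmul _ _ _ this).trans (le_of_eq ?_)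
  rw [nsmul_eq_mul, Finset.card_univ, mul_assoc]

theorem norm_mul_mul_le {q r s : Type*} [Fintype q] [Fintype r] [Fintype s] [DecidableEq q]
    [DecidableEq r] [DecidableEq s] [DecidableEq m] {X : Matrix m q ℝ} {Y : Matrix q r ℝ}
    {Z : Matrix r s ℝ} {a b c : ℝ} (hX : ‖X‖ ≤ a) (hY : ‖Y‖ ≤ b) (hZ : ‖Z‖ ≤ c) :
    ‖X * Y * Z‖ ≤ a * b * c := by
  have ha := (norm_nonneg _).trans hX
  have hb := (norm_nonneg _).trans hY
  exact (Matrix.l2_opNorm_mul _ _).trans (mul_le_mul ((Matrix.l2_opNorm_mul _ _).trans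
    (mul_le_mul hX hY (norm_nonneg _) ha)) hZ (norm_nonneg _) (mul_nonneg ha hb))

theorem PosDef.exists_mul_l2_sq_le [DecidableEq m] {M : Matrix m m ℝ} (hM : M.PosDef) :
    ∃ c > 0, ∀ x, c * l2 x ^ 2 ≤ x ⬝ᵥ M *ᵥ x := by
  refine DAI.exists_mul_l2_sq_le ?_ (fun t x => ?_) fun x hx => ?_
  · exact continuous_id.dotProduct (Continuous.matrix_mulVec continuous_const continuous_id)
  · simp only [mulVec_smul, dotProduct_smul, smul_dotProduct, smul_eq_mul]; ring
  · simpa using hM.dotProduct_mulVec_pos hx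

theorem l2_sumElim_sq {p q : Type*} [Fintype p] [Fintype q] (x : p → ℝ) (y : q → ℝ) :
    l2 (Sum.elim x y) ^ 2 = l2 x ^ 2 + l2 y ^ 2 := by
  simp only [l2_sq, sumElim_dotProduct_sumElim]

end QuadraticForms

/-- Positivity of the quadratic form of the stability condition for small gains: `a, u, y, w` are
the lengths of the four components of the argument, and `κ = s²`. -/
theorem lmi_form_pos {d lam c₀ ν E a u y w s f11 f12 f22 f14 f23 f24 f44 q11 q22 q34 : ℝ}
    (hs : 0 < s) (hs1 : s ≤ 1)
    (hνd : ν ≤ d) (hνl : ν ≤ lam) (hνc : ν ≤ c₀) (hE : 0 ≤ E)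
    (hsE : s * (8 * E) < ν) (ha : 0 ≤ a) (hu : 0 ≤ u) (hw : 0 ≤ w)
    (hpos : 0 < a ^ 2 + u ^ 2 + y ^ 2 + w ^ 2)
    (h11 : d * a ^ 2 ≤ q11) (h22 : s ^ 2 * lam * u ^ 2 ≤ q22) (h34 : c₀ * (y ^ 2 + w ^ 2) ≤ q34)
    (b11 : |f11| ≤ s ^ 2 * E * (a * a)) (b12 : |f12| ≤ s ^ 3 * E * (a * u))
    (b22 : |f22| ≤ s ^ 4 * E * (u * u)) (b14 : |f14| ≤ s ^ 3 * E * (a * w))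
    (b23 : |f23| ≤ s ^ 2 * E * (u * y)) (b24 : |f24| ≤ s ^ 2 * E * (u * w))
    (b44 : |f44| ≤ s ^ 4 * E * w ^ 2) :
    0 < q11 + f11 + 2 * f12 + (q22 + f22) + 2 * (f14 + f23 + f24) + (q34 + f44) := by
  -- In the variables (a, U, y, w) the leading form is at least ν times the sum of squares. Each
  -- factor u in an error term consumes one s, and at least one s remains.
  set U := s * u with hU
  have hU0 : 0 ≤ U := mul_nonneg hs.le hu
  have hsE0 : 0 ≤ s * E := mul_nonneg hs.le hE
  have hp2 : s ^ 2 ≤ s := by nlinarith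
  have hp3 : s ^ 3 ≤ s := by nlinarith
  have hp4 : s ^ 4 ≤ s := by nlinarith [sq_nonneg s]
  have g11 : |f11| ≤ s * E * a ^ 2 := b11.trans (by
    have := mul_le_mul_of_nonneg_right hp2 (mul_nonneg hE (mul_nonneg ha ha)); linarith)
  have g12 : |f12| ≤ s * E * (a * U) := b12.trans (by
    have := mul_le_mul_of_nonneg_right hp2 (mul_nonneg hE (mul_nonneg ha hU0))
    calc s ^ 3 * E * (a * u) = s ^ 2 * (E * (a * U)) := by rw [hU]; ring
      _ ≤ s * (E * (a * U)) := this
      _ = _ := by ring)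
  have g22 : |f22| ≤ s * E * U ^ 2 := b22.trans (by
    have := mul_le_mul_of_nonneg_right hp2 (mul_nonneg hE (mul_nonneg hU0 hU0))
    calc s ^ 4 * E * (u * u) = s ^ 2 * (E * (U * U)) := by rw [hU]; ring
      _ ≤ s * (E * (U * U)) := this
      _ = _ := by ring)
  have g14 : |f14| ≤ s * E * (a * w) := b14.trans (by
    have := mul_le_mul_of_nonneg_right hp3 (mul_nonneg hE (mul_nonneg ha hw)); linarith)
  have g23 : |f23| ≤ s * E * (U * y) := b23.trans (le_of_eq (by rw [hU]; ring))
  have g24 : |f24| ≤ s * E * (U * w) := b24.trans (le_of_eq (by rw [hU]; ring))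
  have g44 : |f44| ≤ s * E * w ^ 2 := b44.trans (by
    have := mul_le_mul_of_nonneg_right hp4 (mul_nonneg hE (sq_nonneg w)); linarith)
  -- After this splitting no square collects more than four units of sE, so the margin 8E is ample.
  have amgm : ∀ x y : ℝ, 2 * (s * E * (x * y)) ≤ s * E * (x ^ 2 + y ^ 2) := fun x y => by
    nlinarith [mul_nonneg hsE0 (sq_nonneg (x - y))]
  have m1 := amgm a U
  have m2 := amgm a w
  have m3 := amgm U y
  have m4 := amgm U w
  have hq22 : lam * U ^ 2 ≤ q22 := by rw [hU]; linarith
  have hpos' : 0 < a ^ 2 + U ^ 2 + y ^ 2 + w ^ 2 := by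
    have h1 : s ^ 2 * (a ^ 2 + u ^ 2 + y ^ 2 + w ^ 2) ≤ a ^ 2 + U ^ 2 + y ^ 2 + w ^ 2 := by
      have h2 : s ^ 2 ≤ 1 := hp2.trans hs1
      have h3 := mul_le_mul_of_nonneg_right h2 (sq_nonneg a)
      have h4 := mul_le_mul_of_nonneg_right h2 (sq_nonneg y)
      have h5 := mul_le_mul_of_nonneg_right h2 (sq_nonneg w)
      rw [hU]; linarith
    exact (mul_pos (pow_pos hs 2) hpos).trans_le h1
  have v1 := mul_le_mul_of_nonneg_right hνd (sq_nonneg a)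
  have v2 := mul_le_mul_of_nonneg_right hνl (sq_nonneg U)
  have v3 := mul_le_mul_of_nonneg_right hνc (add_nonneg (sq_nonneg y) (sq_nonneg w))
  have key : s * (8 * E) * (a ^ 2 + U ^ 2 + y ^ 2 + w ^ 2) <
      ν * (a ^ 2 + U ^ 2 + y ^ 2 + w ^ 2) := mul_lt_mul_of_pos_right hsE hpos'
  have z1 := mul_nonneg hsE0 (sq_nonneg a)
  have z2 := mul_nonneg hsE0 (sq_nonneg U)
  have z3 := mul_nonneg hsE0 (sq_nonneg y)
  have z4 := mul_nonneg hsE0 (sq_nonneg w)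
  have k11 := neg_le_of_abs_le g11
  have k12 := neg_le_of_abs_le g12
  have k22 := neg_le_of_abs_le g22
  have k14 := neg_le_of_abs_le g14
  have k23 := neg_le_of_abs_le g23
  have k24 := neg_le_of_abs_le g24
  have k44 := neg_le_of_abs_le g44
  linarith

/-! ### Feasibility of the LMI conditions for small gains. -/

section LMI

variable {n : ℕ} {ι C : Type*} [DecidableEq C]

theorem couplingMatrix_posDef_left {R S12 : C → Matrix (Fin (n - 1)) (Fin (n - 1)) ℝ}
    (hRS : (couplingMatrix R S12).PosDef) (c : C) : (R c).PosDef := by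
  have h := hRS.submatrix (e := fun i : Fin (n - 1) => Sum.inl (i, c)) (fun i j hij => by
    simpa using hij)
  convert h using 1
  ext i j
  simp [couplingMatrix, Matrix.blockDiagonal_apply]

theorem laplacian_transpose (G : SimpleGraph (Fin n)) : (laplacian G)ᵀ = laplacian G := by
  classical
  exact SimpleGraph.isSymm_lapMatrix (R := ℝ) G

theorem reduced_laplacian_transpose (K A : Fin n → ℝ) (W : Matrix (Fin n) (Fin (n - 1)) ℝ)
    (G : SimpleGraph (Fin n)) :
    (reduced K A W (laplacian G))ᵀ = reduced K A W (laplacian G) := by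
  rw [reduced_eq, transpose_mul, transpose_mul, transpose_transpose, laplacian_transpose,
    Matrix.mul_assoc]

variable [Fintype C]

theorem Psi_isHermitian (D A K : Fin n → ℝ) (W : Matrix (Fin n) (Fin (n - 1)) ℝ)
    (G : SimpleGraph (Fin n)) (ch : Fin n → Fin n → C) (h : C → ℝ)
    {R S : C → Matrix (Fin (n - 1)) (Fin (n - 1)) ℝ} (hR : ∀ c, (R c)ᵀ = R c)
    (hS : ∀ c, (S c)ᵀ = S c) (S12 : C → Matrix (Fin (n - 1)) (Fin (n - 1)) ℝ) :
    (Psi D A K W G ch h R S S12).IsHermitian := by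
  have hRb : (∑ c, h c ^ 2 • R c)ᵀ = ∑ c, h c ^ 2 • R c := by
    rw [transpose_sum]
    exact Finset.sum_congr rfl fun c _ => by rw [transpose_smul, hR]
  have hL := reduced_laplacian_transpose K A W G
  have hbR : (Matrix.blockDiagonal R)ᵀ = Matrix.blockDiagonal R := by
    rw [Matrix.blockDiagonal_transpose]; simp only [hR]
  have hbS : (Matrix.blockDiagonal S)ᵀ = Matrix.blockDiagonal S := by
    rw [Matrix.blockDiagonal_transpose]; simp only [hS]
  unfold Psi
  refine IsHermitian.fromBlocks (IsHermitian.fromBlocks ?_ ?_ ?_) ?_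
    (IsHermitian.fromBlocks ?_ ?_ ?_)
  · rw [IsHermitian, conjTranspose_eq_transpose_of_trivial, transpose_sub, diagonal_transpose]
    simp only [transpose_mul, transpose_transpose, hRb, Matrix.mul_assoc]
  · rw [conjTranspose_eq_transpose_of_trivial]
  · rw [IsHermitian, conjTranspose_eq_transpose_of_trivial, transpose_sub]
    simp only [transpose_mul, hL, hRb, Matrix.mul_assoc]
  · rw [conjTranspose_eq_transpose_of_trivial]
  · rw [IsHermitian, conjTranspose_eq_transpose_of_trivial, transpose_add, hbR, hbS]
  · rw [conjTranspose_eq_transpose_of_trivial]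
  · rw [IsHermitian, conjTranspose_eq_transpose_of_trivial, transpose_add, transpose_add, hbR, hbS,
      Matrix.blockDiagonal_transpose]
    simp only [transpose_neg, transpose_mul, transpose_transpose, hRb, Matrix.mul_assoc]

/-- The terms are grouped as `lmi_form_pos` takes them. In the lower right block, S contributes its
form at x₃ + x₄ and an antisymmetric remainder, which vanishes for symmetric S. -/
theorem Psi_quadForm (D A K : Fin n → ℝ) (W : Matrix (Fin n) (Fin (n - 1)) ℝ)
    (G : SimpleGraph (Fin n)) (ch : Fin n → Fin n → C) (h : C → ℝ)
    (R S S12 : C → Matrix (Fin (n - 1)) (Fin (n - 1)) ℝ) (x₁ : Fin n → ℝ)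
    (x₂ : Fin (n - 1) → ℝ) (x₃ x₄ : Fin (n - 1) × C → ℝ) :
    let KW := sqrtGain K * W
    let Lb := reduced K A W (laplacian G)
    let T := fun c => reduced K A W (channelMatrix G ch c)
    let Rb := ∑ c, h c ^ 2 • R c
    Sum.elim (Sum.elim x₁ x₂) (Sum.elim x₃ x₄) ⬝ᵥ
        Psi D A K W G ch h R S S12 *ᵥ Sum.elim (Sum.elim x₁ x₂) (Sum.elim x₃ x₄) =
      x₁ ⬝ᵥ Matrix.diagonal D *ᵥ x₁ + -(x₁ ⬝ᵥ (KW * Rb * KWᵀ) *ᵥ x₁)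
      + 2 * (x₁ ⬝ᵥ (KW * Rb * Lb) *ᵥ x₂)
      + (x₂ ⬝ᵥ Lb *ᵥ x₂ + -(x₂ ⬝ᵥ (Lb * Rb * Lb) *ᵥ x₂))
      + 2 * (x₁ ⬝ᵥ (blockRow fun c => -(KW * Rb * T c)) *ᵥ x₄ + -(x₂ ⬝ᵥ blockRow S *ᵥ x₃)
        + x₂ ⬝ᵥ (blockRow fun c => Lb * Rb * T c - S c - (1 / 2 : ℝ) • T c) *ᵥ x₄)
      + ((Sum.elim x₃ x₄ ⬝ᵥ couplingMatrix R S12 *ᵥ Sum.elim x₃ x₄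
          + (x₃ + x₄) ⬝ᵥ Matrix.blockDiagonal S *ᵥ (x₃ + x₄)
          + (x₃ ⬝ᵥ Matrix.blockDiagonal S *ᵥ x₄ - x₄ ⬝ᵥ Matrix.blockDiagonal S *ᵥ x₃))
        + x₄ ⬝ᵥ (Matrix.blockDiagonal fun c => -((T c)ᵀ * Rb * T c)) *ᵥ x₄) := by
  intro KW Lb T Rb
  unfold Psi couplingMatrix
  rw [dotProduct_fromBlocks_mulVec, dotProduct_fromBlocks_mulVec, dotProduct_fromBlocks_mulVec,
    dotProduct_fromBlocks_mulVec, Matrix.fromBlocks_mulVec, sumElim_dotProduct_sumElim]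
  simp only [Sum.elim_comp_inl, Sum.elim_comp_inr, zero_mulVec, zero_add, dotProduct_add,
    add_mulVec, sub_mulVec, neg_mulVec, dotProduct_sub, dotProduct_neg, mulVec_add, add_dotProduct]
  ring

open scoped Matrix.Norms.L2Operator in
/-- For small controller gains the stability conditions hold with `S_c` a multiple of the
identity. -/
theorem exists_solvesLMI [Finite ι] {G : ι → SimpleGraph (Fin n)}
    (hG : ∀ ℓ, (G ℓ).Connected) (ch : ι → Fin n → Fin n → C) {A D K : Fin n → ℝ}
    (hA : ∀ i, 0 < A i) (hD : ∀ i, 0 < D i) (hK : ∀ i, 0 < K i) (h : C → ℝ)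
    {R S12 : C → Matrix (Fin (n - 1)) (Fin (n - 1)) ℝ} (hRS : (couplingMatrix R S12).PosDef) :
    ∃ κ₀ > 0, ∀ κ : ℝ, 0 < κ → κ < κ₀ → ∀ W, IsReduction (κ • K) A W →
      ∃ S, SolvesLMI D A (κ • K) W G ch h R S S12 := by
  obtain ⟨d, hd, hdD⟩ := exists_pos_forall_le_of_finite hD
  obtain ⟨lam, hlam, hcoer⟩ := exists_reduced_laplacian_coercive_of_finite hG hK hA
  obtain ⟨bL, hbL0, hbL⟩ := exists_norm_reduced_le K A fun ℓ => laplacian (G ℓ)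
  obtain ⟨bT, hbT0, hbT⟩ := exists_norm_reduced_le K A fun x : ι × C =>
    channelMatrix (G x.1) (ch x.1) x.2
  obtain ⟨c₀, hc₀, hcoup⟩ := PosDef.exists_mul_l2_sq_le hRS
  obtain ⟨b, hb⟩ : ∃ b, b = max bL bT := ⟨_, rfl⟩
  have hb0 : 0 ≤ b := by rw [hb]; exact hbL0.trans (le_max_left _ _)
  obtain ⟨k, hk⟩ : ∃ k, k = ‖sqrtGain K‖ := ⟨_, rfl⟩
  have hk0 : 0 ≤ k := by rw [hk]; exact norm_nonneg _
  obtain ⟨ρ, hρ⟩ : ∃ ρ, ρ = ‖∑ c, h c ^ 2 • R c‖ := ⟨_, rfl⟩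
  have hρ0 : 0 ≤ ρ := by rw [hρ]; exact norm_nonneg _
  obtain ⟨e, he⟩ : ∃ e, e = k * ρ * k + k * ρ * b + b * ρ * b + 1 + b := ⟨_, rfl⟩
  have p1 : 0 ≤ k * ρ * k := by positivity
  have p2 : 0 ≤ k * ρ * b := by positivity
  have p3 : 0 ≤ b * ρ * b := by positivity
  have he0 : 0 ≤ e := by rw [he]; positivity
  obtain ⟨E, hE⟩ : ∃ E, E = (Fintype.card C + 1) * e := ⟨_, rfl⟩
  have hE0 : 0 ≤ E := by rw [hE]; positivity
  have heE : e ≤ E := by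
    rw [hE, add_mul, one_mul]
    exact le_add_of_nonneg_left (by positivity)
  have hCE : Fintype.card C * e ≤ E := by
    rw [hE, add_mul, one_mul]
    exact le_add_of_nonneg_right he0
  obtain ⟨ν, hν, hνd, hνl, hνc⟩ : ∃ ν > 0, ν ≤ d ∧ ν ≤ lam ∧ ν ≤ c₀ :=
    ⟨min d (min lam c₀), lt_min hd (lt_min hlam hc₀), min_le_left _ _,
      (min_le_right _ _).trans (min_le_left _ _), (min_le_right _ _).trans (min_le_right _ _)⟩
  obtain ⟨e₀, he₀, hsmall⟩ := exists_pos_forall_mul_le (A := 8 * E) (half_pos hν)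
  -- The threshold is squared because smallness is required of s = √κ.
  refine ⟨min 1 e₀ ^ 2, pow_pos (lt_min one_pos he₀) 2, fun κ hκ hκ0 W hW => ?_⟩
  have hW' := hW.of_smul hκ
  obtain ⟨s, hs0, hsκ⟩ : ∃ s > 0, κ = s ^ 2 :=
    ⟨√κ, Real.sqrt_pos.2 hκ, (Real.sq_sqrt hκ.le).symm⟩
  have hsmin : s < min 1 e₀ := lt_of_pow_lt_pow_left₀ 2 (lt_min one_pos he₀).le (by rwa [← hsκ])
  have hs1 : s ≤ 1 := (hsmin.trans_le (min_le_left _ _)).le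
  have hsE : s * (8 * E) < ν :=
    (hsmall s hs0.le (hsmin.trans_le (min_le_right _ _)).le).trans_lt (half_lt_self hν)
  have hsq : √κ = s := by rw [hsκ, Real.sqrt_sq hs0.le]
  have hRpos := couplingMatrix_posDef_left hRS
  have hSpos : ∀ _ : C, (κ • (1 : Matrix (Fin (n - 1)) (Fin (n - 1)) ℝ)).PosDef := fun _ =>
    PosDef.one.smul hκ
  have hsymm : ∀ {M : Matrix (Fin (n - 1)) (Fin (n - 1)) ℝ}, M.PosDef → Mᵀ = M := fun hM => by
    rw [← conjTranspose_eq_transpose_of_trivial]; exact hM.isHermitian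
  -- S of order κ is small enough in the rows coupled to x₂, where only κ·lam is available, and
  -- contributes nonnegatively to the lower right block.
  refine ⟨fun _ => κ • 1, hRpos, hSpos, fun ℓ => ?_, hRS.posSemidef⟩
  have hKW : ‖sqrtGain (κ • K) * W‖ ≤ s * k := by
    refine (norm_sqrtGain_mul_le hW).trans ?_
    rw [sqrtGain_smul hκ.le, norm_smul, Real.norm_of_nonneg (Real.sqrt_nonneg _), hsq, hk]
  have hLb : ‖reduced (κ • K) A W (laplacian (G ℓ))‖ ≤ s ^ 2 * b := by
    rw [reduced_smul hκ.le, norm_smul, Real.norm_of_nonneg hκ.le, hsκ, hb]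
    exact mul_le_mul_of_nonneg_left ((hbL W hW' ℓ).trans (le_max_left _ _)) (sq_nonneg s)
  have hT : ∀ c, ‖reduced (κ • K) A W (channelMatrix (G ℓ) (ch ℓ) c)‖ ≤ s ^ 2 * b := fun c => by
    rw [reduced_smul hκ.le, norm_smul, Real.norm_of_nonneg hκ.le, hsκ, hb]
    exact mul_le_mul_of_nonneg_left ((hbT W hW' (ℓ, c)).trans (le_max_right _ _)) (sq_nonneg s)
  have hRb : ‖∑ c, h c ^ 2 • R c‖ ≤ ρ := hρ.ge
  have hKWt : ‖(sqrtGain (κ • K) * W)ᵀ‖ ≤ s * k := by rwa [norm_transpose_eq]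
  have hTt : ∀ c, ‖(reduced (κ • K) A W (channelMatrix (G ℓ) (ch ℓ) c))ᵀ‖ ≤ s ^ 2 * b :=
    fun c => by rw [norm_transpose_eq]; exact hT c
  have hS1 : ‖κ • (1 : Matrix (Fin (n - 1)) (Fin (n - 1)) ℝ)‖ ≤ s ^ 2 := by
    rw [norm_smul, Real.norm_of_nonneg hκ.le, hsκ]
    exact mul_le_of_le_one_right (sq_nonneg s) (norm_one_le _)
  refine PosDef.of_dotProduct_mulVec_pos (Psi_isHermitian _ _ _ _ _ _ _ (fun c => hsymm (hRpos c))
    (fun c => hsymm (hSpos c)) _) fun x hx => ?_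
  obtain ⟨x₁, x₂, x₃, x₄, rfl⟩ : ∃ x₁ x₂ x₃ x₄,
      x = Sum.elim (Sum.elim x₁ x₂) (Sum.elim x₃ x₄) :=
    ⟨fun i => x (Sum.inl (Sum.inl i)), fun i => x (Sum.inl (Sum.inr i)),
      fun i => x (Sum.inr (Sum.inl i)), fun i => x (Sum.inr (Sum.inr i)), by
        funext i; rcases i with (i | i) | (i | i) <;> rfl⟩
  rw [star_trivial, Psi_quadForm]
  have hbS : Matrix.blockDiagonal (fun _ : C => κ • (1 : Matrix (Fin (n - 1)) (Fin (n - 1)) ℝ)) =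
      κ • (1 : Matrix (Fin (n - 1) × C) (Fin (n - 1) × C) ℝ) := by
    rw [← Matrix.blockDiagonal_one, ← Matrix.blockDiagonal_smul]; rfl
  have hcardC : ∀ t : ℝ, 0 ≤ t → ∀ r : ℝ, 0 ≤ r → ∀ q : ℝ, q ≤ e →
      Fintype.card C * (t * q) * r ≤ t * E * r := fun t ht r hr q hq =>
    mul_le_mul_of_nonneg_right (by
      calc Fintype.card C * (t * q) = t * (Fintype.card C * q) := by ring
        _ ≤ t * (Fintype.card C * e) := mul_le_mul_of_nonneg_left
            (mul_le_mul_of_nonneg_left hq (Nat.cast_nonneg _)) ht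
        _ ≤ t * E := mul_le_mul_of_nonneg_left hCE ht) hr
  have hone : ∀ t : ℝ, 0 ≤ t → ∀ r : ℝ, 0 ≤ r → ∀ q : ℝ, q ≤ e → (t * q) * r ≤ t * E * r :=
    fun t ht r hr q hq => mul_le_mul_of_nonneg_right
      (mul_le_mul_of_nonneg_left (hq.trans heE) ht) hr
  have l1 := l2_nonneg x₁
  have l2' := l2_nonneg x₂
  have l3 := l2_nonneg x₃
  have l4 := l2_nonneg x₄
  refine lmi_form_pos (d := d) (lam := lam) (c₀ := c₀) (ν := ν) (E := E) (a := l2 x₁)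
    (u := l2 x₂) (y := l2 x₃) (w := l2 x₄) (s := s) hs0 hs1 hνd hνl hνc hE0 hsE l1 l2' l4
    ?_ ?_ ?_ ?_ ?_ ?_ ?_ ?_ ?_ ?_ ?_
  · have h1 : l2 (Sum.elim (Sum.elim x₁ x₂) (Sum.elim x₃ x₄)) ^ 2 =
        l2 x₁ ^ 2 + l2 x₂ ^ 2 + l2 x₃ ^ 2 + l2 x₄ ^ 2 := by
      rw [l2_sumElim_sq, l2_sumElim_sq, l2_sumElim_sq]; ring
    rw [← h1]
    exact pow_pos (l2_pos hx) 2
  · refine (le_sum_mul_sq hdD x₁).trans (le_of_eq ?_)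
    rw [dotProduct]
    refine Finset.sum_congr rfl fun i _ => ?_
    rw [Matrix.mulVec_diagonal]; ring
  · rw [reduced_smul hκ.le, smul_mulVec, dotProduct_smul, smul_eq_mul, hsκ, mul_assoc]
    exact mul_le_mul_of_nonneg_left (hcoer W hW' ℓ x₂) (sq_nonneg s)
  · have h1 := hcoup (Sum.elim x₃ x₄)
    rw [l2_sumElim_sq] at h1
    have h2 : 0 ≤ κ * ((x₃ + x₄) ⬝ᵥ (x₃ + x₄)) := by
      rw [← l2_sq]; exact mul_nonneg hκ.le (sq_nonneg _)
    rw [hbS]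
    simp only [smul_mulVec, one_mulVec, dotProduct_smul, smul_eq_mul]
    rw [dotProduct_comm x₄ x₃]
    linarith
  · rw [abs_neg]
    refine (abs_dotProduct_mulVec_le (norm_mul_mul_le hKW hRb hKWt) x₁ x₁).trans ?_
    have := hone (s ^ 2) (sq_nonneg s) (l2 x₁ * l2 x₁) (by positivity) (k * ρ * k) (by linarith)
    linarith
  · refine (abs_dotProduct_mulVec_le (norm_mul_mul_le hKW hRb hLb) x₁ x₂).trans ?_
    have := hone (s ^ 3) (by positivity) (l2 x₁ * l2 x₂) (by positivity) (k * ρ * b) (by linarith)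
    linarith
  · rw [abs_neg]
    refine (abs_dotProduct_mulVec_le (norm_mul_mul_le hLb hRb hLb) x₂ x₂).trans ?_
    have := hone (s ^ 4) (by positivity) (l2 x₂ * l2 x₂) (by positivity) (b * ρ * b) (by linarith)
    linarith
  · refine (abs_dotProduct_blockRow_mulVec_le (b := s ^ 3 * (k * ρ * b)) (fun c => ?_)
      x₁ x₄).trans (hcardC _ (by positivity) _ (by positivity) _ (by linarith))
    rw [norm_neg]
    refine (norm_mul_mul_le hKW hRb (hT c)).trans (le_of_eq (by ring))
  · rw [abs_neg]
    exact (abs_dotProduct_blockRow_mulVec_le (b := s ^ 2 * 1) (fun c => by rw [mul_one]; exact hS1)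
      x₂ x₃).trans (hcardC _ (by positivity) _ (by positivity) _ (by linarith))
  · refine (abs_dotProduct_blockRow_mulVec_le (b := s ^ 2 * (b * ρ * b + 1 + b)) (fun c => ?_)
      x₂ x₄).trans (hcardC _ (by positivity) _ (by positivity) _ (by linarith))
    have h1 := norm_mul_mul_le hLb hRb (hT c)
    have h2 : ‖(1 / 2 : ℝ) • reduced (κ • K) A W (channelMatrix (G ℓ) (ch ℓ) c)‖ ≤ s ^ 2 * b := by
      rw [norm_smul, Real.norm_of_nonneg (by norm_num)]
      have := hT c
      have := norm_nonneg (reduced (κ • K) A W (channelMatrix (G ℓ) (ch ℓ) c))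
      linarith
    refine (norm_sub_le _ _).trans ((add_le_add ((norm_sub_le _ _).trans (add_le_add h1 hS1))
      h2).trans ?_)
    have h4 : s ^ 4 * (b * ρ * b) ≤ s ^ 2 * (b * ρ * b) :=
      mul_le_mul_of_nonneg_right (pow_le_pow_of_le_one hs0.le hs1 (by norm_num)) p3
    linarith
  · refine (abs_dotProduct_blockDiagonal_mulVec_le (b := s ^ 4 * (b * ρ * b)) (fun c => ?_)
      x₄).trans (hcardC _ (by positivity) _ (by positivity) _ (by linarith))
    rw [norm_neg]
    refine (norm_mul_mul_le (hTt c) hRb (hT c)).trans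
      (le_of_eq (by ring))

end LMI

/-! ### The reduced error system as an instance of the delay system. -/

section ReducedErrorSystem

variable {n : ℕ} {C : Type*} [Fintype C]

/-- With a uniform delay, the error system depends on the channels through the Laplacian only. -/
theorem errorField_uniform [DecidableEq C] (N : PowerNetwork n) (D A K : Fin n → ℝ)
    (W : Matrix (Fin n) (Fin (n - 1)) ℝ) (θs : Fin n → ℝ) (G : SimpleGraph (Fin n))
    (ch : Fin n → Fin n → C) (z : State n) (pd : Fin (n - 1) → ℝ) :
    errorField N D A K W θs G ch z (fun _ => pd) =
      delayField N.M D (sqrtGain K * W)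
        (N.errorGrad θs (fun i => (A i)⁻¹) (mu K A)⁻¹) (reduced K A W (laplacian G)) z pd := by
  unfold errorField delayField
  refine Prod.ext rfl (Prod.ext ?_ ?_)
  · funext i
    simp only [PowerNetwork.errorGrad, Pi.add_apply, Pi.sub_apply, Pi.smul_apply, smul_eq_mul,
      dotProduct]
    ring
  · have h1 : (sqrtGain K * W)ᵀ = Wᵀ * sqrtGain K := by
      rw [transpose_mul, sqrtGain, diagonal_transpose]
    simp only [h1, ← sum_channelMatrix G ch, ← reduced_sum, sum_mulVec]

theorem errorField_zero (N : PowerNetwork n) (D A K : Fin n → ℝ)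
    (W : Matrix (Fin n) (Fin (n - 1)) ℝ) (θs : Fin n → ℝ) (G : SimpleGraph (Fin n))
    (ch : Fin n → Fin n → C) : errorField N D A K W θs G ch 0 (fun _ => 0) = 0 := by
  unfold errorField
  refine Prod.ext rfl (Prod.ext ?_ ?_)
  · funext i; simp
  · simp

theorem mu_pos (hn : 1 ≤ n) {K A : Fin n → ℝ} (hK : ∀ i, 0 < K i) (hA : ∀ i, 0 < A i) :
    0 < mu K A := by
  change 0 < ∑ i, kernelVec K A i * kernelVec K A i
  refine Finset.sum_pos (fun i _ => ?_) ⟨⟨0, hn⟩, Finset.mem_univ _⟩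
  have := Real.sqrt_pos.2 (hK i)
  have := hA i
  unfold kernelVec
  positivity

end ReducedErrorSystem

end DAI

theorem corollary1 {n : ℕ} (hn : 1 ≤ n)
    {ι : Type*} [Finite ι] (G : ι → SimpleGraph (Fin n)) (hG : ∀ ℓ, (G ℓ).Connected)
    {C : Type*} [Fintype C] [DecidableEq C] (ch : ι → Fin n → Fin n → C)
    (A D Kc : Fin n → ℝ) (hA : ∀ i, 0 < A i) (hD : ∀ i, 0 < D i) (hKc : ∀ i, 0 < Kc i)
    (h : ℝ) (hh : 0 ≤ h)
    (R S12 : C → Matrix (Fin (n - 1)) (Fin (n - 1)) ℝ)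
    (hRS : (DAI.couplingMatrix R S12).PosDef) :
    ∃ κ₀ > 0, ∀ κ : ℝ, 0 < κ → κ < κ₀ →
      ∀ W : Matrix (Fin n) (Fin (n - 1)) ℝ, DAI.IsReduction (κ • Kc) A W →
        (∃ S, DAI.SolvesLMI D A (κ • Kc) W G ch (fun _ => h) R S S12) ∧
        ∀ (N : DAI.PowerNetwork n) (θs : Fin n → ℝ) (ωs : ℝ) (ps : Fin n → ℝ),
          DAI.IsSynchronizedMotion N D A (κ • Kc) G ch θs ωs ps →
          DAI.IsLUAS h fun (j : DAI.Signal ι h) =>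
            DAI.IsSolution N D A (κ • Kc) W θs G ch h j.σ (fun _ => j.τ) := by
  obtain ⟨κ₁, hκ₁, hlmi⟩ := DAI.exists_solvesLMI hG ch hA hD hKc (fun _ => h) hRS
  obtain ⟨κ₂, hκ₂, hgain⟩ := DAI.exists_gainBounds hG hA hD hKc hh
  -- Both thresholds are fixed before W and the network; inertias and potential enter only the
  -- constants of the exponential estimate, chosen after κ.
  refine ⟨min κ₁ κ₂, lt_min hκ₁ hκ₂, fun κ hκ hκ0 W hW => ⟨?_, ?_⟩⟩
  · exact hlmi κ hκ (hκ0.trans_le (min_le_left _ _)) W hW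
  · intro N θs ωs ps hsync
    obtain ⟨d, k, l, lam, γ, hB⟩ := hgain κ hκ (hκ0.trans_le (min_le_right _ _)) W hW
    have hK : ∀ i, 0 < (κ • Kc) i := fun i => mul_pos hκ (hKc i)
    obtain ⟨r, c, CP, hP⟩ := N.exists_localPotential hn (a := fun i => (A i)⁻¹)
      (inv_pos.2 (DAI.mu_pos hn hK hA)) (fun i => inv_pos.2 (hA i)) hsync.angles
    obtain ⟨δ₀, hδ₀, Cst, hCst, β, hβ, hest⟩ := DAI.exists_exp_estimate N.M_pos hP hB
    refine DAI.isLUAS_of_exp_estimate (fun j t₀ t₁ _ _ => ⟨continuousOn_const, fun t _ => ?_⟩)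
      hδ₀ hCst hβ fun j t₀ t₁ z δ _ h01 hsol hδ hδ0 hist => ?_
    · have h0 : ∀ s, DAI.errorField N D A (κ • Kc) W θs (G (j.σ s)) (ch (j.σ s))
          (0 : DAI.State n) (fun _ => (0 : DAI.State n).2.2) = 0 := fun s =>
        DAI.errorField_zero N D A (κ • Kc) W θs _ _
      simp only [h0, intervalIntegral.integral_zero, add_zero]
    · refine hest j.σ j.τ t₀ t₁ z δ j.σ_meas j.τ_meas j.τ_mem h01 hδ hδ0 hsol.1
        (fun t ht => ?_) hist
      have h1 := hsol.2 t ht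
      simp only [DAI.errorField_uniform] at h1
      exact h1
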